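/- Identify $\mathbb R^2$ with $\mathbb C$ via $z=x_1+\mathrm i x_2$. For $Z\in\mathbb R$ let $$W_Z=\boldsymbol\sigma\cdot(\mathfrak p+\mathfrak A)-\frac{Z}{|x|},\qquad \mathfrak p=-\mathrm i\nabla,\quad \mathfrak A(x)=(-x_2,x_1),\quad \boldsymbol\sigma=(\sigma_1,\sigma_2)\ \text{(Pauli matrices)},$$ be the two-dimensional Weyl operator with a homogeneous magnetic field (in rescaled units) and a Coulomb potential, acting on spinors $\mathbb R^2\to\mathbb C^2$. The free operator $W_0$ is self-adjoint in $L^2(\mathbb R^2,\mathbb C^2)$ as the closure of its restriction to $C_c^\infty(\mathbb R^2,\mathbb C^2)$; let $\mathfrak H$ be its positive spectral subspace, the range of $\chi_{(0,\infty)}(W_0)$. For $m\in\mathbb Z$ and $n\in\mathbb N_0$ put $$f^m_n(z)=\sqrt{\frac{n!}{\pi(n+|m|)!}}\;e^{-|z|^2/2}\,L^{|m|}_n(|z|^2)\cdot\begin{cases}z^{|m|}&m\ge0\\ \bar z^{|m|}&m<0,\end{cases}\qquad \psi^m_n=\frac1{\sqrt2}\begin{pmatrix}f^m_n\\ d^*|d^*|^{-1}f^m_n\end{pmatrix},$$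 where $L^\alpha_n$ are the generalized Laguerre polynomials, $d^*=2\mathrm i(-\bar\partial+z/2)$ with $\bar\partial=\tfrac12(\partial_1+\mathrm i\partial_2)$, and $|d^*|=\sqrt{dd^*}$ (with $d$ the adjoint of $d^*$), so that $|d^*|f^m_n=2\sqrt{n+\max\{0,m\}+1}\,f^m_n$. Let $\mathfrak Q_0\subset L^2(\mathbb R^2,\mathbb C^2)$ be the linear span of the spinors $\psi^m_n$ and, for $\varphi,\psi\in\mathfrak Q_0$, let $(\varphi,W_Z\psi)=\int_{\mathbb R^2}\langle\varphi(x),(W_Z\psi)(x)\rangle\,dx$ (an absolutely convergent integral). Let $$Z_c=\left(\frac{\Gamma(1/4)^4}{8\pi^2}+\frac{8\pi^2}{\Gamma(1/4)^4}\right)^{-1}.$$ If $Z\le Z_c$, then $(\psi,W_Z\psi)>0$ for all $0\ne\psi\in\mathfrak Q_0$, and the form $(\varphi,W_Z\psi)$ on $\mathfrak Q_0$ extends to a closed Hermitian form $\mathcal E$ which is bounded from below, whose domain $\mathfrak Q$ is a dense subspace of $\mathfrak H$, and which has $\mathfrak Q_0$ as a form core (i.e. $\mathfrak Q$ is the completion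 of $\mathfrak Q_0$ with respect to the norm $\sqrt{(\psi,W_Z\psi)+\|\psi\|^2}$). If $Z>Z_c$, then the form is unbounded from below: for every $c\in\mathbb R$ there is $\psi\in\mathfrak Q_0$ with $(\psi,W_Z\psi)<c\,\|\psi\|^2$. -/

import Mathlib

open MeasureTheory Filter Topology
open scoped ContDiff

noncomputable section

/-! The plane `ℝ²` is identified with `ℂ` through `z = x₁ + i x₂`; the measure on it is Lebesgue
measure. -/

/-- Two-component spinors, with the Hermitian norm of `ℂ²`. -/
abbrev Spinor : Type := EuclideanSpace ℂ (Fin 2)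

/-- The Hilbert space `L²(ℝ², ℂ²)`. -/
abbrev L2Spinor : Type := Lp Spinor 2 (volume : Measure ℂ)

/-! ### The Weyl operator as a differential expression -/

/-- The Pauli matrix `σ₁`. -/
def pauli₁ : Matrix (Fin 2) (Fin 2) ℂ := !![0, 1; 1, 0]

/-- The Pauli matrix `σ₂`. -/
def pauli₂ : Matrix (Fin 2) (Fin 2) ℂ := !![0, -Complex.I; Complex.I, 0]

/-- `(p₁ + A₁) u` with `p₁ = -i ∂₁` and `A₁(x) = -x₂`. -/
def kinMom₁ (u : ℂ → Spinor) (x : ℂ) : Spinor :=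
  -Complex.I • fderiv ℝ u x 1 - (x.im : ℂ) • u x

/-- `(p₂ + A₂) u` with `p₂ = -i ∂₂` and `A₂(x) = x₁`. -/
def kinMom₂ (u : ℂ → Spinor) (x : ℂ) : Spinor :=
  -Complex.I • fderiv ℝ u x Complex.I + (x.re : ℂ) • u x

/-- The Weyl expression `W_Z u = σ · (p + A) u - (Z / |x|) u`, with `A(x) = (-x₂, x₁)`. -/
def weyl (Z : ℝ) (u : ℂ → Spinor) (x : ℂ) : Spinor :=
  WithLp.toLp 2 (pauli₁.mulVec (kinMom₁ u x).ofLp + pauli₂.mulVec (kinMom₂ u x).ofLp)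
    - ((Z / ‖x‖ : ℝ) : ℂ) • u x

lemma weyl_add (Z : ℝ) {u v : ℂ → Spinor} (hu : Differentiable ℝ u) (hv : Differentiable ℝ v) :
    weyl Z (u + v) = weyl Z u + weyl Z v := by
  funext x
  ext i
  fin_cases i <;>
  · simp [weyl, kinMom₁, kinMom₂, pauli₁, pauli₂, fderiv_add (hu x) (hv x),
      dotProduct, Fin.sum_univ_two]
    ring

lemma weyl_smul (Z : ℝ) (c : ℂ) {u : ℂ → Spinor} (hu : Differentiable ℝ u) :
    weyl Z (c • u) = c • weyl Z u := by
  funext x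
  ext i
  fin_cases i <;>
  · simp [weyl, kinMom₁, kinMom₂, pauli₁, pauli₂, fderiv_const_smul (hu x) c,
      dotProduct, Fin.sum_univ_two]
    ring

/-! ### The self-adjoint free magnetic Weyl operator and its spectral measure -/

/-- The graph in `L²(ℝ², ℂ²)` of the free magnetic Weyl operator `W₀` on `C_c^∞(ℝ², ℂ²)`. -/
def weylMinGraph : Submodule ℂ (L2Spinor × L2Spinor) where
  carrier := {p | ∃ η : ℂ → Spinor, ContDiff ℝ ∞ η ∧ HasCompactSupport η ∧
    p.1 =ᵐ[volume] η ∧ p.2 =ᵐ[volume] weyl 0 η}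
  zero_mem' := by
    refine ⟨0, contDiff_const, HasCompactSupport.zero, Lp.coeFn_zero _ _ _, ?_⟩
    have h : weyl 0 (0 : ℂ → Spinor) = 0 := by
      have := weyl_smul 0 0 (u := (0 : ℂ → Spinor)) (differentiable_const _)
      simpa using this
    rw [h]
    exact Lp.coeFn_zero _ _ _
  add_mem' := by
    rintro p q ⟨η, hη, hη', h1, h2⟩ ⟨ζ, hζ, hζ', k1, k2⟩
    refine ⟨η + ζ, hη.add hζ, hη'.add hζ', (Lp.coeFn_add _ _).trans (h1.add k1), ?_⟩
    rw [weyl_add 0 (hη.differentiable (by simp)) (hζ.differentiable (by simp))]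
    exact (Lp.coeFn_add _ _).trans (h2.add k2)
  smul_mem' := by
    rintro c p ⟨η, hη, hη', h1, h2⟩
    refine ⟨c • η, contDiff_const.smul hη, hη'.mono' ?_,
      (Lp.coeFn_smul _ _).trans (h1.const_smul c), ?_⟩
    · refine (Function.support_const_smul_subset c η).trans subset_closure
    rw [weyl_smul 0 c (hη.differentiable (by simp))]
    exact (Lp.coeFn_smul _ _).trans (h2.const_smul c)

/-- `weylMinGraph` is the graph of an operator. -/
lemma weylMinGraph_single_valued (p : L2Spinor × L2Spinor) (hp : p ∈ weylMinGraph)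
    (h0 : p.1 = 0) : p.2 = 0 := by
  obtain ⟨η, hη, -, h1, h2⟩ := hp
  rw [h0] at h1
  have hη0 : η = 0 :=
    (hη.continuous.ae_eq_iff_eq volume continuous_const).1
      (h1.symm.trans (Lp.coeFn_zero _ _ _))
  have h : weyl 0 (0 : ℂ → Spinor) = 0 := by
    have := weyl_smul 0 0 (u := (0 : ℂ → Spinor)) (differentiable_const _)
    simpa using this
  rw [hη0, h] at h2
  exact Lp.ext (h2.trans (Lp.coeFn_zero _ _ _).symm)

/-- The free magnetic Weyl operator `W₀` in `L²(ℝ², ℂ²)`: the closure of `σ · (p + A)` on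
`C_c^∞(ℝ², ℂ²)`. -/
def freeWeyl : L2Spinor →ₗ.[ℂ] L2Spinor := weylMinGraph.toLinearPMap.closure

/-- `E` is the spectral measure of the (self-adjoint) operator `T`: it is a projection-valued
measure on the Borel sets of `ℝ`, and `T = ∫ x dE(x)`, where, with `μ` the measure
`s ↦ ‖E(s) ψ‖²`, the domain of `T` is `{ψ | ∫ x² dμ < ∞}` and `⟨ψ, T ψ⟩ = ∫ x dμ`. -/
structure IsSpectralMeasure {H : Type*} [NormedAddCommGroup H] [InnerProductSpace ℂ H]
    [CompleteSpace H] (T : H →ₗ.[ℂ] H) (E : Set ℝ → H →L[ℂ] H) : Prop where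
  isStarProjection : ∀ s, MeasurableSet s → IsStarProjection (E s)
  univ : E Set.univ = 1
  inter : ∀ s t, MeasurableSet s → MeasurableSet t → E (s ∩ t) = E s * E t
  resolution : ∀ ψ : H, ∃ μ : Measure ℝ,
    (∀ s, MeasurableSet s → μ s = ENNReal.ofReal (‖E s ψ‖ ^ 2)) ∧
    (ψ ∈ T.domain ↔ Integrable (fun x : ℝ => x ^ 2) μ) ∧
    ∀ h : ψ ∈ T.domain, inner ℂ ψ (T ⟨ψ, h⟩) = ((∫ x, x ∂μ : ℝ) : ℂ)

/-! ### Landau-level functions and spinors -/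

/-- The generalized Laguerre polynomial `L_n^k`, for an integer parameter `k ≥ 0`. -/
def laguerre (n k : ℕ) (x : ℝ) : ℝ :=
  ∑ j ∈ Finset.range (n + 1),
    (-1) ^ j * ((n + k).choose (n - j) : ℝ) / (j.factorial : ℝ) * x ^ j

/-- The functions `f^m_n`, `m ∈ ℤ`, `n ∈ ℕ`. -/
def landauFun (m : ℤ) (n : ℕ) (z : ℂ) : ℂ :=
  ((√((n.factorial : ℝ) / (Real.pi * ((n + m.natAbs).factorial : ℝ)))
      * Real.exp (-‖z‖ ^ 2 / 2) * laguerre n m.natAbs (‖z‖ ^ 2) : ℝ) : ℂ)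
    * (if 0 ≤ m then z else starRingEnd ℂ z) ^ m.natAbs

/-- The operator `d* = 2i (-∂̄ + z / 2)`, where `∂̄ = (∂₁ + i ∂₂) / 2`. -/
def dStar (f : ℂ → ℂ) (z : ℂ) : ℂ :=
  2 * Complex.I *
    (-((fderiv ℝ f z 1 + Complex.I * fderiv ℝ f z Complex.I) / 2) + z / 2 * f z)

/-- The spinor `ψ^m_n = (f^m_n, d* |d*|⁻¹ f^m_n) / √2`. Since `|d*|² = d d*` and
`d d* f^m_n = 4 (n + max 0 m + 1) f^m_n`, the operator `|d*|⁻¹` acts on `f^m_n` as multiplication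
by `(2 √(n + max 0 m + 1))⁻¹`. -/
def landauSpinor (m : ℤ) (n : ℕ) (z : ℂ) : Spinor :=
  ((√2)⁻¹ : ℂ) •
    !₂[landauFun m n z,
      (((2 * √((n : ℝ) + (max 0 m : ℤ) + 1))⁻¹ : ℝ) : ℂ) * dStar (landauFun m n) z]

/-- The space `𝔔₀`: finite linear combinations of the spinors `ψ^m_n`. -/
def landauSpan : Submodule ℂ (ℂ → Spinor) :=
  Submodule.span ℂ (Set.range fun p : ℤ × ℕ => landauSpinor p.1 p.2)

/-- The space `𝔔₀` as a subspace of `L²(ℝ², ℂ²)`. -/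
def landauSubspace : Submodule ℂ L2Spinor where
  carrier := {ψ | ∃ u ∈ landauSpan, ψ =ᵐ[volume] u}
  zero_mem' := ⟨0, landauSpan.zero_mem, Lp.coeFn_zero _ _ _⟩
  add_mem' := by
    rintro ψ φ ⟨u, hu, h1⟩ ⟨v, hv, h2⟩
    exact ⟨u + v, landauSpan.add_mem hu hv, (Lp.coeFn_add _ _).trans (h1.add h2)⟩
  smul_mem' := by
    rintro c ψ ⟨u, hu, h1⟩
    exact ⟨c • u, landauSpan.smul_mem c hu, (Lp.coeFn_smul _ _).trans (h1.const_smul c)⟩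

/-- The form `(u, W_Z v) = ∫ ⟨u(x), (W_Z v)(x)⟩ dx`, conjugate linear in `u`. -/
def weylForm (Z : ℝ) (u v : ℂ → Spinor) : ℂ :=
  ∫ x, inner ℂ (u x) (weyl Z v x)

/-- The critical charge. -/
def criticalCharge : ℝ :=
  (Real.Gamma (1 / 4) ^ 4 / (8 * Real.pi ^ 2) + 8 * Real.pi ^ 2 / Real.Gamma (1 / 4) ^ 4)⁻¹

/-! ### Forms in a Hilbert space -/

/-- A sesquilinear form, conjugate linear in its first argument, on a subspace of `H`. -/
structure SesqForm (H : Type*) [NormedAddCommGroup H] [InnerProductSpace ℂ H] where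
  domain : Submodule ℂ H
  form : domain →ₗ⋆[ℂ] domain →ₗ[ℂ] ℂ

namespace SesqForm

variable {H : Type*} [NormedAddCommGroup H] [InnerProductSpace ℂ H]

/-- The form is Hermitian. -/
def IsHermitian (t : SesqForm H) : Prop :=
  ∀ φ ψ : t.domain, t.form φ ψ = starRingEnd ℂ (t.form ψ φ)

/-- The form is bounded from below. -/
def IsBoundedBelow (t : SesqForm H) : Prop :=
  ∃ c : ℝ, ∀ ψ : t.domain, c * ‖ψ‖ ^ 2 ≤ (t.form ψ ψ).re

/-- The sequence `u` in the domain of `t` is `t`-convergent to `ψ`: `u_n → ψ` in `H` and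
`t[u_n - u_k] → 0` as `n, k → ∞`. -/
def FormTendsto (t : SesqForm H) (u : ℕ → t.domain) (ψ : H) : Prop :=
  Tendsto (fun n => (u n : H)) atTop (𝓝 ψ) ∧
  Tendsto (fun p : ℕ × ℕ => t.form (u p.1 - u p.2) (u p.1 - u p.2)) atTop (𝓝 0)

/-- The form is closed: if `u` is `t`-convergent to `ψ`, then `ψ` is in the domain and
`t[u_n - ψ] → 0`. -/
def IsClosed (t : SesqForm H) : Prop :=
  ∀ (u : ℕ → t.domain) (ψ : H), t.FormTendsto u ψ →
    ∃ h : ψ ∈ t.domain,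
      Tendsto (fun n => t.form (u n - ⟨ψ, h⟩) (u n - ⟨ψ, h⟩)) atTop (𝓝 0)

/-- The subspace `D` of the domain is a core: every `ψ` in the domain is a limit, in `H` and in
the sense of `t`, of a sequence in `D`. -/
def IsCore (t : SesqForm H) (D : Submodule ℂ H) : Prop :=
  D ≤ t.domain ∧ ∀ ψ : t.domain, ∃ u : ℕ → t.domain, (∀ n, (u n : H) ∈ D) ∧
    Tendsto (fun n => (u n : H)) atTop (𝓝 (ψ : H)) ∧
    Tendsto (fun n => t.form (u n - ψ) (u n - ψ)) atTop (𝓝 0)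

end SesqForm

end

/-!
The free operator `W₀` has an orthonormal basis of eigenfunctions of the form polynomial times
Gaussian: the spinors `signedSpinor (±1) m n`, with eigenvalues `±2 √(landauLevel m n)`, and the
zero modes `zeroMode k` (`weyl_weylEigenfun`). They are complete because a square integrable `g`
for which all moments of `exp (-|z|² / 2) g` vanish is zero: the Fourier transform of
`exp (-|z|² / 2) g` is the sum of its power series (`ae_eq_zero_of_orthogonal_gaussSpan`). The
closure of `W₀` on test functions is the maximal diagonal operator in this basis
(`mem_closure_weylMinGraph_iff`); one inclusion is integration by parts, the other a cutoff of the
eigenfunctions. Hence the orthogonal projections `diagProj` form its spectral measure, and the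
positive spectral subspace is the closure of `𝔔₀` (`isSpectralMeasure_freeWeyl`,
`range_diagProj_Ioi`).

On `𝔔₀` the form decouples with respect to `m`. The kinetic part is diagonal, with entries
`2 √(landauLevel m n)`, and `1 / |x|` acts in each sector as the mean of the matrices `coulombMatrix`
for the angular momenta `|m|` and `|m + 1|` of the two components (`weylForm_landauSpinor`).
Expanding `L^a_n` in the polynomials `L^(a-1/2)_k`, which are orthogonal for the weight that the
potential produces, factorizes the Coulomb matrix as `TᵀT` with nonnegative entries. Gauss's
summation theorem then exhibits, for `0 < x < a + 1 / 2`, an explicit positive sequence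
`h n = Γ (n + x) / √(n! (n + a)!)` with
`K h = schurConst a x * (Γ (n + x + 1/2) / Γ (n + x)) * h`
(`hasSum_coulombMatrix_mul_schurSeq`). The best choice is `x = a / 2 + 1 / 4`, with the constant
`critConst a`, and the reflection formula gives `Z_c (critConst 0 + critConst 1) = 4`
(`criticalCharge_mul`).

A symmetric matrix with nonnegative entries and `K h = l h`, `h > 0`, satisfies
`∑ l |c|² - (c, K c) = ½ ∑ K h h' |c / h - c' / h'|²` (`hasSum_groundState`). Applied to both
components, this writes `(ψ, W_Z ψ)` as a diagonal part plus a sum of squares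
(`hasSum_formTerm`). For `0 ≤ Z ≤ Z_c` the diagonal part is nonnegative, because in every sector the
two rates `critConst a * Γ (n + x + 1/2) / Γ (n + x)` sum to at most
`(critConst 0 + critConst 1) √(landauLevel m n)` (`critConst_mul_gammaRatio_le`); the delicate
sector is `m = -1`. Strict positivity holds because a nonzero finite sequence is not proportional to
`h` (`re_weylForm_pos`). A sum of nonnegative terms that are continuous in `L²` is lower
semicontinuous, so the form is closable (`tendsto_form_zero_of_hasSum`), and its closure is
constructed from the closure of an operator `S` with `(ψ, W_Z ψ) = ‖S ψ‖²`
(`exists_form_closure`). Negative `Z` gives a form comparable with that for `Z = 0`.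

For `Z > Z_c` the same sequences serve as trial functions in the sector `m = 0`, with exponents `x`
for the upper and `x + 1 / 2` for the lower component, for which both components are nearly given by
`Γ (n + x) / n!`. At `x = 1 / 4` the potential energy outweighs the kinetic energy at large `n` by
a fixed factor, while the kinetic energy diverges like the harmonic series; a lower bound for the
form would bound the partial sums of that series (`exists_weylForm_lt`).
-/

/-! ### Rising factorials, Laguerre coefficients and their orthogonality -/

/-- The coefficient `(x)_k / k!` of `t ^ k` in the binomial series of `(1 - t) ^ (-x)`. -/
noncomputable def riseCoeff (x : ℝ) (k : ℕ) : ℝ := (ascPochhammer ℝ k).eval x / (k.factorial : ℝ)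

@[simp] lemma riseCoeff_zero (x : ℝ) : riseCoeff x 0 = 1 := by simp [riseCoeff]

lemma riseCoeff_succ (x : ℝ) (k : ℕ) :
    ((k : ℝ) + 1) * riseCoeff x (k + 1) = (x + k) * riseCoeff x k := by
  have h : ((k : ℝ) + 1) ≠ 0 := by positivity
  have h' : (k.factorial : ℝ) ≠ 0 := by positivity
  simp only [riseCoeff, ascPochhammer_succ_eval, Nat.factorial_succ]
  push_cast
  field_simp

lemma riseCoeff_pos {x : ℝ} (hx : 0 < x) (k : ℕ) : 0 < riseCoeff x k :=
  div_pos (ascPochhammer_pos k x hx) (by positivity)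

/-- Pascal's rule. -/
lemma riseCoeff_add_one (x : ℝ) (k : ℕ) :
    riseCoeff (x + 1) (k + 1) = riseCoeff x (k + 1) + riseCoeff (x + 1) k := by
  induction k with
  | zero =>
    have h1 := riseCoeff_succ (x + 1) 0
    have h2 := riseCoeff_succ x 0
    simp at h1 h2 ⊢
    linarith
  | succ k ih =>
    have h1 := riseCoeff_succ (x + 1) (k + 1)
    have h2 := riseCoeff_succ x (k + 1)
    have h3 := riseCoeff_succ (x + 1) k
    have h : ((k + 1 : ℕ) : ℝ) + 1 ≠ 0 := by positivity
    apply mul_left_cancel₀ h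
    rw [h1, mul_add, h2]
    push_cast at *
    linear_combination (x + k + 1) * ih - h3

/-- Chu–Vandermonde. -/
lemma sum_riseCoeff_mul (x y : ℝ) (n : ℕ) :
    ∑ i ∈ Finset.range (n + 1), riseCoeff x i * riseCoeff y (n - i) = riseCoeff (x + y) n := by
  rw [← Finset.Nat.sum_antidiagonal_eq_sum_range_succ (fun i j => riseCoeff x i * riseCoeff y j)]
  induction n with
  | zero => simp
  | succ n ih =>
    have h : ((n : ℝ) + 1) ≠ 0 := by positivity
    apply mul_left_cancel₀ h
    rw [riseCoeff_succ, ← ih, Finset.mul_sum, Finset.mul_sum]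
    have e : ∀ p ∈ Finset.HasAntidiagonal.antidiagonal (n + 1), ((n : ℝ) + 1) * (riseCoeff x p.1 * riseCoeff y p.2)
        = (p.1 * riseCoeff x p.1) * riseCoeff y p.2 + riseCoeff x p.1 * (p.2 * riseCoeff y p.2) := by
      intro p hp
      have : ((n : ℝ) + 1) = p.1 + p.2 := by
        rw [Finset.HasAntidiagonal.mem_antidiagonal] at hp; exact_mod_cast hp.symm
      rw [this]; ring
    rw [Finset.sum_congr rfl e, Finset.sum_add_distrib, Finset.Nat.sum_antidiagonal_succ,
      Finset.Nat.sum_antidiagonal_succ']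
    simp only [Nat.cast_zero, zero_mul, zero_add, mul_zero]
    rw [← Finset.sum_add_distrib]
    refine Finset.sum_congr rfl fun p hp => ?_
    have : (n : ℝ) = p.1 + p.2 := by
      rw [Finset.HasAntidiagonal.mem_antidiagonal] at hp; exact_mod_cast hp.symm
    push_cast
    rw [riseCoeff_succ, riseCoeff_succ, this]
    ring

lemma Gamma_nat_add {x : ℝ} (hx : 0 < x) (k : ℕ) :
    Real.Gamma (k + x) = Real.Gamma x * k.factorial * riseCoeff x k := by
  induction k with
  | zero => simp
  | succ k ih =>
    have h := riseCoeff_succ x k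
    have : ((k + 1 : ℕ) : ℝ) + x = (k + x) + 1 := by push_cast; ring
    rw [this, Real.Gamma_add_one (by positivity), ih, Nat.factorial_succ]
    push_cast
    linear_combination (-Real.Gamma x * k.factorial) * h

/-- The coefficient of `x ^ j` in the Laguerre polynomial `L_n^a`, for a real parameter `a`. -/
noncomputable def lagCoeff (a : ℝ) (n j : ℕ) : ℝ :=
  if j ≤ n then (-1) ^ j / (j.factorial : ℝ) * riseCoeff (a + j + 1) (n - j) else 0

lemma riseCoeff_nat (m k : ℕ) : riseCoeff ((m : ℝ) + 1) k = ((m + k).choose k : ℝ) := by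
  induction k with
  | zero => simp
  | succ k ih =>
    have h := riseCoeff_succ ((m : ℝ) + 1) k
    have h' : ((k : ℝ) + 1) ≠ 0 := by positivity
    apply mul_left_cancel₀ h'
    rw [h, ih]
    have := Nat.add_one_mul_choose_eq (m + k) k
    have h2 : ((m + k + 1 : ℕ) : ℝ) * (m + k).choose k = ((m + k + 1).choose (k + 1)) * (k + 1 : ℕ) := by
      exact_mod_cast this
    push_cast at h2
    rw [show m + (k + 1) = m + k + 1 by ring]
    linear_combination h2

lemma laguerre_eq_sum_lagCoeff (n k : ℕ) (x : ℝ) :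
    laguerre n k x = ∑ j ∈ Finset.range (n + 1), lagCoeff k n j * x ^ j := by
  refine Finset.sum_congr rfl fun j hj => ?_
  have hj' : j ≤ n := Nat.lt_succ_iff.1 (Finset.mem_range.1 hj)
  have := riseCoeff_nat (k + j) (n - j)
  rw [show k + j + (n - j) = n + k by omega] at this
  rw [lagCoeff, if_pos hj', ← this]
  push_cast
  ring

lemma lagCoeff_of_lt {a : ℝ} {n j : ℕ} (h : n < j) : lagCoeff a n j = 0 := if_neg (by omega)

lemma lagCoeff_self (a : ℝ) (n : ℕ) : lagCoeff a n n = (-1) ^ n / (n.factorial : ℝ) := by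
  simp [lagCoeff]

/-- `∫ s ^ (a + i) e ^ (-s) L_n^a(s) ds` vanishes for `i < n`: up to a factor it is the `n`-th
difference of a polynomial of degree `i`. -/
lemma sum_lagCoeff_mul_Gamma {a : ℝ} (ha : -1 < a) {n i : ℕ} (hi : i ≤ n) :
    ∑ j ∈ Finset.range (n + 1), lagCoeff a n j * Real.Gamma (a + 1 + i + j) =
      if i = n then (-1) ^ n * Real.Gamma (n + a + 1) else 0 := by
  set P : Polynomial ℝ := (ascPochhammer ℝ i).comp (Polynomial.X + Polynomial.C (a + 1)) with hP
  have hdeg : P.natDegree = i := by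
    rw [hP, Polynomial.natDegree_comp, ascPochhammer_natDegree, Polynomial.natDegree_X_add_C,
      mul_one]
  have hlead : P.leadingCoeff = 1 := by
    rw [hP, Polynomial.leadingCoeff_comp (by rw [Polynomial.natDegree_X_add_C]; exact one_ne_zero),
      (monic_ascPochhammer ℝ i).leadingCoeff, Polynomial.leadingCoeff_X_add_C]
    simp
  have hterm : ∀ j ∈ Finset.range (n + 1), lagCoeff a n j * Real.Gamma (a + 1 + i + j) =
      (-1) ^ n * Real.Gamma (n + a + 1) / n.factorial *
        (((-1 : ℤ) ^ (n - j) * n.choose j) • P.eval ((0 : ℝ) + j • (1 : ℝ))) := by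
    intro j hj
    have hj' : j ≤ n := Nat.lt_succ_iff.1 (Finset.mem_range.1 hj)
    have hpos : 0 < a + 1 + j := by have : (0 : ℝ) ≤ j := by positivity
                                    linarith
    have e1 : Real.Gamma (a + 1 + i + j) = Real.Gamma (a + 1 + j) * (ascPochhammer ℝ i).eval (a + 1 + j) := by
      have := Gamma_nat_add hpos i
      rw [show a + 1 + (i : ℝ) + j = i + (a + 1 + j) by ring, this, riseCoeff]
      have : (i.factorial : ℝ) ≠ 0 := by positivity
      field_simp
    have e2 : Real.Gamma (n + a + 1) =
        Real.Gamma (a + 1 + j) * (n - j).factorial * riseCoeff (a + j + 1) (n - j) := by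
      have := Gamma_nat_add hpos (n - j)
      rw [Nat.cast_sub hj'] at this
      rw [show a + j + 1 = a + 1 + j by ring, ← this]
      congr 1; ring
    have e3 : P.eval ((0 : ℝ) + j • (1 : ℝ)) = (ascPochhammer ℝ i).eval (a + 1 + j) := by
      simp [hP, Polynomial.eval_comp, add_comm]
    have e4 : (n.choose j : ℝ) = n.factorial / (j.factorial * (n - j).factorial) :=
      Nat.cast_choose ℝ hj'
    have e5 : (-1 : ℝ) ^ n * (-1) ^ (n - j) = (-1) ^ j := by
      rw [← pow_add, show n + (n - j) = 2 * (n - j) + j by omega, pow_add, pow_mul]; simp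
    rw [lagCoeff, if_pos hj', e1, e2, e3, zsmul_eq_mul]
    push_cast
    rw [e4, ← e5]
    have h1 : (n.factorial : ℝ) ≠ 0 := by positivity
    have h2 : (j.factorial : ℝ) ≠ 0 := by positivity
    have h3 : ((n - j).factorial : ℝ) ≠ 0 := by positivity
    field_simp
  rw [Finset.sum_congr rfl hterm, ← Finset.mul_sum,
    ← fwdDiff_iter_eq_sum_shift (1 : ℝ) (fun x => P.eval x) n 0]
  split_ifs with h
  · have := Polynomial.fwdDiff_iter_degree_eq_factorial P
    rw [hdeg, h] at this
    rw [this, hlead]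
    have h1 : (n.factorial : ℝ) ≠ 0 := by positivity
    simp
    field_simp
  · have := Polynomial.fwdDiff_iter_eq_zero_of_degree_lt (P := P) (n := n) (by omega)
    rw [this]
    simp

/-- Orthogonality of the Laguerre polynomials `L_n^a` with respect to `s ^ a e ^ (-s) ds`, the
integral being expanded into moments. -/
lemma sum_lagCoeff_lagCoeff {a : ℝ} (ha : -1 < a) (n n' : ℕ) :
    ∑ i ∈ Finset.range (n + 1), ∑ j ∈ Finset.range (n' + 1),
      lagCoeff a n i * lagCoeff a n' j * Real.Gamma (a + 1 + i + j) =
      if n = n' then Real.Gamma (n + a + 1) / n.factorial else 0 := by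
  wlog h : n ≤ n' generalizing n n'
  · have := this n' n (by omega)
    rw [Finset.sum_comm] at this
    rw [if_neg (by omega)] at this ⊢
    rw [← this]
    refine Finset.sum_congr rfl fun i _ => Finset.sum_congr rfl fun j _ => ?_
    rw [show a + 1 + (i : ℝ) + j = a + 1 + j + i by ring]
    ring
  have e : ∀ i ∈ Finset.range (n + 1), ∑ j ∈ Finset.range (n' + 1),
      lagCoeff a n i * lagCoeff a n' j * Real.Gamma (a + 1 + i + j) =
      lagCoeff a n i * if i = n' then (-1) ^ n' * Real.Gamma (n' + a + 1) else 0 := by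
    intro i hi
    rw [← sum_lagCoeff_mul_Gamma ha (by have := Finset.mem_range.1 hi; omega : i ≤ n'),
      Finset.mul_sum]
    exact Finset.sum_congr rfl fun j _ => by ring
  rw [Finset.sum_congr rfl e]
  split_ifs with h'
  · subst h'
    rw [Finset.sum_eq_single n]
    · rw [if_pos rfl, lagCoeff_self]
      have : (-1 : ℝ) ^ n * (-1) ^ n = 1 := by rw [← mul_pow]; simp
      linear_combination (Real.Gamma (n + a + 1) / n.factorial) * this
    · intro b _ hb; rw [if_neg hb, mul_zero]
    · intro h; simp at h
  · refine Finset.sum_eq_zero fun i hi => ?_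
    have := Finset.mem_range.1 hi
    rw [if_neg (by omega), mul_zero]

/-- `L_n^{a + 1/2} = ∑_k ((1/2)_{n - k} / (n - k)!) L_k^a`, at the level of coefficients. -/
lemma lagCoeff_add_half (a : ℝ) {n j N : ℕ} (hN : n ≤ N) :
    lagCoeff (a + 1 / 2) n j =
      ∑ k ∈ Finset.range (N + 1), (if k ≤ n then riseCoeff (1 / 2) (n - k) else 0) * lagCoeff a k j := by
  by_cases hj : j ≤ n
  · rw [lagCoeff, if_pos hj]
    rw [show a + 1 / 2 + j + 1 = (a + j + 1) + 1 / 2 by ring, ← sum_riseCoeff_mul, Finset.mul_sum]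
    symm
    have hsub : Finset.Ico j (n + 1) ⊆ Finset.range (N + 1) := by
      intro k hk
      simp at hk ⊢; omega
    rw [← Finset.sum_subset hsub, Finset.sum_Ico_eq_sum_range, show n + 1 - j = n - j + 1 by omega]
    · refine Finset.sum_congr rfl fun i hi => ?_
      have hi' := Finset.mem_range.1 hi
      rw [if_pos (by omega), lagCoeff, if_pos (by omega), show j + i - j = i by omega,
        show n - (j + i) = n - j - i by omega]
      ring
    · intro k hk hk'
      simp at hk hk'
      by_cases h1 : k < j
      · rw [lagCoeff_of_lt h1, mul_zero]
      · rw [if_neg (by omega), zero_mul]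
  · rw [lagCoeff_of_lt (by omega)]
    symm
    refine Finset.sum_eq_zero fun k _ => ?_
    by_cases h1 : k ≤ n
    · rw [lagCoeff_of_lt (a := a) (by omega), mul_zero]
    · rw [if_neg h1, zero_mul]

lemma lagCoeff_sum_eq {a : ℝ} {n N : ℕ} (h : n ≤ N) (F : ℕ → ℝ) :
    ∑ i ∈ Finset.range (N + 1), lagCoeff a n i * F i =
      ∑ i ∈ Finset.range (n + 1), lagCoeff a n i * F i := by
  symm
  apply Finset.sum_subset (Finset.range_mono (by omega))
  intro i _ hi
  rw [lagCoeff_of_lt (by simp at hi; omega), zero_mul]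

/-- The matrix `T` for which `T* T` is, up to normalization, the Coulomb matrix in the basis of
Landau functions of angular momentum `± a`. -/
noncomputable def coulombFactor (a k n : ℕ) : ℝ :=
  if k ≤ n then riseCoeff (1 / 2) (n - k) * √(Real.Gamma (k + a + 1 / 2) / k.factorial)
    * √(n.factorial / (n + a).factorial) else 0

/-- The matrix element `∫ conj (f^a_n) f^a_{n'} / |x| dx`. -/
noncomputable def coulombMatrix (a n n' : ℕ) : ℝ :=
  ∑ k ∈ Finset.range (n + 1), coulombFactor a k n * coulombFactor a k n'

/-- The Laplace-type integrals `∫ t ^ (a - 1/2) e ^ (-t) L^a_n L^a_n' dt` that give the Coulomb matrix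
elements, written out in coefficients. Since `L^a_n = ∑ₖ (1/2)_(n-k) / (n-k)! L^(a-1/2)_k`, and the
`L^(a-1/2)_k` are orthogonal for exactly this weight, the double sum becomes a Gram matrix with
nonnegative entries. -/
lemma sum_lagCoeff_half (a n n' : ℕ) :
    ∑ i ∈ Finset.range (n + 1), ∑ j ∈ Finset.range (n' + 1),
      lagCoeff a n i * lagCoeff a n' j * Real.Gamma (a + 1 / 2 + i + j) =
      ∑ k ∈ Finset.range (n + 1), (if k ≤ n then riseCoeff (1 / 2) (n - k) else 0) *
        (if k ≤ n' then riseCoeff (1 / 2) (n' - k) else 0) *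
          (Real.Gamma (k + a + 1 / 2) / k.factorial) := by
  set N := max n n' with hN
  have hn : n ≤ N := le_max_left _ _
  have hn' : n' ≤ N := le_max_right _ _
  set b : ℕ → ℕ → ℝ := fun n k => if k ≤ n then riseCoeff (1 / 2) (n - k) else 0 with hb
  have ha : (a : ℝ) = (a - 1 / 2 : ℝ) + 1 / 2 := by ring
  have key : ∀ k ∈ Finset.range (N + 1), ∀ l ∈ Finset.range (N + 1),
      ∑ i ∈ Finset.range (n + 1), ∑ j ∈ Finset.range (n' + 1),
        lagCoeff (a - 1 / 2) k i * lagCoeff (a - 1 / 2) l j * Real.Gamma (a + 1 / 2 + i + j)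
          * (b n k * b n' l) =
      b n k * b n' l * if k = l then Real.Gamma (k + a + 1 / 2) / k.factorial else 0 := by
    intro k hk l hl
    by_cases h1 : k ≤ n
    swap
    · simp [hb, if_neg h1]
    by_cases h2 : l ≤ n'
    swap
    · simp [hb, if_neg h2]
    have := sum_lagCoeff_lagCoeff (a := a - 1 / 2)
      (by have : (0 : ℝ) ≤ a := by positivity
          linarith) k l
    rw [show (k : ℝ) + (a - 1 / 2) + 1 = k + a + 1 / 2 by ring] at this
    rw [← this, Finset.mul_sum]
    have e1 : ∀ i, ∑ j ∈ Finset.range (n' + 1),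
        lagCoeff (a - 1 / 2) k i * lagCoeff (a - 1 / 2) l j * Real.Gamma (a + 1 / 2 + i + j)
          * (b n k * b n' l) = lagCoeff (a - 1 / 2) k i * ∑ j ∈ Finset.range (l + 1),
        (lagCoeff (a - 1 / 2) l j * (Real.Gamma (a + 1 / 2 + i + j)
          * (b n k * b n' l))) := by
      intro i
      rw [← lagCoeff_sum_eq h2, Finset.mul_sum]
      exact Finset.sum_congr rfl fun j _ => by ring
    rw [Finset.sum_congr rfl fun i _ => e1 i, lagCoeff_sum_eq h1]
    refine Finset.sum_congr rfl fun i _ => ?_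
    rw [Finset.mul_sum, Finset.mul_sum]
    refine Finset.sum_congr rfl fun j _ => ?_
    rw [show (a : ℝ) - 1 / 2 + 1 + i + j = a + 1 / 2 + i + j by ring]
    ring
  calc _ = ∑ i ∈ Finset.range (n + 1), ∑ j ∈ Finset.range (n' + 1),
        ∑ k ∈ Finset.range (N + 1), ∑ l ∈ Finset.range (N + 1),
        lagCoeff (a - 1 / 2) k i * lagCoeff (a - 1 / 2) l j * Real.Gamma (a + 1 / 2 + i + j)
          * (b n k * b n' l) := by
        refine Finset.sum_congr rfl fun i _ => Finset.sum_congr rfl fun j _ => ?_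
        have h1 := lagCoeff_add_half (a - 1 / 2 : ℝ) (j := i) hn
        have h2 := lagCoeff_add_half (a - 1 / 2 : ℝ) (j := j) hn'
        rw [← ha] at h1 h2
        rw [h1, h2, Finset.sum_mul_sum, Finset.sum_mul]
        refine Finset.sum_congr rfl fun k _ => ?_
        rw [Finset.sum_mul]
        refine Finset.sum_congr rfl fun l _ => ?_
        simp only [hb]
        ring
    _ = ∑ k ∈ Finset.range (N + 1), ∑ l ∈ Finset.range (N + 1),
        b n k * b n' l * if k = l then Real.Gamma (k + a + 1 / 2) / k.factorial else 0 := by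
        have : ∀ i ∈ Finset.range (n + 1), ∑ j ∈ Finset.range (n' + 1),
          ∑ k ∈ Finset.range (N + 1), ∑ l ∈ Finset.range (N + 1),
          lagCoeff (a - 1 / 2) k i * lagCoeff (a - 1 / 2) l j * Real.Gamma (a + 1 / 2 + i + j)
          * (b n k * b n' l) = ∑ k ∈ Finset.range (N + 1), ∑ l ∈ Finset.range (N + 1),
          ∑ j ∈ Finset.range (n' + 1),
          lagCoeff (a - 1 / 2) k i * lagCoeff (a - 1 / 2) l j * Real.Gamma (a + 1 / 2 + i + j)
          * (b n k * b n' l) := by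
          intro i _
          rw [Finset.sum_comm]
          exact Finset.sum_congr rfl fun k _ => Finset.sum_comm
        rw [Finset.sum_congr rfl this, Finset.sum_comm]
        refine Finset.sum_congr rfl fun k hk => ?_
        rw [Finset.sum_comm]
        exact Finset.sum_congr rfl fun l hl => key k hk l hl
    _ = ∑ k ∈ Finset.range (N + 1), b n k * b n' k * (Real.Gamma (k + a + 1 / 2) / k.factorial) := by
        refine Finset.sum_congr rfl fun k hk => ?_
        rw [Finset.sum_eq_single k]
        · rw [if_pos rfl]
        · intro l _ hl; rw [if_neg (Ne.symm hl), mul_zero]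
        · intro h; exact absurd hk h
    _ = _ := by
        symm
        apply Finset.sum_subset (Finset.range_mono (by omega))
        intro k _ hk
        rw [if_neg (by simp at hk; omega), zero_mul, zero_mul]

lemma Gamma_div_factorial_pos (k a : ℕ) : 0 < Real.Gamma (k + a + 1 / 2) / k.factorial :=
  div_pos (Real.Gamma_pos_of_pos (by positivity)) (by positivity)

lemma coulombMatrix_eq (a n n' : ℕ) :
    coulombMatrix a n n' = √(n.factorial / (n + a).factorial) * √(n'.factorial / (n' + a).factorial) *
    ∑ i ∈ Finset.range (n + 1), ∑ j ∈ Finset.range (n' + 1),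
      lagCoeff a n i * lagCoeff a n' j * Real.Gamma (a + 1 / 2 + i + j) := by
  rw [sum_lagCoeff_half, coulombMatrix, Finset.mul_sum]
  refine Finset.sum_congr rfl fun k _ => ?_
  have h := Real.mul_self_sqrt (Gamma_div_factorial_pos k a).le
  simp only [coulombFactor]
  split_ifs
  · linear_combination (√(n.factorial / (n + a).factorial) * √(n'.factorial / (n' + a).factorial) *
      riseCoeff (1 / 2) (n - k) * riseCoeff (1 / 2) (n' - k)) * h
  all_goals ring

lemma coulombMatrix_comm (a n n' : ℕ) : coulombMatrix a n n' = coulombMatrix a n' n := by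
  rw [coulombMatrix_eq, coulombMatrix_eq, Finset.sum_comm, mul_comm (√_)]
  congr 1
  refine Finset.sum_congr rfl fun j _ => Finset.sum_congr rfl fun i _ => ?_
  rw [show (a : ℝ) + 1 / 2 + i + j = a + 1 / 2 + j + i by ring]
  ring

lemma coulombFactor_nonneg (a k n : ℕ) : 0 ≤ coulombFactor a k n := by
  rw [coulombFactor]
  split_ifs
  · have := (riseCoeff_pos (x := 1 / 2) (by norm_num) (n - k)).le
    positivity
  · exact le_rfl

lemma coulombMatrix_pos (a n n' : ℕ) : 0 < coulombMatrix a n n' := by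
  apply Finset.sum_pos' (fun k _ => mul_nonneg (coulombFactor_nonneg _ _ _) (coulombFactor_nonneg _ _ _))
  refine ⟨0, by simp, ?_⟩
  have h := Real.sqrt_pos.2 (Gamma_div_factorial_pos 0 a)
  simp only [coulombFactor, Nat.zero_le, if_true]
  have h1 := riseCoeff_pos (x := 1 / 2) (by norm_num) (n - 0)
  have h2 := riseCoeff_pos (x := 1 / 2) (by norm_num) (n' - 0)
  positivity

/-! ### A summation formula and the eigenvectors of the Coulomb matrix -/

lemma hasSum_riseCoeff_mul_pow (x : ℝ) {t : ℝ} (ht0 : 0 ≤ t) (ht1 : t < 1) :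
    HasSum (fun j => riseCoeff x j * t ^ j) ((1 - t) ^ (-x)) := by
  have h := (Real.one_div_one_sub_rpow_hasFPowerSeriesOnBall_zero x).hasSum (y := t)
    (by simp [Metric.mem_eball, edist_eq_enorm_sub, enorm_eq_nnnorm]
        rw [← NNReal.coe_lt_coe]; simpa [abs_of_nonneg ht0] using ht1)
  simp only [zero_add, FormalMultilinearSeries.apply_eq_prod_smul_coeff, Finset.prod_const, Finset.card_univ,
    Fintype.card_fin, FormalMultilinearSeries.coeff_ofScalars, smul_eq_mul] at h
  rw [Real.rpow_neg (by linarith), ← one_div]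
  convert! h using 2 with j
  rw [mul_comm, ← Ring.multichoose_eq]
  congr 1
  have h1 := Ring.factorial_nsmul_multichoose_eq_ascPochhammer x j
  rw [Polynomial.ascPochhammer_smeval_eq_eval, nsmul_eq_mul] at h1
  rw [riseCoeff, ← h1]
  have : (j.factorial : ℝ) ≠ 0 := by positivity
  field_simp

lemma lintegral_beta {a b : ℝ} (ha : 0 < a) (hb : 0 < b) :
    ∫⁻ x in Set.Ioo (0 : ℝ) 1, ENNReal.ofReal (x ^ (a - 1) * (1 - x) ^ (b - 1)) =
      ENNReal.ofReal (ProbabilityTheory.beta a b) := by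
  have h := ProbabilityTheory.lintegral_betaPDF_eq_one ha hb
  have hβ := ProbabilityTheory.beta_pos ha hb
  rw [ProbabilityTheory.lintegral_betaPDF] at h
  have : ∀ x : ℝ, ENNReal.ofReal (1 / ProbabilityTheory.beta a b * x ^ (a - 1) * (1 - x) ^ (b - 1))
      = ENNReal.ofReal (1 / ProbabilityTheory.beta a b) *
        ENNReal.ofReal (x ^ (a - 1) * (1 - x) ^ (b - 1)) := by
    intro x
    rw [← ENNReal.ofReal_mul (by positivity), mul_assoc]
  simp_rw [this] at h
  rw [lintegral_const_mul _ (by fun_prop), one_div, ENNReal.ofReal_inv_of_pos hβ] at h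
  have h0 : ENNReal.ofReal (ProbabilityTheory.beta a b) ≠ 0 := by simpa using hβ
  rw [mul_comm, ← div_eq_mul_inv, ENNReal.div_eq_one_iff h0 (by simp)] at h
  exact h

lemma hasSum_of_tsum_ofReal {f : ℕ → ℝ} {c : ℝ} (hf : ∀ n, 0 ≤ f n) (hc : 0 ≤ c)
    (h : ∑' n, ENNReal.ofReal (f n) = ENNReal.ofReal c) : HasSum f c := by
  have h1 := ENNReal.hasSum_toReal (f := fun n => ENNReal.ofReal (f n)) (by rw [h]; simp)
  rw [← ENNReal.tsum_toReal_eq (by simp), h, ENNReal.toReal_ofReal hc] at h1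
  simpa only [ENNReal.toReal_ofReal (hf _)] using h1

/-- Gauss's summation of a hypergeometric series at `1`, in the case where one parameter is `1/2`. -/
lemma hasSum_riseCoeff_mul_Gamma_div {p q : ℝ} (hp : 0 < p) (hq : p + 1 / 2 < q) :
    HasSum (fun j : ℕ => riseCoeff (1 / 2) j * (Real.Gamma (j + p) / Real.Gamma (j + q)))
      (Real.Gamma p * Real.Gamma (q - p - 1 / 2) / (Real.Gamma (q - 1 / 2) * Real.Gamma (q - p))) := by
  have hqp : 0 < Real.Gamma (q - p) := Real.Gamma_pos_of_pos (by linarith)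
  have key : HasSum (fun j : ℕ => riseCoeff (1 / 2) j * ProbabilityTheory.beta (j + p) (q - p))
      (ProbabilityTheory.beta p (q - p - 1 / 2)) := by
    have hr := fun j => (riseCoeff_pos (x := 1 / 2) (by norm_num) j).le
    have hb : ∀ j : ℕ, 0 < ProbabilityTheory.beta (j + p) (q - p) := fun j =>
      ProbabilityTheory.beta_pos (by positivity) (by linarith)
    apply hasSum_of_tsum_ofReal (fun j => mul_nonneg (hr j) (hb j).le)
      (ProbabilityTheory.beta_pos hp (by linarith)).le
    rw [← lintegral_beta hp (by linarith)]
    have : ∀ j : ℕ, ENNReal.ofReal (riseCoeff (1 / 2) j * ProbabilityTheory.beta (j + p) (q - p)) =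
        ∫⁻ x in Set.Ioo (0 : ℝ) 1, ENNReal.ofReal (riseCoeff (1 / 2) j) *
          ENNReal.ofReal (x ^ (j + p - 1) * (1 - x) ^ (q - p - 1)) := by
      intro j
      rw [ENNReal.ofReal_mul (hr j), ← lintegral_beta (by positivity) (by linarith),
        lintegral_const_mul _ (by fun_prop)]
    simp_rw [this]
    rw [← lintegral_tsum (fun j => by fun_prop)]
    refine setLIntegral_congr_fun measurableSet_Ioo fun x hx => ?_
    have hx0 : 0 < x := hx.1
    have hx1 : 0 < 1 - x := by linarith [hx.2]
    have hs := (hasSum_riseCoeff_mul_pow (1 / 2) hx.1.le hx.2).mul_left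
      (x ^ (p - 1) * (1 - x) ^ (q - p - 1))
    have e : x ^ (p - 1) * (1 - x) ^ (q - p - 1) * (1 - x) ^ (-(1 / 2) : ℝ) =
        x ^ (p - 1) * (1 - x) ^ (q - p - 1 / 2 - 1) := by
      rw [mul_assoc, ← Real.rpow_add hx1]; congr 2; ring
    rw [e] at hs
    rw [← hs.tsum_eq, ENNReal.ofReal_tsum_of_nonneg _ hs.summable]
    · refine tsum_congr fun j => ?_
      rw [← ENNReal.ofReal_mul (hr j)]
      congr 1
      rw [show (j : ℝ) + p - 1 = (p - 1) + j by ring, Real.rpow_add hx0, Real.rpow_natCast]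
      ring
    · intro j
      have := hr j
      positivity
  have h2 := key.div_const (Real.Gamma (q - p))
  convert! h2 using 1
  · funext j
    rw [ProbabilityTheory.beta, show (j : ℝ) + p + (q - p) = j + q by ring]
    field_simp
  · rw [ProbabilityTheory.beta, show p + (q - p - 1 / 2) = q - 1 / 2 by ring]
    field_simp

/-- The ratio `Γ(t + 1/2) / Γ(t)`, which behaves like `√t`. -/
noncomputable def gammaRatio (t : ℝ) : ℝ := Real.Gamma (t + 1 / 2) / Real.Gamma t

lemma gammaRatio_pos {t : ℝ} (ht : 0 < t) : 0 < gammaRatio t :=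
  div_pos (Real.Gamma_pos_of_pos (by linarith)) (Real.Gamma_pos_of_pos ht)

/-- The positive sequence `Γ(n + x) / √(n! (n + a)!)`, which is an eigenvector of the Coulomb
matrix relative to the diagonal matrix with entries `Γ(n + x + 1/2) / Γ(n + x)`. -/
noncomputable def schurSeq (a : ℕ) (x : ℝ) (n : ℕ) : ℝ :=
  Real.Gamma (n + x) / √(n.factorial * (n + a).factorial)

lemma schurSeq_pos (a : ℕ) {x : ℝ} (hx : 0 < x) (n : ℕ) : 0 < schurSeq a x n :=
  div_pos (Real.Gamma_pos_of_pos (by positivity)) (by positivity)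

/-- The eigenvalue belonging to `schurSeq a x`. -/
noncomputable def schurConst (a : ℕ) (x : ℝ) : ℝ :=
  Real.Gamma (a + 1 / 2 - x) * Real.Gamma x / (Real.Gamma (a + 1 - x) * Real.Gamma (x + 1 / 2))

lemma hasSum_coulombFactor_mul_schurSeq (a k : ℕ) {x : ℝ} (hx : 0 < x) (hxa : x < a + 1 / 2) :
    HasSum (fun n => coulombFactor a k n * schurSeq a x n)
      (√(Real.Gamma (k + a + 1 / 2) / k.factorial) * (Real.Gamma (k + x) *
        Real.Gamma (a + 1 / 2 - x) / (Real.Gamma (k + a + 1 / 2) * Real.Gamma (a + 1 - x)))) := by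
  have h := (hasSum_riseCoeff_mul_Gamma_div (p := k + x) (q := k + a + 1) (by positivity)
    (by linarith)).mul_left (√(Real.Gamma (k + a + 1 / 2) / k.factorial))
  rw [show (k : ℝ) + a + 1 - (k + x) - 1 / 2 = a + 1 / 2 - x by ring,
    show (k : ℝ) + a + 1 - (k + x) = a + 1 - x by ring,
    show (k : ℝ) + a + 1 - 1 / 2 = k + a + 1 / 2 by ring] at h
  rw [← hasSum_nat_add_iff' k, Finset.sum_eq_zero, sub_zero]
  · convert! h using 2 with j
    rw [coulombFactor, if_pos (by omega), schurSeq, Nat.add_sub_cancel]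
    have e1 : Real.Gamma ((j : ℝ) + (k + a + 1)) = (j + k + a).factorial := by
      rw [← Real.Gamma_nat_eq_factorial]; congr 1; push_cast; ring
    rw [e1, show ((j + k : ℕ) : ℝ) + x = j + (k + x) by push_cast; ring]
    have h1 : 0 < ((j + k).factorial : ℝ) := by positivity
    have h2 : 0 < ((j + k + a).factorial : ℝ) := by positivity
    have e2 : √((j + k).factorial / (j + k + a).factorial) /
        √((j + k).factorial * (j + k + a).factorial) = 1 / ((j + k + a).factorial : ℝ) := by
      rw [← Real.sqrt_div (by positivity)]
      rw [show ((j + k).factorial / (j + k + a).factorial : ℝ) /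
        ((j + k).factorial * (j + k + a).factorial) = (1 / ((j + k + a).factorial : ℝ)) ^ 2 by
          field_simp]
      exact Real.sqrt_sq (by positivity)
    calc _ = riseCoeff (1 / 2) j * √(Real.Gamma (k + a + 1 / 2) / k.factorial) *
        Real.Gamma (j + (k + x)) * (√((j + k).factorial / (j + k + a).factorial) /
        √((j + k).factorial * (j + k + a).factorial)) := by ring
      _ = _ := by rw [e2]; ring
  · intro n hn
    rw [coulombFactor, if_neg (by simpa using hn), zero_mul]

/-- The eigenvector relation for the factorized Coulomb matrix `TᵀT`: the series for `T h` is Gauss's,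
and the finite sum for `Tᵀ(T h)` is a Chu–Vandermonde convolution. -/
lemma hasSum_coulombMatrix_mul_schurSeq (a n : ℕ) {x : ℝ} (hx : 0 < x) (hxa : x < a + 1 / 2) :
    HasSum (fun n' => coulombMatrix a n n' * schurSeq a x n')
      (schurConst a x * gammaRatio (n + x) * schurSeq a x n) := by
  have h := hasSum_sum (s := Finset.range (n + 1)) fun k _ =>
    (hasSum_coulombFactor_mul_schurSeq a k hx hxa).mul_left (coulombFactor a k n)
  have hΓ := (Real.Gamma_pos_of_pos hx).ne'
  have hΓ' := (Real.Gamma_pos_of_pos (show 0 < x + 1 / 2 by linarith)).ne'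
  have hΓ'' := (Real.Gamma_pos_of_pos (show 0 < a + 1 - x by linarith)).ne'
  convert! h using 1
  · funext n'
    rw [coulombMatrix, Finset.sum_mul]
    exact Finset.sum_congr rfl fun k _ => by ring
  · have e : ∀ k ∈ Finset.range (n + 1), coulombFactor a k n *
        (√(Real.Gamma (k + a + 1 / 2) / k.factorial) * (Real.Gamma (k + x) *
        Real.Gamma (a + 1 / 2 - x) / (Real.Gamma (k + a + 1 / 2) * Real.Gamma (a + 1 - x)))) =
        √(n.factorial / (n + a).factorial) * Real.Gamma (a + 1 / 2 - x) / Real.Gamma (a + 1 - x) *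
          Real.Gamma x * (riseCoeff x k * riseCoeff (1 / 2) (n - k)) := by
      intro k hk
      have hk' : k ≤ n := Nat.lt_succ_iff.1 (Finset.mem_range.1 hk)
      rw [coulombFactor, if_pos hk', Gamma_nat_add hx k]
      have h1 := Real.mul_self_sqrt (Gamma_div_factorial_pos k a).le
      have h2 := (Real.Gamma_pos_of_pos (show (0 : ℝ) < k + a + 1 / 2 by positivity)).ne'
      have h3 : (k.factorial : ℝ) ≠ 0 := by positivity
      calc _ = (√(Real.Gamma (k + a + 1 / 2) / k.factorial) *
          √(Real.Gamma (k + a + 1 / 2) / k.factorial)) * (riseCoeff (1 / 2) (n - k) *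
          √(n.factorial / (n + a).factorial) * (Real.Gamma x * k.factorial * riseCoeff x k *
        Real.Gamma (a + 1 / 2 - x) / (Real.Gamma (k + a + 1 / 2) * Real.Gamma (a + 1 - x)))) := by
            ring
        _ = _ := by rw [h1]; field_simp
    rw [Finset.sum_congr rfl e, ← Finset.mul_sum, sum_riseCoeff_mul, gammaRatio, schurSeq,
      schurConst, Gamma_nat_add hx n, show (n : ℝ) + x + 1 / 2 = n + (x + 1 / 2) by ring,
      Gamma_nat_add (by linarith : 0 < x + 1 / 2) n]
    have h1 : 0 < (n.factorial : ℝ) := by positivity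
    have h2 : 0 < ((n + a).factorial : ℝ) := by positivity
    have h3 := (riseCoeff_pos hx n).ne'
    have e2 : √(n.factorial / (n + a).factorial) =
        n.factorial / √(n.factorial * (n + a).factorial) := by
      rw [eq_div_iff (by positivity), ← Real.sqrt_mul (by positivity)]
      rw [show (n.factorial / (n + a).factorial : ℝ) * (n.factorial * (n + a).factorial) =
        (n.factorial : ℝ) ^ 2 by field_simp]
      exact Real.sqrt_sq h1.le
    rw [e2]
    field_simp

/-! ### Estimates for ratios of Gamma functions -/

lemma gammaRatio_mul_gammaRatio {t : ℝ} (ht : 0 < t) :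
    gammaRatio t * gammaRatio (t + 1 / 2) = t := by
  have h1 := (Real.Gamma_pos_of_pos ht).ne'
  have h2 := (Real.Gamma_pos_of_pos (show 0 < t + 1 / 2 by linarith)).ne'
  rw [gammaRatio, gammaRatio, show t + 1 / 2 + 1 / 2 = t + 1 by ring, Real.Gamma_add_one ht.ne']
  field_simp

lemma gammaRatio_sq_le {t : ℝ} (ht : 0 < t) : gammaRatio t ^ 2 ≤ t := by
  have hΓ := Real.Gamma_pos_of_pos ht
  have h := Real.Gamma_mul_add_mul_le_rpow_Gamma_mul_rpow_Gamma ht (by linarith : 0 < t + 1)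
    (a := 1 / 2) (b := 1 / 2) (by norm_num) (by norm_num) (by norm_num)
  rw [show 1 / 2 * t + 1 / 2 * (t + 1) = t + 1 / 2 by ring, Real.Gamma_add_one ht.ne',
    ← Real.sqrt_eq_rpow, ← Real.sqrt_eq_rpow, ← Real.sqrt_mul hΓ.le,
    show Real.Gamma t * (t * Real.Gamma t) = t * Real.Gamma t ^ 2 by ring,
    Real.sqrt_mul ht.le, Real.sqrt_sq hΓ.le] at h
  have h2 : gammaRatio t ≤ √t := by rw [gammaRatio, div_le_iff₀ hΓ]; exact h
  calc gammaRatio t ^ 2 ≤ √t ^ 2 := by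
        have := (gammaRatio_pos ht).le
        gcongr
    _ = t := Real.sq_sqrt ht.le

lemma gammaRatio_le_sqrt {t : ℝ} (ht : 0 < t) : gammaRatio t ≤ √t :=
  Real.le_sqrt_of_sq_le (gammaRatio_sq_le ht)

lemma le_gammaRatio_sq {t : ℝ} (ht : 0 < t) : t ^ 2 / (t + 1 / 2) ≤ gammaRatio t ^ 2 := by
  have h := gammaRatio_mul_gammaRatio ht
  have h1 := gammaRatio_sq_le (show 0 < t + 1 / 2 by linarith)
  have h2 := gammaRatio_pos ht
  rw [div_le_iff₀ (by linarith)]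
  calc t ^ 2 = gammaRatio t ^ 2 * gammaRatio (t + 1 / 2) ^ 2 := by rw [← mul_pow, h]
    _ ≤ _ := by gcongr

lemma gammaRatio_add_one {t : ℝ} (ht : 0 < t) :
    gammaRatio (t + 1) = gammaRatio t * ((t + 1 / 2) / t) := by
  have h1 := (Real.Gamma_pos_of_pos ht).ne'
  rw [gammaRatio, gammaRatio, show t + 1 + 1 / 2 = (t + 1 / 2) + 1 by ring,
    Real.Gamma_add_one ht.ne', Real.Gamma_add_one (by linarith)]
  field_simp

lemma tendsto_natCast_add_div (b c : ℝ) :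
    Tendsto (fun N : ℕ => ((N : ℝ) + b) / (N + c)) atTop (𝓝 1) := by
  have h1 : Tendsto (fun N : ℕ => (N : ℝ) + c) atTop atTop :=
    tendsto_atTop_add_const_right _ _ tendsto_natCast_atTop_atTop
  have h2 : Tendsto (fun N : ℕ => 1 + (b - c) * ((N : ℝ) + c)⁻¹) atTop (𝓝 (1 + (b - c) * 0)) :=
    (h1.inv_tendsto_atTop.const_mul _).const_add _
  simp only [mul_zero, add_zero] at h2
  refine h2.congr' ?_
  filter_upwards [h1.eventually_gt_atTop 0] with N hN
  field_simp
  ring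

lemma tendsto_gammaRatio_sq_div (b : ℝ) :
    Tendsto (fun N : ℕ => gammaRatio (N + 1 / 4) ^ 2 / (N + b)) atTop (𝓝 1) := by
  have h1 : Tendsto (fun N : ℕ => (((N : ℝ) + 1 / 4) / (N + 3 / 4)) * ((N + 1 / 4) / (N + b)))
      atTop (𝓝 (1 * 1)) := (tendsto_natCast_add_div _ _).mul (tendsto_natCast_add_div _ _)
  rw [mul_one] at h1
  have h2 := tendsto_natCast_add_div (1 / 4) b
  have h3 : ∀ᶠ N : ℕ in atTop, 0 < (N : ℝ) + b :=
    (tendsto_atTop_add_const_right _ b tendsto_natCast_atTop_atTop).eventually_gt_atTop 0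
  refine tendsto_of_tendsto_of_tendsto_of_le_of_le' h1 h2 ?_ ?_
  · filter_upwards [h3] with N hN
    have := le_gammaRatio_sq (show (0 : ℝ) < N + 1 / 4 by positivity)
    rw [show (N : ℝ) + 1 / 4 + 1 / 2 = N + 3 / 4 by ring] at this
    calc _ = ((N : ℝ) + 1 / 4) ^ 2 / (N + 3 / 4) / (N + b) := by ring
      _ ≤ _ := by gcongr
  · filter_upwards [h3] with N hN
    have := gammaRatio_sq_le (show (0 : ℝ) < N + 1 / 4 by positivity)
    gcongr

lemma gammaRatio_quarter_succ (N : ℕ) :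
    gammaRatio ((N + 1 : ℕ) + 1 / 4) ^ 2 =
      gammaRatio (N + 1 / 4) ^ 2 * (((N : ℝ) + 3 / 4) ^ 2 / (N + 1 / 4) ^ 2) := by
  have := gammaRatio_add_one (show (0 : ℝ) < N + 1 / 4 by positivity)
  rw [show ((N + 1 : ℕ) : ℝ) + 1 / 4 = N + 1 / 4 + 1 by push_cast; ring, this, mul_pow, div_pow]
  ring_nf

/-- The two sides of `N ≤ (Γ(N + 3/4) / Γ(N + 1/4))² ≤ N + 2/25` are asymptotically equal, and their
quotients are monotone in `N`. -/
lemma le_gammaRatio_quarter_sq (N : ℕ) (hN : 1 ≤ N) : (N : ℝ) ≤ gammaRatio (N + 1 / 4) ^ 2 := by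
  have hanti : Antitone fun N : ℕ => gammaRatio ((N + 1 : ℕ) + 1 / 4) ^ 2 / ((N + 1 : ℕ) + (0 : ℝ)) := by
    refine antitone_nat_of_succ_le fun n => ?_
    rw [gammaRatio_quarter_succ (n + 1)]
    have hr := gammaRatio_pos (show (0 : ℝ) < (n + 1 : ℕ) + 1 / 4 by positivity)
    rw [mul_div_assoc, div_eq_mul_inv (gammaRatio _ ^ 2)]
    gcongr
    push_cast
    rw [div_div, div_le_iff₀ (by positivity), inv_mul_eq_div, le_div_iff₀ (by positivity)]
    have : (0 : ℝ) ≤ n := by positivity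
    nlinarith [mul_nonneg this this, mul_nonneg this (mul_nonneg this this)]
  have hlim := (tendsto_add_atTop_iff_nat 1).2 (tendsto_gammaRatio_sq_div 0)
  have := hanti.le_of_tendsto hlim (N - 1)
  simp only [Nat.sub_add_cancel hN, add_zero] at this
  rwa [le_div_iff₀ (by positivity), one_mul] at this

lemma gammaRatio_quarter_sq_le (N : ℕ) (hN : 1 ≤ N) :
    gammaRatio (N + 1 / 4) ^ 2 ≤ N + 2 / 25 := by
  have hmono : Monotone fun N : ℕ =>
      gammaRatio ((N + 1 : ℕ) + 1 / 4) ^ 2 / ((N + 1 : ℕ) + (2 / 25 : ℝ)) := by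
    refine monotone_nat_of_le_succ fun n => ?_
    rw [gammaRatio_quarter_succ (n + 1)]
    have hr := gammaRatio_pos (show (0 : ℝ) < (n + 1 : ℕ) + 1 / 4 by positivity)
    rw [mul_div_assoc, div_eq_mul_inv (gammaRatio _ ^ 2)]
    gcongr
    push_cast
    rw [div_div, le_div_iff₀ (by positivity), inv_mul_eq_div, div_le_iff₀ (by positivity)]
    have : (0 : ℝ) ≤ n := by positivity
    nlinarith [mul_nonneg this this, mul_nonneg this (mul_nonneg this this)]
  have hlim := (tendsto_add_atTop_iff_nat 1).2 (tendsto_gammaRatio_sq_div (2 / 25))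
  have := hmono.ge_of_tendsto hlim (N - 1)
  simp only [Nat.sub_add_cancel hN] at this
  rwa [div_le_iff₀ (by positivity), one_mul] at this

/-- The critical exponent `x = a / 2 + 1 / 4`, for which `schurSeq a x n` decays like
`n ^ (-3/4)`. -/
noncomputable def critExp (a : ℕ) : ℝ := a / 2 + 1 / 4

lemma critExp_pos (a : ℕ) : 0 < critExp a := by rw [critExp]; positivity

lemma critExp_lt (a : ℕ) : critExp a < a + 1 / 2 := by
  have : (0 : ℝ) ≤ a := by positivity
  rw [critExp]; linarith

/-- The eigenvalue at the critical exponent. -/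
noncomputable def critConst (a : ℕ) : ℝ := schurConst a (critExp a)

lemma critConst_eq (a : ℕ) : critConst a = 1 / gammaRatio (critExp a) ^ 2 := by
  have h1 := (Real.Gamma_pos_of_pos (critExp_pos a)).ne'
  have h2 := (Real.Gamma_pos_of_pos (show 0 < critExp a + 1 / 2 by linarith [critExp_pos a])).ne'
  rw [critConst, schurConst, gammaRatio, show (a : ℝ) + 1 / 2 - critExp a = critExp a by
    rw [critExp]; ring, show (a : ℝ) + 1 - critExp a = critExp a + 1 / 2 by rw [critExp]; ring]
  field_simp

lemma critConst_pos (a : ℕ) : 0 < critConst a := by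
  rw [critConst_eq]
  have := gammaRatio_pos (critExp_pos a)
  positivity

lemma critConst_add_two (a : ℕ) :
    critConst (a + 2) = critConst a * (critExp a / (critExp a + 1 / 2)) ^ 2 := by
  have h := gammaRatio_add_one (critExp_pos a)
  have h1 := gammaRatio_pos (critExp_pos a)
  have h2 := critExp_pos a
  rw [critConst_eq, critConst_eq, show critExp (a + 2) = critExp a + 1 by
    simp only [critExp]; push_cast; ring, h]
  field_simp

lemma critConst_add_two_le (a : ℕ) : critConst (a + 2) ≤ critConst a := by
  have h2 := critExp_pos a
  rw [critConst_add_two]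
  refine mul_le_of_le_one_right (critConst_pos a).le (pow_le_one₀ (by positivity) ?_)
  rw [div_le_one (by positivity)]
  linarith

lemma critConst_zero_mul_one : critConst 0 * critConst 1 = 16 := by
  have h := gammaRatio_mul_gammaRatio (show (0 : ℝ) < 1 / 4 by norm_num)
  have h1 := gammaRatio_pos (show (0 : ℝ) < 1 / 4 by norm_num)
  have h2 := gammaRatio_pos (show (0 : ℝ) < 1 / 4 + 1 / 2 by norm_num)
  rw [critConst_eq, critConst_eq, show critExp 0 = 1 / 4 by simp [critExp],
    show critExp 1 = 1 / 4 + 1 / 2 by simp [critExp]; norm_num]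
  rw [div_mul_div_comm, ← mul_pow, h]
  norm_num

lemma critConst_two : critConst 2 = critConst 0 / 9 := by
  rw [critConst_add_two 0, show critExp 0 = 1 / 4 by simp [critExp]]
  norm_num
  ring

lemma critConst_two_bounds : 25 / 27 ≤ critConst 2 ∧ critConst 2 ≤ 1 := by
  have h1 := le_gammaRatio_quarter_sq 1 le_rfl
  have h2 := gammaRatio_quarter_sq_le 1 le_rfl
  rw [critConst_eq, show critExp 2 = (1 : ℕ) + 1 / 4 by simp [critExp]]
  push_cast at *
  constructor
  · rw [le_div_iff₀ (by linarith)]; linarith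
  · rw [div_le_one (by linarith)]; exact h1

lemma critConst_zero_le : critConst 0 ≤ 9 := by
  have := critConst_two_bounds; rw [critConst_two] at this; linarith

lemma le_critConst_zero : 25 / 3 ≤ critConst 0 := by
  have := critConst_two_bounds; rw [critConst_two] at this; linarith

lemma le_critConst_one : 16 / 9 ≤ critConst 1 := by
  have h := critConst_zero_mul_one
  have h1 := critConst_zero_le
  have h2 := critConst_pos 1
  nlinarith

lemma critConst_one_le : critConst 1 ≤ critConst 0 := by
  have h := critConst_zero_mul_one
  have h1 := le_critConst_zero
  have h2 := critConst_pos 1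
  nlinarith

lemma critConst_le_zero (a : ℕ) : critConst a ≤ critConst 0 := by
  induction a using Nat.twoStepInduction with
  | zero => exact le_rfl
  | one => exact critConst_one_le
  | more a h _ => exact (critConst_add_two_le a).trans h

lemma critConst_succ_le_one (a : ℕ) : critConst (a + 1) ≤ critConst 1 := by
  induction a using Nat.twoStepInduction with
  | zero => exact le_rfl
  | one => linarith [critConst_two_bounds.2, le_critConst_one]
  | more a h _ => exact (critConst_add_two_le (a + 1)).trans h

/-- The index `n'` for which `d* f^m_n` is a multiple of `f^{m+1}_{n'}`. -/
def lowerIndex (m : ℤ) (n : ℕ) : ℕ := if 0 ≤ m then n else n + 1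

/-- The number `N + 1 = n + max 0 m + 1`, where `f^m_n` belongs to the Landau level `N`. -/
noncomputable def landauLevel (m : ℤ) (n : ℕ) : ℝ := (n : ℝ) + (max 0 m : ℤ) + 1

lemma one_le_landauLevel (m : ℤ) (n : ℕ) : 1 ≤ landauLevel m n := by
  have h1 : (0 : ℝ) ≤ n := by positivity
  have h2 : (0 : ℝ) ≤ (max 0 m : ℤ) := by exact_mod_cast le_max_left _ _
  rw [landauLevel]; linarith

lemma critConst_le_div {a : ℕ} : critConst a ≤ (critExp a + 1 / 2) / critExp a ^ 2 := by
  have h := le_gammaRatio_sq (critExp_pos a)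
  have h1 := critExp_pos a
  rw [critConst_eq]
  rw [div_le_div_iff₀ (by have := gammaRatio_pos h1; positivity) (by positivity), one_mul]
  rwa [div_le_iff₀ (by positivity), mul_comm] at h

/-- For `m = -1` the upper component has slack of relative order `1 / N`, and it compensates for the
lower one, where `Γ(N + 3/4) / Γ(N + 1/4)` exceeds `√N` by a relative amount of order `N ^ (-2)`. -/
lemma critConst_mul_gammaRatio_neg_one (n : ℕ) :
    critConst 1 * gammaRatio (n + 3 / 4) + critConst 0 * gammaRatio ((n + 1 : ℕ) + 1 / 4) ≤
      (critConst 0 + critConst 1) * √((n : ℝ) + 1) := by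
  set s := √((n : ℝ) + 1) with hs
  set r := gammaRatio ((n + 1 : ℕ) + 1 / 4) with hr
  have hs2 : s ^ 2 = n + 1 := Real.sq_sqrt (by positivity)
  have hs0 : 0 < s := Real.sqrt_pos.2 (by positivity)
  have hr0 : 0 < r := gammaRatio_pos (by positivity)
  have h1 := le_gammaRatio_quarter_sq (n + 1) (by omega)
  have h2 := gammaRatio_quarter_sq_le (n + 1) (by omega)
  rw [← hr] at h1 h2
  push_cast at h1 h2
  rw [← hs2] at h1 h2
  have hrs : s ≤ r := by nlinarith
  have hs1 : 1 ≤ s := by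
    have : (0 : ℝ) ≤ n := by positivity
    nlinarith
  have h3 : gammaRatio (n + 3 / 4) * r = s ^ 2 - 1 / 4 := by
    have := gammaRatio_mul_gammaRatio (show (0 : ℝ) < n + 3 / 4 by positivity)
    rw [show (n : ℝ) + 3 / 4 + 1 / 2 = (n + 1 : ℕ) + 1 / 4 by push_cast; ring, ← hr] at this
    rw [this, hs2]; ring
  have k0 := critConst_zero_le
  have k0' := le_critConst_zero
  have k1 := le_critConst_one
  have hr2 : r ≤ 2 * s := by nlinarith
  have h4 : critConst 0 * r - critConst 1 * s ≤ 11 / 2 * (r + s) := by nlinarith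
  have h5 : (critConst 0 * r - critConst 1 * s) * (r - s) ≤ 11 / 2 * (r + s) * (r - s) :=
    mul_le_mul_of_nonneg_right h4 (by linarith)
  refine le_of_mul_le_mul_right ?_ hr0
  rw [add_mul, mul_assoc, h3]
  nlinarith

/-- In every sector the rates of the two components are bounded together by the kinetic energy, with
the constant of the sectors `m = 0` and `m = -1`. For `0 ≤ m` each component can be bounded
separately; for `m = -1` the two components have to be combined
(`critConst_mul_gammaRatio_neg_one`); for `m ≤ -2` the constants are so much smaller that crude
bounds suffice. -/
lemma critConst_mul_gammaRatio_le (m : ℤ) (n : ℕ) :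
    critConst m.natAbs * gammaRatio (n + critExp m.natAbs) +
      critConst (m + 1).natAbs * gammaRatio (lowerIndex m n + critExp (m + 1).natAbs) ≤
      (critConst 0 + critConst 1) * √(landauLevel m n) := by
  rcases le_or_gt 0 m with hm | hm
  · lift m to ℕ using hm
    have e1 : ((m : ℤ) + 1).natAbs = m + 1 := by omega
    rw [e1, Int.natAbs_natCast, lowerIndex, if_pos (by omega), landauLevel, add_mul]
    have e2 : ((max 0 (m : ℤ) : ℤ) : ℝ) = m := by simp
    rw [e2]
    have h1 : gammaRatio (n + critExp m) ≤ √((n : ℝ) + m + 1) := by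
      refine (gammaRatio_le_sqrt (by have := critExp_pos m; positivity)).trans
        (Real.sqrt_le_sqrt ?_)
      rw [critExp]
      linarith [show (0 : ℝ) ≤ m by positivity]
    have h2 : gammaRatio (n + critExp (m + 1)) ≤ √((n : ℝ) + m + 1) := by
      refine (gammaRatio_le_sqrt (by have := critExp_pos (m + 1); positivity)).trans
        (Real.sqrt_le_sqrt ?_)
      rw [critExp]
      push_cast
      linarith [show (0 : ℝ) ≤ m by positivity]
    have h3 : 0 < gammaRatio (n + critExp m) :=
      gammaRatio_pos (by have := critExp_pos m; positivity)
    have h4 : 0 < gammaRatio (n + critExp (m + 1)) :=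
      gammaRatio_pos (by have := critExp_pos (m + 1); positivity)
    have := critConst_pos 0
    have := critConst_pos 1
    exact add_le_add (mul_le_mul (critConst_le_zero m) h1 h3.le (by positivity))
      (mul_le_mul (critConst_succ_le_one m) h2 h4.le (by positivity))
  · obtain ⟨k, rfl⟩ : ∃ k : ℕ, m = -((k : ℤ) + 1) := ⟨(-m - 1).toNat, by omega⟩
    have e1 : (-((k : ℤ) + 1) + 1).natAbs = k := by omega
    have e3 : (-((k : ℤ) + 1)).natAbs = k + 1 := by omega
    have e2 : ((max 0 (-((k : ℤ) + 1)) : ℤ) : ℝ) = 0 := by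
      rw [max_eq_left (by omega)]; simp
    rw [e1, e3, lowerIndex, if_neg (by omega), landauLevel, e2, add_zero]
    rcases Nat.eq_zero_or_pos k with rfl | hk
    · have := critConst_mul_gammaRatio_neg_one n
      convert this using 4 <;> (simp [critExp]; try norm_num)
    · have hk' : (1 : ℝ) ≤ k := by exact_mod_cast hk
      have hs : 0 ≤ √((n : ℝ) + 1) := Real.sqrt_nonneg _
      have hn : (0 : ℝ) ≤ n := by positivity
      set u := critExp (k + 1) with hu
      set v := critExp k with hv
      have hu1 : 5 / 4 ≤ u := by rw [hu, critExp]; push_cast; linarith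
      have hv1 : 3 / 4 ≤ v := by rw [hv, critExp]; linarith
      have h1 : gammaRatio (n + u) ≤ u * √((n : ℝ) + 1) := by
        refine (gammaRatio_le_sqrt (by positivity)).trans ?_
        rw [Real.sqrt_le_left (by positivity), mul_pow, Real.sq_sqrt (by positivity)]
        have : u ≤ u ^ 2 := by nlinarith
        nlinarith
      have h2 : gammaRatio ((n + 1 : ℕ) + v) ≤ (1 + v / 2) * √((n : ℝ) + 1) := by
        refine (gammaRatio_le_sqrt (by positivity)).trans ?_
        rw [Real.sqrt_le_left (by positivity), mul_pow, Real.sq_sqrt (by positivity)]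
        push_cast
        have : 1 + v ≤ (1 + v / 2) ^ 2 := by nlinarith
        nlinarith
      have h3 : critConst (k + 1) * u ≤ 3 / 2 := by
        have := critConst_le_div (a := k + 1)
        rw [← hu] at this
        calc _ ≤ (u + 1 / 2) / u ^ 2 * u := by gcongr
          _ ≤ 3 / 2 := by
            rw [div_mul_eq_mul_div, div_le_iff₀ (by positivity)]
            nlinarith
      have h4 : critConst k * (1 + v / 2) ≤ 4 := by
        have := critConst_le_div (a := k)
        rw [← hv] at this
        calc _ ≤ (v + 1 / 2) / v ^ 2 * (1 + v / 2) := by gcongr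
          _ ≤ 4 := by
            rw [div_mul_eq_mul_div, div_le_iff₀ (by positivity)]
            nlinarith
      have k0 := le_critConst_zero
      have k1 := le_critConst_one
      calc _ ≤ critConst (k + 1) * (u * √((n : ℝ) + 1)) +
            critConst k * ((1 + v / 2) * √((n : ℝ) + 1)) := by
            have := critConst_pos k
            have := critConst_pos (k + 1)
            gcongr
        _ = (critConst (k + 1) * u + critConst k * (1 + v / 2)) * √((n : ℝ) + 1) := by ring
        _ ≤ _ := mul_le_mul_of_nonneg_right (by linarith) hs

/-- By the reflection formula at `1 / 4`, the two summands in the definition of `Z_c` are a quarter of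
the critical constants for angular momenta `0` and `1`. -/
lemma criticalCharge_mul : criticalCharge * (critConst 0 + critConst 1) = 4 := by
  have hΓ := Real.Gamma_pos_of_pos (show (0 : ℝ) < 1 / 4 by norm_num)
  have hπ := Real.pi_pos
  have hrefl : Real.Gamma (1 / 4) * Real.Gamma (1 / 4 + 1 / 2) = Real.pi * √2 := by
    have h := Real.Gamma_mul_Gamma_one_sub (1 / 4)
    rw [show (1 : ℝ) - 1 / 4 = 1 / 4 + 1 / 2 by norm_num,
      show Real.pi * (1 / 4) = Real.pi / 4 by ring, Real.sin_pi_div_four] at h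
    rw [h]
    have := Real.sq_sqrt (show (0 : ℝ) ≤ 2 by norm_num)
    field_simp
    linarith
  have hsq : (Real.pi * √2) ^ 2 = 2 * Real.pi ^ 2 := by
    rw [mul_pow, Real.sq_sqrt (by norm_num)]; ring
  have h3 : gammaRatio (1 / 4) = Real.pi * √2 / Real.Gamma (1 / 4) ^ 2 := by
    rw [gammaRatio, ← hrefl]; field_simp
  have h0 : critConst 0 = Real.Gamma (1 / 4) ^ 4 / (2 * Real.pi ^ 2) := by
    rw [critConst_eq, show critExp 0 = 1 / 4 by simp [critExp], h3, div_pow, hsq]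
    field_simp
  have h1 : critConst 1 = 32 * Real.pi ^ 2 / Real.Gamma (1 / 4) ^ 4 := by
    have := critConst_zero_mul_one
    have h0' := (critConst_pos 0).ne'
    rw [← mul_right_inj' h0', this, h0]
    field_simp
    norm_num
  rw [criticalCharge, h0, h1]
  field_simp
  ring

lemma criticalCharge_pos : 0 < criticalCharge := by
  have h := criticalCharge_mul
  have h0 := critConst_pos 0
  have h1 := critConst_pos 1
  by_contra hc
  nlinarith

/-! ### Polynomials in `z` and `conj z` times a Gaussian -/

/-- The function `z ^ p * conj z ^ q * exp (-|z|² / 2)`. -/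
noncomputable def gaussMon (p q : ℕ) (z : ℂ) : ℂ :=
  z ^ p * (starRingEnd ℂ z) ^ q * Complex.exp (-(z * starRingEnd ℂ z) / 2)

/-- The real-linear map `v ↦ A v + B conj v`; for `A = ∂f`, `B = ∂̄f` it is the differential of `f`. -/
noncomputable def wirtinger (A B : ℂ) : ℂ →L[ℝ] ℂ :=
  A • ContinuousLinearMap.id ℝ ℂ + B • (Complex.conjCLE : ℂ →L[ℝ] ℂ)

@[simp] lemma wirtinger_apply (A B v : ℂ) : wirtinger A B v = A * v + B * starRingEnd ℂ v := by
  simp [wirtinger]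

/-- The formal adjoint of `dStar`, the operator `-2i (∂ + conj z / 2)`. -/
noncomputable def dAdj (f : ℂ → ℂ) (z : ℂ) : ℂ :=
  -(2 * Complex.I) * ((fderiv ℝ f z 1 - Complex.I * fderiv ℝ f z Complex.I) / 2
    + starRingEnd ℂ z / 2 * f z)

lemma dStar_of_hasFDerivAt {f : ℂ → ℂ} {A B z : ℂ} (h : HasFDerivAt f (wirtinger A B) z) :
    dStar f z = 2 * Complex.I * (-B + z / 2 * f z) := by
  rw [dStar, h.fderiv]
  simp only [wirtinger_apply, map_one, Complex.conj_I, mul_one]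
  linear_combination (-Complex.I * (A - B)) * Complex.I_mul_I

lemma dAdj_of_hasFDerivAt {f : ℂ → ℂ} {A B z : ℂ} (h : HasFDerivAt f (wirtinger A B) z) :
    dAdj f z = -(2 * Complex.I) * (A + starRingEnd ℂ z / 2 * f z) := by
  rw [dAdj, h.fderiv]
  simp only [wirtinger_apply, map_one, Complex.conj_I, mul_one]
  linear_combination (Complex.I * (A - B)) * Complex.I_mul_I

lemma hasFDerivAt_conj (z : ℂ) : HasFDerivAt (fun z => starRingEnd ℂ z) (wirtinger 0 1) z := by
  have : HasFDerivAt (fun z => starRingEnd ℂ z) (Complex.conjCLE : ℂ →L[ℝ] ℂ) z :=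
    (Complex.conjCLE : ℂ →L[ℝ] ℂ).hasFDerivAt
  convert this using 1
  ext v; simp

lemma hasFDerivAt_gaussMon (p q : ℕ) (z : ℂ) :
    HasFDerivAt (gaussMon p q) (wirtinger
      (p * gaussMon (p - 1) q z - gaussMon p (q + 1) z / 2)
      (q * gaussMon p (q - 1) z - gaussMon (p + 1) q z / 2)) z := by
  have hid : HasFDerivAt (fun z : ℂ => z) (ContinuousLinearMap.id ℝ ℂ) z := hasFDerivAt_id z
  have hc := hasFDerivAt_conj z
  have hE := (((hid.mul hc).neg.mul_const (2 : ℂ)⁻¹).cexp)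
  have h := ((hid.pow p).mul (hc.pow q)).mul hE
  have e : gaussMon p q = (((fun z : ℂ => z) ^ p) * ((fun z : ℂ => starRingEnd ℂ z) ^ q)) *
      fun x => Complex.exp (-(x * starRingEnd ℂ x) * (2 : ℂ)⁻¹) := by
    funext x; simp [gaussMon, div_eq_mul_inv]
  rw [e]
  refine h.congr_fderiv ?_
  ext; simp [gaussMon, div_eq_mul_inv]; ring

lemma dStar_gaussMon (p q : ℕ) (z : ℂ) : dStar (gaussMon p q) z =
    2 * Complex.I * (gaussMon (p + 1) q z - q * gaussMon p (q - 1) z) := by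
  rw [dStar_of_hasFDerivAt (hasFDerivAt_gaussMon p q z)]
  simp only [gaussMon, pow_succ]
  ring

lemma dAdj_gaussMon (p q : ℕ) (z : ℂ) : dAdj (gaussMon p q) z =
    -(2 * Complex.I) * (p * gaussMon (p - 1) q z) := by
  rw [dAdj_of_hasFDerivAt (hasFDerivAt_gaussMon p q z)]
  simp only [gaussMon, pow_succ]
  ring

lemma contDiff_gaussMon (p q : ℕ) : ContDiff ℝ ∞ (gaussMon p q) := by
  have hc : ContDiff ℝ ∞ (fun z : ℂ => starRingEnd ℂ z) := Complex.conjCLE.contDiff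
  have h1 : ContDiff ℝ ∞ (fun z : ℂ => Complex.exp (-(z * starRingEnd ℂ z) / 2)) :=
    ((contDiff_id.mul hc).neg.div_const 2).cexp
  exact ((contDiff_id.pow p).mul (hc.pow q)).mul h1

lemma dStar_add {f g : ℂ → ℂ} (hf : Differentiable ℝ f) (hg : Differentiable ℝ g) :
    dStar (f + g) = dStar f + dStar g := by
  funext z
  simp only [dStar, Pi.add_apply, fderiv_add (hf z) (hg z), add_apply]
  ring

lemma dAdj_add {f g : ℂ → ℂ} (hf : Differentiable ℝ f) (hg : Differentiable ℝ g) :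
    dAdj (f + g) = dAdj f + dAdj g := by
  funext z
  simp only [dAdj, Pi.add_apply, fderiv_add (hf z) (hg z), add_apply]
  ring

lemma dStar_smul (c : ℂ) {f : ℂ → ℂ} (hf : Differentiable ℝ f) : dStar (c • f) = c • dStar f := by
  funext z
  simp only [dStar, Pi.smul_apply, fderiv_const_smul (hf z) c, smul_apply,
    smul_eq_mul]
  ring

lemma dAdj_smul (c : ℂ) {f : ℂ → ℂ} (hf : Differentiable ℝ f) : dAdj (c • f) = c • dAdj f := by
  funext z
  simp only [dAdj, Pi.smul_apply, fderiv_const_smul (hf z) c, smul_apply,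
    smul_eq_mul]
  ring

lemma differentiable_gaussMon (p q : ℕ) : Differentiable ℝ (gaussMon p q) :=
  (contDiff_gaussMon p q).differentiable (by simp)

lemma dStar_sum_gaussMon (s : Finset ℕ) (c : ℕ → ℂ) (p q : ℕ → ℕ) :
    dStar (∑ j ∈ s, c j • gaussMon (p j) (q j)) = ∑ j ∈ s, c j • dStar (gaussMon (p j) (q j)) := by
  classical
  induction s using Finset.induction_on with
  | empty => funext z; simp [dStar]
  | insert j s hj ih =>
    have hd : Differentiable ℝ (∑ j ∈ s, c j • gaussMon (p j) (q j)) :=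
      Differentiable.sum fun j _ => (differentiable_gaussMon _ _).const_smul _
    rw [Finset.sum_insert hj, Finset.sum_insert hj,
      dStar_add ((differentiable_gaussMon _ _).const_smul _) hd, ih,
      dStar_smul _ (differentiable_gaussMon _ _)]

lemma dAdj_sum_gaussMon (s : Finset ℕ) (c : ℕ → ℂ) (p q : ℕ → ℕ) :
    dAdj (∑ j ∈ s, c j • gaussMon (p j) (q j)) = ∑ j ∈ s, c j • dAdj (gaussMon (p j) (q j)) := by
  classical
  induction s using Finset.induction_on with
  | empty => funext z; simp [dAdj]
  | insert j s hj ih =>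
    have hd : Differentiable ℝ (∑ j ∈ s, c j • gaussMon (p j) (q j)) :=
      Differentiable.sum fun j _ => (differentiable_gaussMon _ _).const_smul _
    rw [Finset.sum_insert hj, Finset.sum_insert hj,
      dAdj_add ((differentiable_gaussMon _ _).const_smul _) hd, ih,
      dAdj_smul _ (differentiable_gaussMon _ _)]

/-- The unnormalized Landau function
`exp (-|z|² / 2) L_n^{p + q}(|z|²) z ^ p * conj z ^ q`, used with `p = 0` or `q = 0`. -/
noncomputable def lagGauss (p q n : ℕ) : ℂ → ℂ :=
  ∑ j ∈ Finset.range (n + 1), (lagCoeff (p + q : ℕ) n j : ℂ) • gaussMon (p + j) (q + j)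

lemma riseCoeff_mul_add_one (x : ℝ) (k : ℕ) :
    x * riseCoeff (x + 1) k = (k + 1) * riseCoeff x (k + 1) := by
  induction k with
  | zero => simp [riseCoeff]
  | succ k ih =>
    have h1 := riseCoeff_succ (x + 1) k
    have h2 := riseCoeff_succ x (k + 1)
    have h : ((k : ℝ) + 1) ≠ 0 := by positivity
    apply mul_left_cancel₀ h
    push_cast at *
    linear_combination x * h1 + (x + k + 1) * ih - (k + 1) * h2

lemma lagCoeff_add_one (a : ℝ) (n j : ℕ) :
    lagCoeff (a + 1) n j = lagCoeff a n j - (j + 1) * lagCoeff a n (j + 1) := by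
  rcases lt_trichotomy j n with h | rfl | h
  · obtain ⟨k, rfl⟩ : ∃ k, n = j + k + 1 := ⟨n - j - 1, by omega⟩
    rw [lagCoeff, if_pos (by omega), lagCoeff, if_pos (by omega), lagCoeff, if_pos (by omega),
      show j + k + 1 - j = k + 1 by omega, show j + k + 1 - (j + 1) = k by omega,
      show a + 1 + j + 1 = (a + j + 1) + 1 by ring, riseCoeff_add_one, Nat.factorial_succ, pow_succ]
    push_cast
    rw [show a + (j + 1 : ℝ) + 1 = (a + j + 1) + 1 by ring]
    field_simp
    ring
  · rw [lagCoeff_of_lt (n := j) (j := j + 1) (by omega), lagCoeff_self, lagCoeff_self]; ring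
  · rw [lagCoeff_of_lt h, lagCoeff_of_lt h, lagCoeff_of_lt (by omega)]; ring

lemma lagCoeff_succ_succ (a : ℝ) (n j : ℕ) :
    (j + 1) * lagCoeff a (n + 1) (j + 1) = -lagCoeff (a + 1) n j := by
  by_cases h : j ≤ n
  · rw [lagCoeff, if_pos (by omega), lagCoeff, if_pos h, Nat.factorial_succ, pow_succ,
      show n + 1 - (j + 1) = n - j by omega]
    push_cast
    rw [show a + (j + 1 : ℝ) + 1 = a + 1 + j + 1 by ring]
    field_simp
  · rw [lagCoeff_of_lt (by omega), lagCoeff_of_lt (by omega)]; simp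

lemma mul_lagCoeff_add_one (a : ℝ) (n j : ℕ) :
    (a + 1 + j) * lagCoeff (a + 1) n j = (n + a + 1) * lagCoeff a n j := by
  by_cases h : j ≤ n
  · rw [lagCoeff, if_pos h, lagCoeff, if_pos h]
    have h1 := riseCoeff_mul_add_one (a + j + 1) (n - j)
    have h2 := riseCoeff_succ (a + j + 1) (n - j)
    rw [Nat.cast_sub h] at h1 h2
    rw [show a + 1 + (j : ℝ) + 1 = a + j + 1 + 1 by ring]
    linear_combination ((-1) ^ j / (j.factorial : ℝ)) * (h1 + h2)
  · rw [lagCoeff_of_lt (by omega), lagCoeff_of_lt (by omega)]; simp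

lemma lagCoeff_succ_zero (a : ℝ) (n : ℕ) :
    (n + 1) * lagCoeff a (n + 1) 0 = (a + 1) * lagCoeff (a + 1) n 0 := by
  have h := riseCoeff_mul_add_one (a + 1) n
  simp [lagCoeff]
  linarith

lemma mul_lagCoeff_succ_succ (a : ℝ) (n j : ℕ) :
    (n + 1) * lagCoeff a (n + 1) (j + 1) =
      (a + j + 2) * lagCoeff (a + 1) n (j + 1) - lagCoeff (a + 1) n j := by
  have h1 := mul_lagCoeff_add_one a n (j + 1)
  have h2 := lagCoeff_succ_succ a n j
  have h3 := lagCoeff_add_one a n j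
  have h : ((j : ℝ) + 1) ≠ 0 := by positivity
  have h4 := mul_lagCoeff_add_one a n j
  apply mul_left_cancel₀ h
  push_cast at *
  linear_combination (n + 1 : ℝ) * h2 - (j + 1) * h1 - (n + a + 1) * h3 + h4

lemma sum_range_mul_pred {M : Type*} [AddCommGroup M] [Module ℂ M] (a : ℝ) (n : ℕ) (G : ℕ → M) :
    ∑ j ∈ Finset.range (n + 1), ((lagCoeff a n j : ℂ) * j) • G (j - 1) =
      ∑ j ∈ Finset.range (n + 1), ((lagCoeff a n (j + 1) : ℂ) * (j + 1)) • G j := by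
  rw [Finset.sum_range_succ', Finset.sum_range_succ]
  simp [lagCoeff_of_lt (Nat.lt_succ_self n)]

lemma dStar_lagGauss_pos (p n : ℕ) :
    dStar (lagGauss p 0 n) = (2 * Complex.I) • lagGauss (p + 1) 0 n := by
  rw [lagGauss, lagGauss, dStar_sum_gaussMon]
  funext z
  have h := sum_range_mul_pred p n (fun j => gaussMon (p + 1 + j) j z)
  have e : ∀ j ∈ Finset.range (n + 1), ((lagCoeff p n j : ℂ) * j) • gaussMon (p + 1 + (j - 1)) (j - 1) z =
      ((lagCoeff p n j : ℂ) * j) • gaussMon (p + j) (j - 1) z := by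
    intro j _
    rcases Nat.eq_zero_or_pos j with rfl | hj
    · simp
    · rw [show p + 1 + (j - 1) = p + j by omega]
  rw [Finset.sum_congr rfl e] at h
  simp only [Finset.sum_apply, Pi.smul_apply, smul_eq_mul, dStar_gaussMon, add_zero, zero_add] at h ⊢
  calc _ = 2 * Complex.I * (∑ j ∈ Finset.range (n + 1), (lagCoeff p n j : ℂ) * gaussMon (p + j + 1) j z
      - ∑ j ∈ Finset.range (n + 1), (lagCoeff p n j : ℂ) * j * gaussMon (p + j) (j - 1) z) := by
        rw [← Finset.sum_sub_distrib, Finset.mul_sum]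
        exact Finset.sum_congr rfl fun j _ => by ring
    _ = _ := by
        rw [h, ← Finset.sum_sub_distrib]
        congr 1
        refine Finset.sum_congr rfl fun j _ => ?_
        have := lagCoeff_add_one p n j
        push_cast
        rw [this]
        push_cast
        rw [show p + 1 + j = p + j + 1 by ring]
        ring

lemma dStar_lagGauss_neg (q n : ℕ) :
    dStar (lagGauss 0 (q + 1) n) = (-(2 * Complex.I) * (n + 1)) • lagGauss 0 q (n + 1) := by
  rw [lagGauss, lagGauss, dStar_sum_gaussMon]
  funext z
  simp only [Finset.sum_apply, Pi.smul_apply, smul_eq_mul, dStar_gaussMon, zero_add]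
  rw [Finset.sum_range_succ' _ (n + 1)]
  have h0 := lagCoeff_succ_zero q n
  have e1 : ∑ j ∈ Finset.range (n + 1), (lagCoeff (q + 1 : ℕ) n j : ℂ) *
      (2 * Complex.I * (gaussMon (j + 1) (q + 1 + j) z
        - ((q + 1 + j : ℕ) : ℂ) * gaussMon j (q + 1 + j - 1) z)) =
      2 * Complex.I * (∑ j ∈ Finset.range (n + 1), (lagCoeff (q + 1 : ℕ) n j : ℂ) *
        gaussMon (j + 1) (q + 1 + j) z - ∑ j ∈ Finset.range (n + 1 + 1),
        (lagCoeff (q + 1 : ℕ) n j : ℂ) * (q + 1 + j) * gaussMon j (q + j) z) := by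
    rw [Finset.sum_range_succ _ (n + 1), lagCoeff_of_lt (Nat.lt_succ_self n)]
    simp only [Complex.ofReal_zero, zero_mul, add_zero]
    rw [← Finset.sum_sub_distrib, Finset.mul_sum]
    refine Finset.sum_congr rfl fun j _ => ?_
    rw [show q + 1 + j - 1 = q + j by omega]
    push_cast
    ring
  rw [e1, Finset.sum_range_succ' _ (n + 1)]
  have e2 : ((n : ℂ) + 1) * lagCoeff q (n + 1) 0 = (q + 1) * lagCoeff (q + 1 : ℕ) n 0 := by
    push_cast
    exact_mod_cast h0
  have e3 : ∑ j ∈ Finset.range (n + 1), (lagCoeff (q + 1 : ℕ) n j : ℂ) *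
        gaussMon (j + 1) (q + 1 + j) z = ∑ j ∈ Finset.range (n + 1),
        ((lagCoeff (q + 1 : ℕ) n (j + 1) : ℂ) * (q + 1 + (j + 1 : ℕ)) * gaussMon (j + 1) (q + (j + 1)) z
        - (n + 1) * (lagCoeff q (n + 1) (j + 1) * gaussMon (j + 1) (q + (j + 1)) z)) := by
    refine Finset.sum_congr rfl fun j _ => ?_
    have := mul_lagCoeff_succ_succ q n j
    have h : ((n : ℂ) + 1) * lagCoeff q (n + 1) (j + 1) =
      (q + j + 2) * lagCoeff (q + 1 : ℕ) n (j + 1) - lagCoeff (q + 1 : ℕ) n j := by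
      push_cast
      exact_mod_cast this
    rw [show q + (j + 1) = q + 1 + j by ring, ← mul_assoc, h]
    push_cast
    ring
  rw [e3, Finset.sum_sub_distrib, ← Finset.mul_sum]
  simp only [Nat.cast_zero, add_zero]
  linear_combination (2 * Complex.I * gaussMon 0 q z) * e2

lemma dAdj_lagGauss_pos (p n : ℕ) :
    dAdj (lagGauss (p + 1) 0 n) = (-(2 * Complex.I) * (n + p + 1)) • lagGauss p 0 n := by
  rw [lagGauss, lagGauss, dAdj_sum_gaussMon, Finset.smul_sum]
  refine Finset.sum_congr rfl fun j _ => ?_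
  funext z
  simp only [Pi.smul_apply, smul_eq_mul, dAdj_gaussMon, add_zero, zero_add]
  have h := mul_lagCoeff_add_one p n j
  have h' : ((p : ℂ) + 1 + j) * lagCoeff (p + 1 : ℕ) n j = (n + p + 1) * lagCoeff p n j := by
    push_cast
    exact_mod_cast h
  rw [show p + 1 + j - 1 = p + j by omega]
  push_cast at h' ⊢
  linear_combination (-(2 * Complex.I) * gaussMon (p + j) j z) * h'

lemma dAdj_lagGauss_neg (q n : ℕ) :
    dAdj (lagGauss 0 q (n + 1)) = (2 * Complex.I) • lagGauss 0 (q + 1) n := by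
  rw [lagGauss, lagGauss, dAdj_sum_gaussMon, Finset.smul_sum, Finset.sum_range_succ']
  funext z
  simp only [Pi.smul_apply, Pi.add_apply, Finset.sum_apply, smul_eq_mul, dAdj_gaussMon, add_zero,
    zero_add, Nat.cast_zero, zero_mul, mul_zero]
  refine Finset.sum_congr rfl fun j _ => ?_
  have h := lagCoeff_succ_succ q n j
  have h' : ((j : ℂ) + 1) * lagCoeff q (n + 1) (j + 1) = -lagCoeff (q + 1 : ℕ) n j := by
    push_cast
    exact_mod_cast h
  rw [show j + 1 - 1 = j by omega, show q + (j + 1) = q + 1 + j by ring]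
  push_cast at h' ⊢
  linear_combination (-(2 * Complex.I) * gaussMon j (q + 1 + j) z) * h'

lemma dAdj_lagGauss_zero (q : ℕ) : dAdj (lagGauss 0 q 0) = 0 := by
  rw [lagGauss, dAdj_sum_gaussMon]
  funext z
  simp [dAdj_gaussMon]

/-- The normalization constant of `f^m_n`. -/
noncomputable def landauNorm (a n : ℕ) : ℝ :=
  √((n.factorial : ℝ) / (Real.pi * ((n + a).factorial : ℝ)))

lemma landauFun_eq (m : ℤ) (n : ℕ) :
    landauFun m n = (landauNorm m.natAbs n : ℂ) • lagGauss m.toNat (-m).toNat n := by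
  funext z
  have hexp : Complex.exp (-(z * starRingEnd ℂ z) / 2) = (Real.exp (-‖z‖ ^ 2 / 2) : ℂ) := by
    rw [Complex.mul_conj, Complex.normSq_eq_norm_sq]; push_cast; rfl
  have hn : ((‖z‖ ^ 2 : ℝ) : ℂ) = z * starRingEnd ℂ z := by
    rw [Complex.mul_conj, Complex.normSq_eq_norm_sq]
  rw [landauFun, laguerre_eq_sum_lagCoeff, lagGauss, Pi.smul_apply, Finset.sum_apply]
  simp only [Pi.smul_apply, smul_eq_mul, gaussMon, hexp]
  rw [show m.toNat + (-m).toNat = m.natAbs by omega]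
  simp only [Complex.ofReal_mul, Complex.ofReal_sum]
  rw [Finset.mul_sum, Finset.sum_mul, Finset.mul_sum]
  refine Finset.sum_congr rfl fun j _ => ?_
  rw [Complex.ofReal_pow, hn, landauNorm]
  rcases le_or_gt 0 m with hm | hm
  · rw [if_pos hm, show m.toNat = m.natAbs by omega, show (-m).toNat = 0 by omega]
    ring
  · rw [if_neg (by omega), show m.toNat = 0 by omega, show (-m).toNat = m.natAbs by omega]
    ring

/-- The phase of `d*` on the sector of angular momentum `m`. -/
noncomputable def landauPhase (m : ℤ) : ℂ := if 0 ≤ m then Complex.I else -Complex.I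

lemma landauPhase_mul_conj (m : ℤ) : starRingEnd ℂ (landauPhase m) * landauPhase m = 1 := by
  rw [landauPhase]; split_ifs <;> simp

lemma landauNorm_succ (a n : ℕ) :
    landauNorm a n = √((n : ℝ) + a + 1) * landauNorm (a + 1) n := by
  rw [landauNorm, landauNorm, ← Real.sqrt_mul (by positivity)]
  congr 1
  rw [← add_assoc, Nat.factorial_succ]
  push_cast
  field_simp

lemma landauNorm_succ_left (a n : ℕ) :
    √((n : ℝ) + 1) * landauNorm (a + 1) n = landauNorm a (n + 1) := by
  rw [landauNorm, landauNorm, ← Real.sqrt_mul (by positivity)]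
  congr 1
  rw [show n + 1 + a = n + (a + 1) by ring, Nat.factorial_succ n]
  push_cast
  field_simp

lemma differentiable_lagGauss (p q n : ℕ) : Differentiable ℝ (lagGauss p q n) :=
  Differentiable.sum fun _ _ => (differentiable_gaussMon _ _).const_smul _

lemma dStar_landauFun (m : ℤ) (n : ℕ) :
    dStar (landauFun m n) =
      (landauPhase m * ((2 * √(landauLevel m n) : ℝ) : ℂ)) • landauFun (m + 1) (lowerIndex m n) := by
  rw [landauFun_eq, landauFun_eq, dStar_smul _ (differentiable_lagGauss _ _ _)]
  rcases le_or_gt 0 m with hm | hm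
  · lift m to ℕ using hm
    rw [landauPhase, if_pos (by omega), lowerIndex, if_pos (by omega), landauLevel,
      max_eq_right (by omega), show (m : ℤ).natAbs = m by omega, show (m : ℤ).toNat = m by omega,
      show (-(m : ℤ)).toNat = 0 by omega, show ((m : ℤ) + 1).natAbs = m + 1 by omega,
      show ((m : ℤ) + 1).toNat = m + 1 by omega, show (-((m : ℤ) + 1)).toNat = 0 by omega,
      dStar_lagGauss_pos, landauNorm_succ, smul_smul, smul_smul]
    congr 1
    push_cast
    ring
  · obtain ⟨k, rfl⟩ : ∃ k : ℕ, m = -((k : ℤ) + 1) := ⟨(-m - 1).toNat, by omega⟩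
    have hs : ((√((n : ℝ) + 1) : ℝ) : ℂ) * (√((n : ℝ) + 1) : ℝ) = n + 1 := by
      rw [← Complex.ofReal_mul, Real.mul_self_sqrt (by positivity)]; push_cast; ring
    rw [landauPhase, if_neg (by omega), lowerIndex, if_neg (by omega), landauLevel,
      max_eq_left (by omega), show (-((k : ℤ) + 1)).natAbs = k + 1 by omega,
      show (-((k : ℤ) + 1)).toNat = 0 by omega, show (-(-((k : ℤ) + 1))).toNat = k + 1 by omega,
      show (-((k : ℤ) + 1) + 1).natAbs = k by omega, show (-((k : ℤ) + 1) + 1).toNat = 0 by omega,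
      show (-(-((k : ℤ) + 1) + 1)).toNat = k by omega, dStar_lagGauss_neg, ← landauNorm_succ_left,
      smul_smul, smul_smul]
    congr 1
    push_cast
    rw [add_zero]
    linear_combination (2 * Complex.I * (landauNorm (k + 1) n : ℂ)) * hs

lemma dAdj_landauFun (m : ℤ) (n : ℕ) :
    dAdj (landauFun (m + 1) (lowerIndex m n)) =
      (starRingEnd ℂ (landauPhase m) * ((2 * √(landauLevel m n) : ℝ) : ℂ)) • landauFun m n := by
  rw [landauFun_eq, landauFun_eq, dAdj_smul _ (differentiable_lagGauss _ _ _)]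
  rcases le_or_gt 0 m with hm | hm
  · lift m to ℕ using hm
    have hs : ((√((n : ℝ) + m + 1) : ℝ) : ℂ) * (√((n : ℝ) + m + 1) : ℝ) = n + m + 1 := by
      rw [← Complex.ofReal_mul, Real.mul_self_sqrt (by positivity)]; push_cast; ring
    rw [landauPhase, if_pos (by omega), lowerIndex, if_pos (by omega), landauLevel,
      max_eq_right (by omega), show (m : ℤ).natAbs = m by omega, show (m : ℤ).toNat = m by omega,
      show (-(m : ℤ)).toNat = 0 by omega, show ((m : ℤ) + 1).natAbs = m + 1 by omega,
      show ((m : ℤ) + 1).toNat = m + 1 by omega, show (-((m : ℤ) + 1)).toNat = 0 by omega,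
      dAdj_lagGauss_pos, landauNorm_succ m, smul_smul, smul_smul, Complex.conj_I]
    congr 1
    push_cast
    linear_combination (2 * Complex.I * (landauNorm (m + 1) n : ℂ)) * hs
  · obtain ⟨k, rfl⟩ : ∃ k : ℕ, m = -((k : ℤ) + 1) := ⟨(-m - 1).toNat, by omega⟩
    rw [landauPhase, if_neg (by omega), lowerIndex, if_neg (by omega), landauLevel,
      max_eq_left (by omega), show (-((k : ℤ) + 1)).natAbs = k + 1 by omega,
      show (-((k : ℤ) + 1)).toNat = 0 by omega, show (-(-((k : ℤ) + 1))).toNat = k + 1 by omega,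
      show (-((k : ℤ) + 1) + 1).natAbs = k by omega, show (-((k : ℤ) + 1) + 1).toNat = 0 by omega,
      show (-(-((k : ℤ) + 1) + 1)).toNat = k by omega, dAdj_lagGauss_neg, ← landauNorm_succ_left,
      smul_smul, smul_smul]
    congr 1
    push_cast
    rw [add_zero, map_neg, Complex.conj_I]
    ring

lemma dAdj_landauFun_zero (k : ℕ) : dAdj (landauFun (-(k : ℤ)) 0) = 0 := by
  rw [landauFun_eq, dAdj_smul _ (differentiable_lagGauss _ _ _), show (-(k : ℤ)).toNat = 0 by omega,
    dAdj_lagGauss_zero, smul_zero]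

/-! ### Gaussian integrals -/

lemma integrable_rpow_mul_gauss {s : ℝ} (hs : -2 < s) :
    Integrable (fun z : ℂ => ‖z‖ ^ s * Real.exp (-‖z‖ ^ 2)) := by
  have h := Complex.integral_rpow_mul_exp_neg_rpow (p := 2) (q := s) (by norm_num) hs
  simp only [Real.rpow_two] at h
  apply Integrable.of_integral_ne_zero
  rw [h]
  have := Real.Gamma_pos_of_pos (show 0 < (s + 2) / 2 by linarith)
  positivity

lemma conj_gaussMon (p q : ℕ) (z : ℂ) : starRingEnd ℂ (gaussMon p q z) = gaussMon q p z := by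
  have h2 : starRingEnd ℂ (2 : ℂ) = 2 := Complex.conj_ofNat 2
  simp only [gaussMon, map_mul, map_pow, ← Complex.exp_conj, map_div₀, map_neg, Complex.conj_conj, h2]
  ring_nf

lemma norm_gaussMon (p q : ℕ) (z : ℂ) :
    ‖gaussMon p q z‖ = ‖z‖ ^ (p + q) * Real.exp (-‖z‖ ^ 2 / 2) := by
  have hexp : Complex.exp (-(z * starRingEnd ℂ z) / 2) = (Real.exp (-‖z‖ ^ 2 / 2) : ℂ) := by
    rw [Complex.mul_conj, Complex.normSq_eq_norm_sq]; push_cast; rfl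
  rw [gaussMon, hexp, norm_mul, norm_mul, norm_pow, norm_pow, RCLike.norm_conj, Complex.norm_real,
    Real.norm_of_nonneg (Real.exp_pos _).le, pow_add]

lemma continuous_gaussMon (p q : ℕ) : Continuous (gaussMon p q) := (contDiff_gaussMon p q).continuous

lemma integrable_gaussMon_mul {s : ℝ} (hs : -2 < s) (p q p' q' : ℕ) :
    Integrable (fun z : ℂ => ((‖z‖ ^ s : ℝ) : ℂ) *
      (starRingEnd ℂ (gaussMon p q z) * gaussMon p' q' z)) := by
  have hint := integrable_rpow_mul_gauss (s := s + (p + q + p' + q' : ℕ)) (by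
    have : (0 : ℝ) ≤ (p + q + p' + q' : ℕ) := by positivity
    linarith)
  refine hint.mono' ?_ ?_
  · have h1 := continuous_gaussMon p q
    have h2 := continuous_gaussMon p' q'
    have h3 : Measurable fun z : ℂ => ((‖z‖ ^ s : ℝ) : ℂ) := by fun_prop
    exact h3.aestronglyMeasurable.mul (by fun_prop)
  · have h0 : ∀ᵐ z : ℂ, z ≠ 0 := by
      rw [ae_iff]; simp
    filter_upwards [h0] with z hz
    have hz' : 0 < ‖z‖ := norm_pos_iff.2 hz
    have he : Real.exp (-‖z‖ ^ 2) = Real.exp (-‖z‖ ^ 2 / 2) * Real.exp (-‖z‖ ^ 2 / 2) := by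
      rw [← Real.exp_add]; congr 1; ring
    rw [norm_mul, norm_mul, RCLike.norm_conj, norm_gaussMon, norm_gaussMon, Complex.norm_real,
      Real.norm_of_nonneg (by positivity), Real.rpow_add hz', Real.rpow_natCast, he]
    apply le_of_eq
    ring

/-- Off the diagonal the integral vanishes because the integrand gets multiplied by `-1` under a
suitable rotation. -/
lemma integral_gaussMon_mul {s : ℝ} (hs : -2 < s) (p q p' q' : ℕ) :
    ∫ z : ℂ, ((‖z‖ ^ s : ℝ) : ℂ) * (starRingEnd ℂ (gaussMon p q z) * gaussMon p' q' z) =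
      if p' + q = p + q' then ((Real.pi * Real.Gamma (p' + q + 1 + s / 2) : ℝ) : ℂ) else 0 := by
  split_ifs with h
  · have key := Complex.integral_rpow_mul_exp_neg_rpow (p := 2) (q := s + 2 * (p' + q : ℕ))
      (by norm_num) (by have : (0 : ℝ) ≤ (p' + q : ℕ) := by positivity
                        linarith)
    have h0 : ∀ᵐ z : ℂ, z ≠ 0 := by
      rw [ae_iff]; simp
    have e : (fun z : ℂ => ((‖z‖ ^ s : ℝ) : ℂ) *
        (starRingEnd ℂ (gaussMon p q z) * gaussMon p' q' z)) =ᵐ[volume]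
        fun z : ℂ => ((‖z‖ ^ (s + 2 * (p' + q : ℕ)) * Real.exp (-‖z‖ ^ (2 : ℝ)) : ℝ) : ℂ) := by
      filter_upwards [h0] with z hz
      have hz' : 0 < ‖z‖ := norm_pos_iff.2 hz
      have hexp : Complex.exp (-(z * starRingEnd ℂ z) / 2) = (Real.exp (-‖z‖ ^ 2 / 2) : ℂ) := by
        rw [Complex.mul_conj, Complex.normSq_eq_norm_sq]; push_cast; rfl
      have he : Real.exp (-‖z‖ ^ 2) = Real.exp (-‖z‖ ^ 2 / 2) * Real.exp (-‖z‖ ^ 2 / 2) := by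
        rw [← Real.exp_add]; congr 1; ring
      have hn : ((‖z‖ : ℂ)) ^ 2 = z * starRingEnd ℂ z := by
        rw [Complex.mul_conj, Complex.normSq_eq_norm_sq]; push_cast; rfl
      rw [conj_gaussMon, gaussMon, gaussMon, hexp, Real.rpow_add hz', Real.rpow_two, he,
        show (2 : ℝ) * (p' + q : ℕ) = ((2 * (p' + q) : ℕ) : ℝ) by push_cast; ring,
        Real.rpow_natCast]
      push_cast
      rw [pow_mul, hn, mul_pow]
      have e1 : z ^ q * z ^ p' = z ^ (p' + q) := by rw [← pow_add, add_comm]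
      have e2 : (starRingEnd ℂ z) ^ p * (starRingEnd ℂ z) ^ q' = (starRingEnd ℂ z) ^ (p' + q) := by
        rw [← pow_add, h]
      rw [← e1, ← e2]
      ring
    rw [integral_congr_ae e, integral_complex_ofReal, key]
    congr 3
    · ring
    · push_cast; ring
  · set F : ℂ → ℂ := fun z => ((‖z‖ ^ s : ℝ) : ℂ) *
      (starRingEnd ℂ (gaussMon p q z) * gaussMon p' q' z) with hF
    set d : ℝ := (p' + q : ℝ) - (p + q') with hd
    have hd0 : d ≠ 0 := by
      rw [hd, sub_ne_zero]; exact_mod_cast h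
    set c : Circle := Circle.exp (Real.pi / d) with hc
    have hrot : ∀ z, F (rotation c z) = -F z := by
      intro z
      have hw : (c : ℂ) = Complex.exp ((Real.pi / d : ℝ) * Complex.I) := by rw [hc, Circle.coe_exp]
      have hcw : starRingEnd ℂ (c : ℂ) = Complex.exp (-((Real.pi / d : ℝ) * Complex.I)) := by
        rw [hw, ← Complex.exp_conj, map_mul, Complex.conj_I, Complex.conj_ofReal, mul_neg]
      have h1 : (c : ℂ) * starRingEnd ℂ (c : ℂ) = 1 := by
        rw [hcw, hw, ← Complex.exp_add]; simp
      have h2 : (c : ℂ) ^ (p' + q) * (starRingEnd ℂ (c : ℂ)) ^ (p + q') = -1 := by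
        rw [hcw, hw, ← Complex.exp_nat_mul, ← Complex.exp_nat_mul, ← Complex.exp_add,
          ← Complex.exp_pi_mul_I]
        congr 1
        have : ((d : ℝ) : ℂ) ≠ 0 := by exact_mod_cast hd0
        have hd' : ((d : ℝ) : ℂ) = (p' + q : ℂ) - (p + q') := by rw [hd]; push_cast; ring
        push_cast
        field_simp
        rw [hd']
        ring
      have h3 : rotation c z * starRingEnd ℂ (rotation c z) = z * starRingEnd ℂ z := by
        rw [rotation_apply, map_mul]
        linear_combination (z * starRingEnd ℂ z) * h1
      simp only [hF, LinearIsometryEquiv.norm_map, conj_gaussMon]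
      rw [gaussMon, gaussMon, gaussMon, gaussMon, h3, rotation_apply, map_mul]
      rw [mul_pow, mul_pow, mul_pow, mul_pow]
      rw [pow_add, pow_add] at h2
      linear_combination (((‖z‖ ^ s : ℝ) : ℂ) * (z ^ q * (starRingEnd ℂ z) ^ p *
        Complex.exp (-(z * starRingEnd ℂ z) / 2) * (z ^ p' * (starRingEnd ℂ z) ^ q' *
        Complex.exp (-(z * starRingEnd ℂ z) / 2)))) * h2
    have hI : ∫ z, F (rotation c z) = ∫ z, F z :=
      (rotation c).measurePreserving.integral_comp'
        (f := (rotation c).toHomeomorph.toMeasurableEquiv) F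
    simp_rw [hrot] at hI
    rw [integral_neg] at hI
    exact self_eq_neg.1 hI.symm

/-- The span of the functions `z ^ p * conj z ^ q * exp (-|z|² / 2)`. -/
noncomputable def gaussSpan : Submodule ℂ (ℂ → ℂ) :=
  Submodule.span ℂ (Set.range fun p : ℕ × ℕ => gaussMon p.1 p.2)

lemma gaussMon_mem (p q : ℕ) : gaussMon p q ∈ gaussSpan := Submodule.subset_span ⟨(p, q), rfl⟩

lemma contDiff_of_mem_gaussSpan {f : ℂ → ℂ} (hf : f ∈ gaussSpan) : ContDiff ℝ ∞ f := by
  induction hf using Submodule.span_induction with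
  | mem f hf => obtain ⟨p, rfl⟩ := hf; exact contDiff_gaussMon _ _
  | zero => exact contDiff_const
  | add f g _ _ hf hg => exact hf.add hg
  | smul c f _ hf => exact contDiff_const.smul hf

lemma differentiable_of_mem_gaussSpan {f : ℂ → ℂ} (hf : f ∈ gaussSpan) : Differentiable ℝ f :=
  (contDiff_of_mem_gaussSpan hf).differentiable (by simp)

lemma dStar_mem_gaussSpan {f : ℂ → ℂ} (hf : f ∈ gaussSpan) : dStar f ∈ gaussSpan := by
  induction hf using Submodule.span_induction with
  | mem f hf =>
    obtain ⟨p, rfl⟩ := hf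
    have : dStar (gaussMon p.1 p.2) = (2 * Complex.I) • (gaussMon (p.1 + 1) p.2 -
        (p.2 : ℂ) • gaussMon p.1 (p.2 - 1)) := by
      funext z; simp [dStar_gaussMon]
    simp only [this]
    exact gaussSpan.smul_mem _ (gaussSpan.sub_mem (gaussMon_mem _ _)
      (gaussSpan.smul_mem _ (gaussMon_mem _ _)))
  | zero =>
    have : dStar (0 : ℂ → ℂ) = 0 := by funext z; simp [dStar]
    rw [this]; exact gaussSpan.zero_mem
  | add f g hf' hg' hf hg =>
    rw [dStar_add (differentiable_of_mem_gaussSpan hf') (differentiable_of_mem_gaussSpan hg')]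
    exact gaussSpan.add_mem hf hg
  | smul c f hf' hf =>
    rw [dStar_smul _ (differentiable_of_mem_gaussSpan hf')]
    exact gaussSpan.smul_mem _ hf

lemma dAdj_mem_gaussSpan {f : ℂ → ℂ} (hf : f ∈ gaussSpan) : dAdj f ∈ gaussSpan := by
  induction hf using Submodule.span_induction with
  | mem f hf =>
    obtain ⟨p, rfl⟩ := hf
    have : dAdj (gaussMon p.1 p.2) = (-(2 * Complex.I) * p.1) • gaussMon (p.1 - 1) p.2 := by
      funext z; simp [dAdj_gaussMon]; ring
    simp only [this]
    exact gaussSpan.smul_mem _ (gaussMon_mem _ _)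
  | zero =>
    have : dAdj (0 : ℂ → ℂ) = 0 := by funext z; simp [dAdj]
    rw [this]; exact gaussSpan.zero_mem
  | add f g hf' hg' hf hg =>
    rw [dAdj_add (differentiable_of_mem_gaussSpan hf') (differentiable_of_mem_gaussSpan hg')]
    exact gaussSpan.add_mem hf hg
  | smul c f hf' hf =>
    rw [dAdj_smul _ (differentiable_of_mem_gaussSpan hf')]
    exact gaussSpan.smul_mem _ hf

lemma integrable_mul_of_mem_gaussSpan {s : ℝ} (hs : -2 < s) {f g : ℂ → ℂ} (hf : f ∈ gaussSpan)
    (hg : g ∈ gaussSpan) :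
    Integrable (fun z : ℂ => ((‖z‖ ^ s : ℝ) : ℂ) * (starRingEnd ℂ (f z) * g z)) := by
  induction hf using Submodule.span_induction with
  | mem f hf =>
    obtain ⟨p, rfl⟩ := hf
    induction hg using Submodule.span_induction with
    | mem g hg => obtain ⟨q, rfl⟩ := hg; exact integrable_gaussMon_mul hs _ _ _ _
    | zero => simp
    | add g g' _ _ hg hg' => exact (hg.add hg').congr (ae_of_all _ fun z => by simp [mul_add])
    | smul c g _ hg =>
      refine (hg.const_mul c).congr (ae_of_all _ fun z => ?_)
      simp only [Pi.smul_apply, smul_eq_mul]; ring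
  | zero => simp
  | add f f' _ _ hf hf' => exact (hf.add hf').congr (ae_of_all _ fun z => by simp [mul_add, add_mul])
  | smul c f _ hf =>
    refine (hf.const_mul (starRingEnd ℂ c)).congr (ae_of_all _ fun z => ?_)
    simp only [Pi.smul_apply, smul_eq_mul, map_mul]; ring

lemma lagGauss_mem (p q n : ℕ) : lagGauss p q n ∈ gaussSpan :=
  Submodule.sum_mem _ fun _ _ => gaussSpan.smul_mem _ (gaussMon_mem _ _)

lemma landauFun_mem (m : ℤ) (n : ℕ) : landauFun m n ∈ gaussSpan := by
  rw [landauFun_eq]; exact gaussSpan.smul_mem _ (lagGauss_mem _ _ _)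

lemma integral_landauFun_mul {s : ℝ} (hs : -2 < s) (m m' : ℤ) (n n' : ℕ) :
    ∫ z : ℂ, ((‖z‖ ^ s : ℝ) : ℂ) * (starRingEnd ℂ (landauFun m n z) * landauFun m' n' z) =
      if m = m' then ((landauNorm m.natAbs n * landauNorm m.natAbs n' * Real.pi *
        ∑ i ∈ Finset.range (n + 1), ∑ j ∈ Finset.range (n' + 1),
          lagCoeff m.natAbs n i * lagCoeff m.natAbs n' j *
            Real.Gamma (m.natAbs + 1 + s / 2 + i + j) : ℝ) : ℂ) else 0 := by
  have e : ∀ z : ℂ, ((‖z‖ ^ s : ℝ) : ℂ) * (starRingEnd ℂ (landauFun m n z) * landauFun m' n' z) =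
      ∑ i ∈ Finset.range (n + 1), ∑ j ∈ Finset.range (n' + 1),
        (landauNorm m.natAbs n * landauNorm m'.natAbs n' * (lagCoeff m.natAbs n i *
          lagCoeff m'.natAbs n' j) : ℂ) * (((‖z‖ ^ s : ℝ) : ℂ) *
          (starRingEnd ℂ (gaussMon (m.toNat + i) ((-m).toNat + i) z) *
            gaussMon (m'.toNat + j) ((-m').toNat + j) z)) := by
    intro z
    rw [landauFun_eq, landauFun_eq, lagGauss, lagGauss, show m.toNat + (-m).toNat = m.natAbs by omega,
      show m'.toNat + (-m').toNat = m'.natAbs by omega]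
    simp only [Pi.smul_apply, Finset.sum_apply, smul_eq_mul, map_mul, map_sum, Complex.conj_ofReal]
    rw [show ∀ a b c d : ℂ, a * b * (c * d) = a * c * (b * d) by intros; ring, Finset.sum_mul_sum,
      Finset.mul_sum, Finset.mul_sum]
    refine Finset.sum_congr rfl fun i _ => ?_
    rw [Finset.mul_sum, Finset.mul_sum]
    exact Finset.sum_congr rfl fun j _ => by ring
  simp_rw [e]
  have hi : ∀ i j, Integrable fun z : ℂ => (landauNorm m.natAbs n * landauNorm m'.natAbs n' *
      (lagCoeff m.natAbs n i * lagCoeff m'.natAbs n' j) : ℂ) * (((‖z‖ ^ s : ℝ) : ℂ) *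
          (starRingEnd ℂ (gaussMon (m.toNat + i) ((-m).toNat + i) z) *
            gaussMon (m'.toNat + j) ((-m').toNat + j) z)) := fun i j =>
    (integrable_gaussMon_mul hs _ _ _ _).const_mul _
  rw [integral_finsetSum _ fun i _ => integrable_finsetSum _ fun j _ => hi i j]
  simp_rw [integral_finsetSum _ fun j _ => hi _ j, integral_const_mul, integral_gaussMon_mul hs]
  split_ifs with h
  · subst h
    push_cast
    rw [Finset.mul_sum]
    refine Finset.sum_congr rfl fun i _ => ?_
    rw [Finset.mul_sum]
    refine Finset.sum_congr rfl fun j _ => ?_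
    rw [if_pos (by omega)]
    rw [show (m.toNat : ℝ) + j + ((-m).toNat + i) + 1 + s / 2 =
      m.natAbs + 1 + s / 2 + i + j by
        have : (m.toNat : ℝ) + j + ((-m).toNat + i) = m.natAbs + i + j := by
          exact_mod_cast (by omega : (m.toNat + j) + ((-m).toNat + i) = m.natAbs + i + j)
        rw [this]; ring]
    ring
  · refine Finset.sum_eq_zero fun i _ => Finset.sum_eq_zero fun j _ => ?_
    rw [if_neg (by omega), mul_zero]

lemma landauNorm_mul_mul_pi (a n n' : ℕ) : landauNorm a n * landauNorm a n' * Real.pi =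
    √(n.factorial / (n + a).factorial) * √(n'.factorial / (n' + a).factorial) := by
  have h : ∀ n : ℕ, landauNorm a n = √(n.factorial / (n + a).factorial) / √Real.pi := by
    intro n
    rw [landauNorm, ← Real.sqrt_div (by positivity)]
    congr 1
    field_simp
  have := Real.mul_self_sqrt Real.pi_pos.le
  have h0 : √Real.pi ≠ 0 := (Real.sqrt_pos.2 Real.pi_pos).ne'
  rw [h, h]
  nth_rw 3 [← this]
  field_simp

lemma integral_landauFun_inner (m m' : ℤ) (n n' : ℕ) :
    ∫ z : ℂ, starRingEnd ℂ (landauFun m n z) * landauFun m' n' z =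
      if m = m' ∧ n = n' then 1 else 0 := by
  have h := integral_landauFun_mul (s := 0) (by norm_num) m m' n n'
  simp only [Real.rpow_zero, Complex.ofReal_one, one_mul, zero_div, add_zero] at h
  rw [h, sum_lagCoeff_lagCoeff (by
    have : (0 : ℝ) ≤ m.natAbs := by positivity
    linarith), landauNorm_mul_mul_pi]
  by_cases hm : m = m'
  · by_cases hn : n = n'
    · subst hn
      rw [if_pos hm, if_pos rfl, if_pos ⟨hm, rfl⟩, Real.mul_self_sqrt (by positivity),
        ← Nat.cast_add, Real.Gamma_nat_eq_factorial]
      have : ((n + m.natAbs).factorial : ℝ) ≠ 0 := by positivity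
      have : (n.factorial : ℝ) ≠ 0 := by positivity
      field_simp
      simp
    · rw [if_pos hm, if_neg hn, if_neg (by tauto)]; simp
  · rw [if_neg hm, if_neg (by tauto)]

lemma integral_landauFun_coulomb (m m' : ℤ) (n n' : ℕ) :
    ∫ z : ℂ, ((‖z‖⁻¹ : ℝ) : ℂ) * (starRingEnd ℂ (landauFun m n z) * landauFun m' n' z) =
      if m = m' then (coulombMatrix m.natAbs n n' : ℂ) else 0 := by
  have h := integral_landauFun_mul (s := -1) (by norm_num) m m' n n'
  simp only [Real.rpow_neg_one] at h
  rw [h, landauNorm_mul_mul_pi, coulombMatrix_eq,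
    show ((m.natAbs : ℝ) + 1 + -1 / 2) = m.natAbs + 1 / 2 by ring]

/-! ### The Weyl operator on Landau spinors -/

lemma fderiv_spinor_apply {u : ℂ → Spinor} {x : ℂ} (hu : DifferentiableAt ℝ u x) (v : ℂ) (i : Fin 2) :
    fderiv ℝ u x v i = fderiv ℝ (fun y => u y i) x v := by
  have h : HasFDerivAt (fun y => u y i)
      ((PiLp.proj 2 (𝕜 := ℝ) (fun _ : Fin 2 => ℂ) i).comp (fderiv ℝ u x)) x :=
    ((PiLp.proj 2 (𝕜 := ℝ) (fun _ : Fin 2 => ℂ) i).hasFDerivAt).comp x hu.hasFDerivAt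
  rw [h.fderiv]
  rfl

lemma weyl_apply_zero (Z : ℝ) {u : ℂ → Spinor} {x : ℂ} (hu : DifferentiableAt ℝ u x) :
    weyl Z u x 0 = dAdj (fun y => u y 1) x - (Z / ‖x‖ : ℝ) * u x 0 := by
  have hcx : starRingEnd ℂ x = x.re - x.im * Complex.I := by
    apply Complex.ext <;> simp
  simp only [weyl, kinMom₁, kinMom₂, pauli₁, pauli₂, dAdj, PiLp.sub_apply, PiLp.smul_apply, smul_eq_mul,
    Matrix.mulVec, dotProduct, Fin.sum_univ_two, Pi.add_apply, PiLp.add_apply,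
    fderiv_spinor_apply hu, hcx, neg_smul, PiLp.neg_apply]
  simp
  linear_combination (-(x.im * u x 1)) * Complex.I_mul_I

lemma weyl_apply_one (Z : ℝ) {u : ℂ → Spinor} {x : ℂ} (hu : DifferentiableAt ℝ u x) :
    weyl Z u x 1 = dStar (fun y => u y 0) x - (Z / ‖x‖ : ℝ) * u x 1 := by
  have hx : (x : ℂ) = x.re + x.im * Complex.I := (Complex.re_add_im x).symm
  simp only [weyl, kinMom₁, kinMom₂, pauli₁, pauli₂, dStar, PiLp.sub_apply, PiLp.smul_apply, smul_eq_mul,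
    Matrix.mulVec, dotProduct, Fin.sum_univ_two, Pi.add_apply, PiLp.add_apply,
    fderiv_spinor_apply hu, neg_smul, PiLp.neg_apply]
  simp
  linear_combination (-Complex.I * u x 0) * hx - (x.im * u x 0) * Complex.I_mul_I

/-- Spinors whose components are polynomials in `z` and `conj z` times `exp (-|z|² / 2)`. -/
noncomputable def spinorGauss : Submodule ℂ (ℂ → Spinor) where
  carrier := {u | ∀ i, (fun z => u z i) ∈ gaussSpan}
  zero_mem' _ := gaussSpan.zero_mem
  add_mem' hu hv i := gaussSpan.add_mem (hu i) (hv i)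
  smul_mem' c _ hu i := gaussSpan.smul_mem c (hu i)

lemma contDiff_of_mem_spinorGauss {u : ℂ → Spinor} (hu : u ∈ spinorGauss) : ContDiff ℝ ∞ u :=
  (contDiff_piLp (n := ∞) 2).2 fun i => contDiff_of_mem_gaussSpan (hu i)

lemma differentiable_of_mem_spinorGauss {u : ℂ → Spinor} (hu : u ∈ spinorGauss) :
    Differentiable ℝ u :=
  (contDiff_of_mem_spinorGauss hu).differentiable (by simp)

lemma weyl_eq_sub (Z : ℝ) (u : ℂ → Spinor) (x : ℂ) :
    weyl Z u x = weyl 0 u x - (Z : ℂ) • (((‖x‖⁻¹ : ℝ) : ℂ) • u x) := by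
  simp only [weyl, smul_smul, div_eq_mul_inv, Complex.ofReal_mul, Complex.ofReal_zero, zero_mul,
    zero_smul, sub_zero]

lemma weyl_zero_mem_spinorGauss {u : ℂ → Spinor} (hu : u ∈ spinorGauss) :
    weyl 0 u ∈ spinorGauss := by
  have hd := differentiable_of_mem_spinorGauss hu
  intro i
  fin_cases i
  · have : (fun z => weyl 0 u z 0) = dAdj (fun y => u y 1) := by
      funext z; rw [weyl_apply_zero 0 (hd z)]; simp
    exact this ▸ dAdj_mem_gaussSpan (hu 1)
  · have : (fun z => weyl 0 u z 1) = dStar (fun y => u y 0) := by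
      funext z; rw [weyl_apply_one 0 (hd z)]; simp
    exact this ▸ dStar_mem_gaussSpan (hu 0)

lemma spinor_inner (a b : Spinor) :
    inner ℂ a b = starRingEnd ℂ (a 0) * b 0 + starRingEnd ℂ (a 1) * b 1 := by
  simp [PiLp.inner_apply, Fin.sum_univ_two, mul_comm]

lemma integrable_inner_of_mem_spinorGauss {s : ℝ} (hs : -2 < s) {u v : ℂ → Spinor}
    (hu : u ∈ spinorGauss) (hv : v ∈ spinorGauss) :
    Integrable (fun x : ℂ => ((‖x‖ ^ s : ℝ) : ℂ) * inner ℂ (u x) (v x)) := by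
  refine ((integrable_mul_of_mem_gaussSpan hs (hu 0) (hv 0)).add
    (integrable_mul_of_mem_gaussSpan hs (hu 1) (hv 1))).congr (ae_of_all _ fun x => ?_)
  simp only [Pi.add_apply, spinor_inner, mul_add]

lemma integrable_inner {u v : ℂ → Spinor} (hu : u ∈ spinorGauss) (hv : v ∈ spinorGauss) :
    Integrable (fun x : ℂ => inner ℂ (u x) (v x)) := by
  simpa using integrable_inner_of_mem_spinorGauss (s := 0) (by norm_num) hu hv

lemma integrable_coulomb {u v : ℂ → Spinor} (hu : u ∈ spinorGauss) (hv : v ∈ spinorGauss) :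
    Integrable (fun x : ℂ => ((‖x‖⁻¹ : ℝ) : ℂ) * inner ℂ (u x) (v x)) := by
  simpa [Real.rpow_neg_one] using integrable_inner_of_mem_spinorGauss (s := -1) (by norm_num) hu hv

lemma inner_weyl (Z : ℝ) (u v : ℂ → Spinor) (x : ℂ) : inner ℂ (u x) (weyl Z v x) =
    inner ℂ (u x) (weyl 0 v x) - (Z : ℂ) * (((‖x‖⁻¹ : ℝ) : ℂ) * inner ℂ (u x) (v x)) := by
  rw [weyl_eq_sub, inner_sub_right, inner_smul_right, inner_smul_right]

lemma integrable_inner_weyl (Z : ℝ) {u v : ℂ → Spinor} (hu : u ∈ spinorGauss)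
    (hv : v ∈ spinorGauss) : Integrable (fun x => inner ℂ (u x) (weyl Z v x)) := by
  simp_rw [inner_weyl Z u v]
  exact (integrable_inner hu (weyl_zero_mem_spinorGauss hv)).sub ((integrable_coulomb hu hv).const_mul _)

lemma memLp_of_mem_spinorGauss {u : ℂ → Spinor} (hu : u ∈ spinorGauss) :
    MemLp u 2 (volume : Measure ℂ) := by
  rw [memLp_two_iff_integrable_sq_norm
    (contDiff_of_mem_spinorGauss hu).continuous.aestronglyMeasurable]
  refine (integrable_inner hu hu).re.congr (ae_of_all _ fun x => ?_)
  exact inner_self_eq_norm_sq (𝕜 := ℂ) (u x)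

/-- The spinor `(f^m_n, σ d* |d*|⁻¹ f^m_n) / √2`, an eigenfunction of `W₀` for `σ = ± 1`. -/
noncomputable def signedSpinor (σ : ℝ) (m : ℤ) (n : ℕ) (z : ℂ) : Spinor :=
  ((√2)⁻¹ : ℂ) • !₂[landauFun m n z, σ * landauPhase m * landauFun (m + 1) (lowerIndex m n) z]

lemma landauSpinor_eq (m : ℤ) (n : ℕ) : landauSpinor m n = signedSpinor 1 m n := by
  funext z
  have h := one_le_landauLevel m n
  have hs : ((√(landauLevel m n) : ℝ) : ℂ) ≠ 0 := by
    exact_mod_cast (Real.sqrt_pos.2 (by linarith)).ne'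
  rw [landauSpinor, signedSpinor, dStar_landauFun, ← landauLevel]
  congr 4
  simp only [Pi.smul_apply, smul_eq_mul]
  push_cast
  field_simp

lemma signedSpinor_mem (σ : ℝ) (m : ℤ) (n : ℕ) : signedSpinor σ m n ∈ spinorGauss := by
  intro i
  fin_cases i
  · exact gaussSpan.smul_mem _ (landauFun_mem m n)
  · exact gaussSpan.smul_mem _ (gaussSpan.smul_mem _ (landauFun_mem _ _))

lemma landauSpinor_mem (m : ℤ) (n : ℕ) : landauSpinor m n ∈ spinorGauss :=
  landauSpinor_eq m n ▸ signedSpinor_mem 1 m n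

lemma landauSpan_le : landauSpan ≤ spinorGauss := by
  rw [landauSpan, Submodule.span_le]
  rintro _ ⟨p, rfl⟩
  exact landauSpinor_mem _ _

lemma weyl_signedSpinor {σ : ℝ} (hσ : σ * σ = 1) (m : ℤ) (n : ℕ) :
    weyl 0 (signedSpinor σ m n) = ((σ * (2 * √(landauLevel m n)) : ℝ) : ℂ) • signedSpinor σ m n := by
  have hd := differentiable_of_mem_spinorGauss (signedSpinor_mem σ m n)
  have hf := differentiable_of_mem_gaussSpan (landauFun_mem m n)
  have hf' := differentiable_of_mem_gaussSpan (landauFun_mem (m + 1) (lowerIndex m n))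
  have hσ' : (σ : ℂ) * σ = 1 := by exact_mod_cast hσ
  funext z
  ext i
  fin_cases i
  · have e : (fun y => signedSpinor σ m n y 1) =
        (((√2)⁻¹ : ℂ) * (σ * landauPhase m)) • landauFun (m + 1) (lowerIndex m n) := by
      funext y; simp [signedSpinor]; ring
    change weyl 0 (signedSpinor σ m n) z 0 = _
    rw [weyl_apply_zero 0 (hd z), e, dAdj_smul _ hf', dAdj_landauFun]
    have := landauPhase_mul_conj m
    simp [signedSpinor]
    linear_combination ((√2 : ℂ)⁻¹ * σ * 2 * √(landauLevel m n) * landauFun m n z) * this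
  · have e : (fun y => signedSpinor σ m n y 0) = ((√2)⁻¹ : ℂ) • landauFun m n := by
      funext y; simp [signedSpinor]
    change weyl 0 (signedSpinor σ m n) z 1 = _
    rw [weyl_apply_one 0 (hd z), e, dStar_smul _ hf, dStar_landauFun]
    simp [signedSpinor]
    linear_combination (-(√2 : ℂ)⁻¹ * landauPhase m * 2 * √(landauLevel m n) *
      landauFun (m + 1) (lowerIndex m n) z) * hσ'

/-- The zero modes of `W₀`. -/
noncomputable def zeroMode (k : ℕ) (z : ℂ) : Spinor := !₂[0, landauFun (-(k : ℤ)) 0 z]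

lemma zeroMode_mem (k : ℕ) : zeroMode k ∈ spinorGauss := by
  intro i
  fin_cases i
  · exact gaussSpan.zero_mem
  · exact landauFun_mem _ _

lemma weyl_zeroMode (k : ℕ) : weyl 0 (zeroMode k) = 0 := by
  have hd := differentiable_of_mem_spinorGauss (zeroMode_mem k)
  funext z
  ext i
  fin_cases i
  · have e : (fun y => zeroMode k y 1) = landauFun (-(k : ℤ)) 0 := by
      funext y; simp [zeroMode]
    change weyl 0 (zeroMode k) z 0 = _
    rw [weyl_apply_zero 0 (hd z), e, dAdj_landauFun_zero]
    simp
  · have e : (fun y => zeroMode k y 0) = 0 := by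
      funext y; simp [zeroMode]
    change weyl 0 (zeroMode k) z 1 = _
    rw [weyl_apply_one 0 (hd z), e]
    simp [dStar, zeroMode]

/-- The index set of the eigenfunctions of `W₀`: positive and negative eigenvalues, zero modes. -/
abbrev WeylIndex : Type := (ℤ × ℕ) ⊕ (ℤ × ℕ) ⊕ ℕ

/-- The eigenfunctions of `W₀`. -/
noncomputable def weylEigenfun : WeylIndex → ℂ → Spinor
  | .inl p => signedSpinor 1 p.1 p.2
  | .inr (.inl p) => signedSpinor (-1) p.1 p.2
  | .inr (.inr k) => zeroMode k

lemma weylEigenfun_inl (p : ℤ × ℕ) : weylEigenfun (.inl p) = signedSpinor 1 p.1 p.2 := rfl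

lemma weylEigenfun_inr_inl (p : ℤ × ℕ) :
    weylEigenfun (.inr (.inl p)) = signedSpinor (-1) p.1 p.2 := rfl

lemma weylEigenfun_inr_inr (k : ℕ) : weylEigenfun (.inr (.inr k)) = zeroMode k := rfl

/-- The eigenvalues of `W₀`. -/
noncomputable def weylEigenval : WeylIndex → ℝ
  | .inl p => 2 * √(landauLevel p.1 p.2)
  | .inr (.inl p) => -(2 * √(landauLevel p.1 p.2))
  | .inr (.inr _) => 0

lemma weylEigenval_pos_iff (i : WeylIndex) : 0 < weylEigenval i ↔ ∃ p, i = .inl p := by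
  have h : ∀ p : ℤ × ℕ, 0 < √(landauLevel p.1 p.2) := fun p =>
    Real.sqrt_pos.2 (by linarith [one_le_landauLevel p.1 p.2])
  rcases i with p | p | k
  · simpa [weylEigenval] using h p
  · simp [weylEigenval]
  · simp [weylEigenval]

lemma weylEigenfun_mem (i : WeylIndex) : weylEigenfun i ∈ spinorGauss := by
  rcases i with p | p | k
  exacts [signedSpinor_mem _ _ _, signedSpinor_mem _ _ _, zeroMode_mem _]

lemma weyl_weylEigenfun (i : WeylIndex) :
    weyl 0 (weylEigenfun i) = (weylEigenval i : ℂ) • weylEigenfun i := by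
  rcases i with p | p | k
  · simpa [weylEigenval, weylEigenfun_inl] using weyl_signedSpinor (σ := 1) (by norm_num) p.1 p.2
  · simpa [weylEigenval, weylEigenfun_inr_inl] using
      weyl_signedSpinor (σ := -1) (by norm_num) p.1 p.2
  · simpa [weylEigenval, weylEigenfun_inr_inr] using weyl_zeroMode k

lemma inv_sqrt_two_mul : ((√2 : ℝ) : ℂ)⁻¹ * ((√2 : ℝ) : ℂ)⁻¹ = 1 / 2 := by
  rw [← mul_inv, ← Complex.ofReal_mul, Real.mul_self_sqrt (by norm_num)]; norm_num

lemma inner_signedSpinor (σ τ : ℝ) (m m' : ℤ) (n n' : ℕ) (z : ℂ) :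
    inner ℂ (signedSpinor σ m n z) (signedSpinor τ m' n' z) =
      1 / 2 * (starRingEnd ℂ (landauFun m n z) * landauFun m' n' z) +
      1 / 2 * (σ * τ * (starRingEnd ℂ (landauPhase m) * landauPhase m')) *
        (starRingEnd ℂ (landauFun (m + 1) (lowerIndex m n) z) *
          landauFun (m' + 1) (lowerIndex m' n') z) := by
  have h := inv_sqrt_two_mul
  rw [spinor_inner]
  simp [signedSpinor]
  linear_combination (starRingEnd ℂ (landauFun m n z) * landauFun m' n' z +
      (σ * τ * (starRingEnd ℂ (landauPhase m) * landauPhase m')) *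
        (starRingEnd ℂ (landauFun (m + 1) (lowerIndex m n) z) *
          landauFun (m' + 1) (lowerIndex m' n') z)) * h

lemma integrable_conj_landauFun_mul (m m' : ℤ) (n n' : ℕ) :
    Integrable fun z : ℂ => starRingEnd ℂ (landauFun m n z) * landauFun m' n' z := by
  simpa using integrable_mul_of_mem_gaussSpan (s := 0) (by norm_num) (landauFun_mem m n)
    (landauFun_mem m' n')

lemma lowerIndex_inj (m : ℤ) {n n' : ℕ} : lowerIndex m n = lowerIndex m n' ↔ n = n' := by
  simp only [lowerIndex]; split_ifs <;> simp

lemma integral_inner_signedSpinor (σ τ : ℝ) (m m' : ℤ) (n n' : ℕ) :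
    ∫ z, inner ℂ (signedSpinor σ m n z) (signedSpinor τ m' n' z) =
      if m = m' ∧ n = n' then (1 + σ * τ : ℂ) / 2 else 0 := by
  simp_rw [inner_signedSpinor]
  rw [integral_add ((integrable_conj_landauFun_mul _ _ _ _).const_mul _)
    ((integrable_conj_landauFun_mul _ _ _ _).const_mul _), integral_const_mul, integral_const_mul,
    integral_landauFun_inner, integral_landauFun_inner]
  by_cases hm : m = m'
  · subst hm
    simp only [true_and, lowerIndex_inj, landauPhase_mul_conj]
    split_ifs <;> ring
  · rw [if_neg (by tauto), if_neg (by omega), if_neg (by tauto)]; simp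

lemma integral_inner_weylEigenfun (i j : WeylIndex) :
    ∫ z, inner ℂ (weylEigenfun i z) (weylEigenfun j z) = if i = j then 1 else 0 := by
  have hz : ∀ (m : ℤ) (n k : ℕ), ¬(m + 1 = -(k : ℤ) ∧ lowerIndex m n = 0) := by
    intro m n k ⟨h1, h2⟩
    rw [lowerIndex, if_neg (by omega)] at h2
    omega
  have hzero : ∀ (σ : ℝ) (m : ℤ) (n k : ℕ),
      ∫ z, inner ℂ (signedSpinor σ m n z) (zeroMode k z) = 0 := by
    intro σ m n k
    have e : ∀ z, inner ℂ (signedSpinor σ m n z) (zeroMode k z) =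
        (starRingEnd ℂ ((√2 : ℂ)⁻¹ * (σ * landauPhase m))) *
        (starRingEnd ℂ (landauFun (m + 1) (lowerIndex m n) z) * landauFun (-(k : ℤ)) 0 z) := by
      intro z; rw [spinor_inner]; simp [signedSpinor, zeroMode]; ring
    simp_rw [e]
    rw [integral_const_mul, integral_landauFun_inner, if_neg (hz m n k), mul_zero]
  have hzero' : ∀ (σ : ℝ) (m : ℤ) (n k : ℕ),
      ∫ z, inner ℂ (zeroMode k z) (signedSpinor σ m n z) = 0 := by
    intro σ m n k
    have := congrArg (starRingEnd ℂ) (hzero σ m n k)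
    rw [← integral_conj, map_zero] at this
    simpa only [inner_conj_symm] using this
  rcases i with p | p | k <;> rcases j with q | q | l
  · have := integral_inner_signedSpinor 1 1 p.1 q.1 p.2 q.2
    simp only [weylEigenfun, this, Sum.inl.injEq, Prod.ext_iff]
    norm_num
  · have := integral_inner_signedSpinor 1 (-1) p.1 q.1 p.2 q.2
    rw [weylEigenfun_inl, weylEigenfun_inr_inl, this]
    simp
  · simpa [weylEigenfun] using hzero _ _ _ _
  · have := integral_inner_signedSpinor (-1) 1 p.1 q.1 p.2 q.2
    rw [weylEigenfun_inl, weylEigenfun_inr_inl, this]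
    simp
  · have := integral_inner_signedSpinor (-1) (-1) p.1 q.1 p.2 q.2
    simp only [weylEigenfun, this, Sum.inl.injEq, Sum.inr.injEq, Prod.ext_iff]
    norm_num
  · simpa [weylEigenfun] using hzero _ _ _ _
  · simpa [weylEigenfun] using hzero' _ _ _ _
  · simpa [weylEigenfun] using hzero' _ _ _ _
  · have e : ∀ z, inner ℂ (zeroMode k z) (zeroMode l z) =
        starRingEnd ℂ (landauFun (-(k : ℤ)) 0 z) * landauFun (-(l : ℤ)) 0 z := by
      intro z; rw [spinor_inner]; simp [zeroMode]
    simp only [weylEigenfun, e, integral_landauFun_inner, Sum.inr.injEq]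
    by_cases h : k = l <;> simp [h]

/-- The matrix of the Coulomb potential `1 / |x|` in the basis of the spinors `ψ^m_n`, for fixed
`m`. -/
noncomputable def spinorCoulomb (m : ℤ) (n n' : ℕ) : ℝ :=
  (coulombMatrix m.natAbs n n' +
    coulombMatrix (m + 1).natAbs (lowerIndex m n) (lowerIndex m n')) / 2

lemma integral_coulomb_landauSpinor (m m' : ℤ) (n n' : ℕ) :
    ∫ z, ((‖z‖⁻¹ : ℝ) : ℂ) * inner ℂ (landauSpinor m n z) (landauSpinor m' n' z) =
      if m = m' then (spinorCoulomb m n n' : ℂ) else 0 := by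
  simp_rw [landauSpinor_eq, inner_signedSpinor, mul_add]
  have hi : ∀ (m m' : ℤ) (n n' : ℕ) (c : ℂ), Integrable fun z : ℂ => ((‖z‖⁻¹ : ℝ) : ℂ) *
      (c * (starRingEnd ℂ (landauFun m n z) * landauFun m' n' z)) := by
    intro m m' n n' c
    have := (integrable_mul_of_mem_gaussSpan (s := -1) (by norm_num) (landauFun_mem m n)
      (landauFun_mem m' n')).const_mul c
    simp only [Real.rpow_neg_one] at this
    exact this.congr (ae_of_all _ fun z => by ring)
  have he : ∀ (m m' : ℤ) (n n' : ℕ) (c : ℂ), ∫ z : ℂ, ((‖z‖⁻¹ : ℝ) : ℂ) *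
      (c * (starRingEnd ℂ (landauFun m n z) * landauFun m' n' z)) =
      c * if m = m' then (coulombMatrix m.natAbs n n' : ℂ) else 0 := by
    intro m m' n n' c
    rw [← integral_landauFun_coulomb, ← integral_const_mul]
    exact integral_congr_ae (ae_of_all _ fun z => by ring)
  rw [integral_add (hi _ _ _ _ _) (hi _ _ _ _ _), he, he]
  by_cases hm : m = m'
  · subst hm
    simp only [if_true, landauPhase_mul_conj, spinorCoulomb]
    push_cast
    ring
  · rw [if_neg hm, if_neg (by omega), if_neg hm]; simp

lemma weylForm_landauSpinor (Z : ℝ) (m m' : ℤ) (n n' : ℕ) :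
    weylForm Z (landauSpinor m n) (landauSpinor m' n') =
      if m = m' then (((if n = n' then 2 * √(landauLevel m n) else 0) -
        Z * spinorCoulomb m n n' : ℝ) : ℂ) else 0 := by
  rw [weylForm]
  have h1 := landauSpinor_mem m n
  have h2 := landauSpinor_mem m' n'
  simp_rw [inner_weyl Z (landauSpinor m n)]
  rw [integral_sub (integrable_inner h1 (weyl_zero_mem_spinorGauss h2))
    ((integrable_coulomb h1 h2).const_mul _), integral_const_mul, integral_coulomb_landauSpinor]
  have e : ∀ z, inner ℂ (landauSpinor m n z) (weyl 0 (landauSpinor m' n') z) =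
      ((2 * √(landauLevel m' n') : ℝ) : ℂ) * inner ℂ (signedSpinor 1 m n z) (signedSpinor 1 m' n' z) := by
    intro z
    rw [landauSpinor_eq, landauSpinor_eq, weyl_signedSpinor (by norm_num), one_mul, Pi.smul_apply,
      inner_smul_right]
  simp_rw [e]
  rw [integral_const_mul, integral_inner_signedSpinor]
  by_cases hm : m = m'
  · subst hm
    by_cases hn : n = n'
    · subst hn; simp
    · simp [hn]
  · simp [hm]

/-! ### Operators that are diagonal in a Hilbert basis -/

section Diagonal

variable {H ι : Type*} [NormedAddCommGroup H] [InnerProductSpace ℂ H]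

lemma HilbertBasis.hasSum_norm_sq (b : HilbertBasis ι ℂ H) (x : H) :
    HasSum (fun i => ‖inner ℂ (b i) x‖ ^ 2) (‖x‖ ^ 2) := by
  have h := (Complex.hasSum_re (b.hasSum_inner_mul_inner x x))
  have e : (fun i => (inner ℂ x (b i) * inner ℂ (b i) x).re) = fun i => ‖inner ℂ (b i) x‖ ^ 2 := by
    funext i
    rw [← inner_conj_symm x (b i), mul_comm, Complex.mul_conj, Complex.normSq_eq_norm_sq,
      Complex.ofReal_re]
  rw [e] at h
  convert! h using 1
  exact (inner_self_eq_norm_sq (𝕜 := ℂ) x).symm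

lemma HilbertBasis.ext_inner (b : HilbertBasis ι ℂ H) {x y : H}
    (h : ∀ i, inner ℂ (b i) x = inner ℂ (b i) y) : x = y := by
  apply b.repr.injective
  ext i
  simpa only [b.repr_apply_apply] using h i

/-- If a graph `G` is compatible with multiplication of the `i`-th coefficient by `l i`, and its closure
contains all basis vectors, then its closure is the maximal multiplication operator. -/
lemma mem_closure_iff_diagonal (b : HilbertBasis ι ℂ H) (l : ι → ℝ) (G : Submodule ℂ (H × H))
    (h1 : ∀ i, (b i, (l i : ℂ) • b i) ∈ G.topologicalClosure)
    (h2 : ∀ p ∈ G, ∀ i, inner ℂ (b i) p.2 = (l i : ℂ) * inner ℂ (b i) p.1) (p : H × H) :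
    p ∈ G.topologicalClosure ↔ ∀ i, inner ℂ (b i) p.2 = (l i : ℂ) * inner ℂ (b i) p.1 := by
  constructor
  · intro hp i
    have hc : IsClosed {p : H × H | inner ℂ (b i) p.2 = (l i : ℂ) * inner ℂ (b i) p.1} :=
      isClosed_eq (by fun_prop) (by fun_prop)
    exact closure_minimal (fun p hp => h2 p hp i) hc hp
  · intro hp
    have hx := b.hasSum_repr p.1
    have hy := b.hasSum_repr p.2
    have hs := hx.prodMk hy
    have hmem : ∀ i, (b.repr p.1 i • b i, b.repr p.2 i • b i) ∈ G.topologicalClosure := by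
      intro i
      have := G.topologicalClosure.smul_mem (b.repr p.1 i) (h1 i)
      rw [b.repr_apply_apply, b.repr_apply_apply, hp i]
      rw [b.repr_apply_apply] at this
      rwa [Prod.smul_mk, smul_smul, mul_comm] at this
    exact G.isClosed_topologicalClosure.mem_of_tendsto hs
      (Eventually.of_forall fun s => Submodule.sum_mem _ fun i _ => hmem i)

variable [CompleteSpace H]

/-- The orthogonal projection onto the closed span of the `b i` with `l i ∈ s`. -/
noncomputable def diagProj (b : HilbertBasis ι ℂ H) (l : ι → ℝ) (s : Set ℝ) : H →L[ℂ] H :=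
  (Submodule.span ℂ (b '' {i | l i ∈ s})).topologicalClosure.starProjection

lemma range_diagProj (b : HilbertBasis ι ℂ H) (l : ι → ℝ) (s : Set ℝ) :
    LinearMap.range (diagProj b l s).toLinearMap =
      (Submodule.span ℂ (b '' {i | l i ∈ s})).topologicalClosure :=
  Submodule.range_starProjection _

lemma inner_diagProj (b : HilbertBasis ι ℂ H) (l : ι → ℝ) (s : Set ℝ) (i : ι) (x : H)
    [Decidable (l i ∈ s)] :
    inner ℂ (b i) (diagProj b l s x) = if l i ∈ s then inner ℂ (b i) x else 0 := by
  set U := (Submodule.span ℂ (b '' {i | l i ∈ s})).topologicalClosure with hU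
  have hsym : inner ℂ (b i) (diagProj b l s x) = inner ℂ (diagProj b l s (b i)) x :=
    ((isSelfAdjoint_starProjection U).isSymmetric (b i) x).symm
  rw [hsym]
  split_ifs with h
  · have : diagProj b l s (b i) = b i :=
      Submodule.starProjection_eq_self_iff.2 (Submodule.le_topologicalClosure _
        (Submodule.subset_span ⟨i, h, rfl⟩))
    rw [this]
  · have : diagProj b l s (b i) = 0 := by
      rw [diagProj, Submodule.starProjection_apply_eq_zero_iff, Submodule.orthogonal_closure,
        Submodule.mem_orthogonal]
      intro u hu
      induction hu using Submodule.span_induction with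
      | mem u hu =>
        obtain ⟨j, hj, rfl⟩ := hu
        exact b.orthonormal.2 (by rintro rfl; exact h hj)
      | zero => simp
      | add u v _ _ hu hv => rw [inner_add_left, hu, hv, add_zero]
      | smul c u _ hu => rw [inner_smul_left, hu, mul_zero]
    rw [this, inner_zero_left]

/-- The family of projections `diagProj b l` is the spectral measure of the operator which is
diagonal in the basis `b` with eigenvalues `l`, on its maximal domain. -/
lemma isSpectralMeasure_diagProj (b : HilbertBasis ι ℂ H) (l : ι → ℝ) (T : H →ₗ.[ℂ] H)
    (hT : ∀ p : H × H, p ∈ T.graph ↔ ∀ i, inner ℂ (b i) p.2 = (l i : ℂ) * inner ℂ (b i) p.1) :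
    IsSpectralMeasure T (diagProj b l) := by
  classical
  refine ⟨fun s _ => isStarProjection_starProjection, ?_, ?_, ?_⟩
  · ext x
    refine b.ext_inner fun i => ?_
    rw [inner_diagProj]; simp
  · intro s t _ _
    ext x
    refine b.ext_inner fun i => ?_
    rw [show (diagProj b l s * diagProj b l t) x = diagProj b l s (diagProj b l t x) from rfl,
      inner_diagProj, inner_diagProj, inner_diagProj]
    by_cases h1 : l i ∈ s <;> by_cases h2 : l i ∈ t <;> simp [h1, h2]
  · intro ψ
    set w : ι → ENNReal := fun i => ENNReal.ofReal (‖inner ℂ (b i) ψ‖ ^ 2) with hw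
    set μ : Measure ℝ := Measure.sum fun i => w i • Measure.dirac (l i) with hμ
    have hlint : ∀ f : ℝ → ENNReal, Measurable f → ∫⁻ x, f x ∂μ = ∑' i, w i * f (l i) := by
      intro f hf
      rw [hμ, lintegral_sum_measure]
      refine tsum_congr fun i => ?_
      rw [lintegral_smul_measure, lintegral_dirac' _ hf, smul_eq_mul]
    have hint : Integrable (fun x : ℝ => x ^ 2) μ ↔
        Summable fun i => ‖(l i : ℂ) * inner ℂ (b i) ψ‖ ^ 2 := by
      have hm : Measurable fun x : ℝ => x ^ 2 := by fun_prop
      have e : ∀ i, w i * ‖(l i) ^ 2‖ₑ =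
          ENNReal.ofReal (‖(l i : ℂ) * inner ℂ (b i) ψ‖ ^ 2) := by
        intro i
        rw [hw, Real.enorm_of_nonneg (by positivity), ← ENNReal.ofReal_mul (by positivity), norm_mul,
          Complex.norm_real, mul_pow, Real.norm_eq_abs, sq_abs, mul_comm]
      have hnn : ∀ i, 0 ≤ ‖(l i : ℂ) * inner ℂ (b i) ψ‖ ^ 2 := fun i => by positivity
      rw [Integrable, and_iff_right hm.aestronglyMeasurable, HasFiniteIntegral,
        hlint _ (by fun_prop)]
      simp_rw [e]
      constructor
      · intro h
        have := ENNReal.summable_toReal h.ne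
        simpa only [ENNReal.toReal_ofReal (hnn _)] using this
      · intro h
        exact lt_top_iff_ne_top.2 h.tsum_ofReal_ne_top
    have hdom : ∀ h : ψ ∈ T.domain, ∀ i,
        inner ℂ (b i) (T ⟨ψ, h⟩) = (l i : ℂ) * inner ℂ (b i) ψ := fun h =>
      (hT (ψ, T ⟨ψ, h⟩)).1 (T.mem_graph ⟨ψ, h⟩)
    have hiff : ψ ∈ T.domain ↔ Integrable (fun x : ℝ => x ^ 2) μ := by
      rw [hint]
      constructor
      · intro h
        have := (b.hasSum_norm_sq (T ⟨ψ, h⟩)).summable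
        simpa only [hdom h] using this
      · intro h
        have hmem : Memℓp (fun i => (l i : ℂ) * inner ℂ (b i) ψ) 2 := by
          refine memℓp_gen ?_
          simpa using h
        set y : H := b.repr.symm ⟨_, hmem⟩ with hy
        have : (ψ, y) ∈ T.graph := by
          rw [hT]
          intro i
          rw [← b.repr_apply_apply, hy, LinearIsometryEquiv.apply_symm_apply]
        obtain ⟨z, hz, -⟩ := (LinearPMap.mem_graph_iff _).1 this
        exact (show (z : H) = ψ from hz) ▸ z.2
    refine ⟨μ, ?_, hiff, ?_⟩
    · intro s hs
      rw [← lintegral_indicator_one hs, hlint _ (measurable_one.indicator hs),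
        ← (b.hasSum_norm_sq (diagProj b l s ψ)).tsum_eq,
        ENNReal.ofReal_tsum_of_nonneg (fun i => by positivity)
          (b.hasSum_norm_sq (diagProj b l s ψ)).summable]
      refine tsum_congr fun i => ?_
      rw [inner_diagProj]
      by_cases h : l i ∈ s <;> simp [h, hw]
    · intro h
      have h1 := b.hasSum_inner_mul_inner ψ (T ⟨ψ, h⟩)
      have hfin : μ Set.univ < ⊤ := by
        rw [← lintegral_one, hlint _ measurable_const]
        simp only [mul_one]
        exact lt_top_iff_ne_top.2 (b.hasSum_norm_sq ψ).summable.tsum_ofReal_ne_top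
      have : IsFiniteMeasure μ := ⟨hfin⟩
      have hx : Integrable (fun x : ℝ => x) μ := by
        refine ((hiff.1 h).add (integrable_const (1 : ℝ))).mono' (by fun_prop)
          (ae_of_all _ fun x => ?_)
        rw [Real.norm_eq_abs]
        simp only [Pi.add_apply]
        nlinarith [sq_nonneg (|x| - 1), sq_abs x]
      have h2 := hasSum_integral_measure hx
      have e : ∀ i, inner ℂ ψ (b i) * inner ℂ (b i) (T ⟨ψ, h⟩) =
          ((∫ x, x ∂(w i • Measure.dirac (l i)) : ℝ) : ℂ) := by
        intro i
        rw [integral_smul_measure, integral_dirac, hdom h, ← inner_conj_symm ψ (b i), hw,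
          ENNReal.toReal_ofReal (by positivity), smul_eq_mul, mul_left_comm,
          mul_comm (starRingEnd ℂ _), Complex.mul_conj, Complex.normSq_eq_norm_sq, mul_comm]
        push_cast
        rfl
      simp_rw [e] at h1
      exact h1.unique (Complex.hasSum_ofReal.2 h2)

end Diagonal

/-! ### The closure of a closable nonnegative form -/

universe u in
/-- A nonnegative Hermitian form is the pullback of the inner product of a Hilbert space. -/
lemma exists_gram_map {V : Type u} [AddCommGroup V] [Module ℂ V] (q : V →ₗ⋆[ℂ] V →ₗ[ℂ] ℂ)
    (hherm : ∀ u v, q u v = starRingEnd ℂ (q v u)) (hpos : ∀ u, 0 ≤ (q u u).re) :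
    ∃ (K : Type u) (_ : NormedAddCommGroup K) (_ : InnerProductSpace ℂ K) (_ : CompleteSpace K)
      (S : V →ₗ[ℂ] K), ∀ u v, inner ℂ (S u) (S v) = q u v := by
  let core : PreInnerProductSpace.Core ℂ V :=
    { inner := fun u v => q u v
      conj_inner_symm := fun u v => (hherm u v).symm
      re_inner_nonneg := fun u => hpos u
      add_left := fun u v w => by simp
      smul_left := fun u v c => by simp }
  let : SeminormedAddCommGroup V := InnerProductSpace.Core.toSeminormedAddCommGroup (c := core)
  let : InnerProductSpace ℂ V := InnerProductSpace.ofCore core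
  refine ⟨UniformSpace.Completion V, inferInstance, inferInstance, inferInstance,
    UniformSpace.Completion.toComplₗᵢ.toLinearMap, fun u v => ?_⟩
  exact UniformSpace.Completion.inner_coe u v

section FormClosure

variable {H : Type*} [NormedAddCommGroup H] [InnerProductSpace ℂ H]

/-- A nonnegative Hermitian form `q` on a subspace `D`, written as `q(u, v) = ⟨S u, S v⟩`, is
closable as soon as the operator `S` is, and its closure is given by the closure of `S`. -/
lemma exists_form_closure (D : Submodule ℂ H) (q : D →ₗ⋆[ℂ] D →ₗ[ℂ] ℂ)
    (hherm : ∀ u v, q u v = starRingEnd ℂ (q v u)) (hpos : ∀ u, 0 ≤ (q u u).re)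
    (hclos : ∀ u : ℕ → D, Tendsto (fun n => (u n : H)) atTop (𝓝 0) →
      Tendsto (fun p : ℕ × ℕ => (q (u p.1 - u p.2) (u p.1 - u p.2)).re) atTop (𝓝 0) →
      Tendsto (fun n => (q (u n) (u n)).re) atTop (𝓝 0)) :
    ∃ t : SesqForm H, (∀ (φ ψ : t.domain) (u v : D), (φ : H) = u → (ψ : H) = v →
        t.form φ ψ = q u v) ∧ t.domain ≤ D.topologicalClosure ∧ t.IsCore D ∧ t.IsHermitian ∧
      t.IsBoundedBelow ∧ t.IsClosed := by
  obtain ⟨K, _, _, _, S, hS⟩ := exists_gram_map q hherm hpos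
  have hSn : ∀ u, (q u u).re = ‖S u‖ ^ 2 := by
    intro u
    rw [← hS]; exact inner_self_eq_norm_sq (𝕜 := ℂ) (S u)
  have hcauchy : ∀ (g : ℕ → K), (CauchySeq g ↔
      Tendsto (fun p : ℕ × ℕ => ‖g p.1 - g p.2‖ ^ 2) atTop (𝓝 0)) := by
    intro g
    rw [cauchySeq_iff_tendsto_dist_atTop_0]
    simp_rw [dist_eq_norm]
    constructor
    · intro h; simpa using h.pow 2
    · intro h
      have := (Real.continuous_sqrt.tendsto 0).comp h
      simpa [Function.comp_def, Real.sqrt_sq] using this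
  let f : H →ₗ.[ℂ] K := ⟨D, S⟩
  have hf : f.IsClosable := by
    refine ⟨f.graph.topologicalClosure.toLinearPMap, ?_⟩
    rw [Submodule.toLinearPMap_graph_eq]
    rintro ⟨x, y⟩ hxy (rfl : x = 0)
    obtain ⟨g, hg, hlim⟩ := mem_closure_iff_seq_limit.1 hxy
    choose u hu1 hu2 using fun n => (LinearPMap.mem_graph_iff _).1 (hg n)
    have l1 : Tendsto (fun n => (u n : H)) atTop (𝓝 0) := by
      simp_rw [hu1]; exact (continuous_fst.tendsto _).comp hlim
    have l2 : Tendsto (fun n => S (u n)) atTop (𝓝 y) := by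
      have : ∀ n, S (u n) = (g n).2 := hu2
      simp_rw [this]; exact (continuous_snd.tendsto _).comp hlim
    have l3 := hclos u l1 (by
      have := (hcauchy _).1 l2.cauchySeq
      refine this.congr fun p => ?_
      rw [← map_sub, hSn])
    simp_rw [hSn] at l3
    have l4 := (l2.norm.pow 2)
    have := tendsto_nhds_unique l3 l4
    simpa using this.symm
  set F := f.closure with hF
  have hFgraph : ∀ (x : H) (y : K), (x, y) ∈ f.graph.topologicalClosure ↔
      ∃ h : x ∈ F.domain, F ⟨x, h⟩ = y := by
    intro x y
    rw [hf.graph_closure_eq_closure_graph, LinearPMap.mem_graph_iff]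
    constructor
    · rintro ⟨z, hz1, hz2⟩
      have hz : (z : H) = x := hz1
      subst hz
      exact ⟨z.2, hz2⟩
    · rintro ⟨h, rfl⟩
      exact ⟨⟨x, h⟩, rfl, rfl⟩
  have hle : f ≤ F := f.le_closure
  have hFS : ∀ (u : D) (h : (u : H) ∈ F.domain), F ⟨u, h⟩ = S u := fun u h =>
    (hle.2 (x := u) (y := ⟨u, h⟩) rfl).symm
  have happrox : ∀ x : F.domain, ∃ u : ℕ → D, Tendsto (fun n => (u n : H)) atTop (𝓝 (x : H)) ∧
      Tendsto (fun n => S (u n)) atTop (𝓝 (F x)) := by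
    intro x
    obtain ⟨g, hg, hlim⟩ := mem_closure_iff_seq_limit.1 ((hFgraph x (F x)).2 ⟨x.2, rfl⟩)
    choose u hu1 hu2 using fun n => (LinearPMap.mem_graph_iff _).1 (hg n)
    refine ⟨u, ?_, ?_⟩
    · simp_rw [hu1]; exact (continuous_fst.tendsto _).comp hlim
    · have : ∀ n, S (u n) = (g n).2 := hu2
      simp_rw [this]; exact (continuous_snd.tendsto _).comp hlim
  let t : SesqForm H :=
    { domain := F.domain
      form := LinearMap.mk₂'ₛₗ (starRingEnd ℂ) (RingHom.id ℂ) (fun x y => inner ℂ (F x) (F y))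
        (fun x x' y => by rw [F.map_add, inner_add_left])
        (fun c x y => by rw [F.map_smul, inner_smul_left]; rfl)
        (fun x y y' => by rw [F.map_add, inner_add_right])
        (fun c x y => by rw [F.map_smul, inner_smul_right]; rfl) }
  have htn : ∀ x : t.domain, t.form x x = ((‖F x‖ ^ 2 : ℝ) : ℂ) := by
    intro x
    have : t.form x x = inner ℂ (F x) (F x) := rfl
    rw [this, inner_self_eq_norm_sq_to_K]; push_cast; rfl
  refine ⟨t, ?_, ?_, ⟨hle.1, ?_⟩, ?_, ⟨0, ?_⟩, ?_⟩
  · rintro ⟨φ, hφ⟩ ⟨ψ, hψ⟩ u v h1 h2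
    change φ = u at h1
    change ψ = v at h2
    subst h1 h2
    change inner ℂ (F ⟨u, hφ⟩) (F ⟨v, hψ⟩) = q u v
    rw [hFS, hFS, hS]
  · intro x hx
    obtain ⟨u, hu, -⟩ := happrox ⟨x, hx⟩
    exact mem_closure_of_tendsto hu (Eventually.of_forall fun n => (u n).2)
  · intro x
    obtain ⟨u, hu1, hu2⟩ := happrox x
    refine ⟨fun n => ⟨u n, hle.1 (u n).2⟩, fun n => (u n).2, hu1, ?_⟩
    simp_rw [htn]
    have h3 : Tendsto (fun n => ‖S (u n) - F x‖ ^ 2) atTop (𝓝 0) := by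
      have := ((hu2.sub_const (F x)).norm.pow 2)
      simpa using this
    have h4 := (Complex.continuous_ofReal.tendsto 0).comp h3
    simp only [Complex.ofReal_zero] at h4
    refine h4.congr fun n => ?_
    have : F (⟨u n, hle.1 (u n).2⟩ - x) = S (u n) - F x := by
      rw [F.map_sub, hFS]
    rw [Function.comp_apply, ← this]
  · intro φ ψ
    exact (inner_conj_symm (F φ) (F ψ)).symm
  · intro x
    rw [htn, zero_mul, Complex.ofReal_re]
    positivity
  · rintro u ψ ⟨h1, h2⟩
    have h3 : CauchySeq fun n => F (u n) := by
      rw [hcauchy]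
      have := (Complex.continuous_re.tendsto 0).comp h2
      simp only [Complex.zero_re] at this
      refine this.congr fun p => ?_
      rw [Function.comp_apply, htn, Complex.ofReal_re, F.map_sub]
    obtain ⟨y, hy⟩ := cauchySeq_tendsto_of_complete h3
    have hmem : (ψ, y) ∈ f.graph.topologicalClosure := by
      refine f.graph.isClosed_topologicalClosure.mem_of_tendsto (h1.prodMk_nhds hy)
        (Eventually.of_forall fun n => ?_)
      exact (hFgraph _ _).2 ⟨(u n).2, rfl⟩
    obtain ⟨hψ, hFy⟩ := (hFgraph _ _).1 hmem
    refine ⟨hψ, ?_⟩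
    simp_rw [htn]
    have h4 : Tendsto (fun n => ‖F (u n) - y‖ ^ 2) atTop (𝓝 0) := by
      have := ((hy.sub_const y).norm.pow 2)
      simpa using this
    have h5 := (Complex.continuous_ofReal.tendsto 0).comp h4
    simp only [Complex.ofReal_zero] at h5
    refine h5.congr fun n => ?_
    rw [Function.comp_apply, F.map_sub, hFy]

end FormClosure

/-! ### Completeness of the Gaussian monomials -/

open FourierTransform in
/-- An integrable function is zero almost everywhere if its Fourier transform vanishes. -/
lemma ae_eq_zero_of_fourier_eq_zero {G : ℂ → ℂ} (hG : Integrable G) (h : ∀ w, 𝓕 G w = 0) :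
    G =ᵐ[volume] 0 := by
  refine ae_eq_zero_of_integral_contDiff_smul_eq_zero hG.locallyIntegrable fun φ hφ hφ' => ?_
  have h1 : HasCompactSupport fun x => (φ x : ℂ) := hφ'.comp_left (g := fun x : ℝ => (x : ℂ)) (by simp)
  have h2 : ContDiff ℝ ∞ fun x => (φ x : ℂ) := Complex.ofRealCLM.contDiff.comp hφ
  set S : SchwartzMap ℂ ℂ := h1.toSchwartzMap h2 with hS
  have hS' : ∀ x, S x = φ x := fun x => rfl
  obtain ⟨T, h3⟩ : ∃ T : SchwartzMap ℂ ℂ, 𝓕 T = S := ⟨𝓕⁻ S, fourier_fourierInv_eq S⟩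
  have h4 : ∀ x, (φ x : ℂ) = 𝓕 (⇑T) x := by
    intro x
    rw [← hS', ← SchwartzMap.fourier_coe, h3]
  have h5 : ∫ x, 𝓕 (⇑T) x • G x = ∫ x, T x • 𝓕 G x := by
    simpa using! (VectorFourier.integral_fourierIntegral_smul_eq_flip (L := innerₗ ℂ)
      Real.continuous_fourierChar continuous_inner T.integrable hG)
  simp_rw [h, smul_zero, integral_zero, ← h4] at h5
  simpa using h5

lemma integrable_exp_neg_mul_norm_sq {b : ℝ} (hb : 0 < b) :
    Integrable fun z : ℂ => Real.exp (-b * ‖z‖ ^ 2) := by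
  have h := (GaussianFourier.integrable_cexp_neg_mul_sq_norm_add (V := ℂ) (b := (b : ℂ))
    (by simpa using hb) 0 0).norm
  refine h.congr (ae_of_all _ fun z => ?_)
  simp only [Complex.norm_exp]
  congr 1
  simp [← Complex.ofReal_pow]

lemma memLp_exp_mul_gauss (c : ℝ) :
    MemLp (fun z : ℂ => Real.exp (c * ‖z‖) * Real.exp (-‖z‖ ^ 2 / 2)) 2 := by
  rw [memLp_two_iff_integrable_sq_norm (by fun_prop)]
  refine ((integrable_exp_neg_mul_norm_sq (b := 1 / 2) (by norm_num)).const_mul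
    (Real.exp (2 * c ^ 2))).mono' (by fun_prop) (ae_of_all _ fun z => ?_)
  rw [Real.norm_of_nonneg (by positivity), Real.norm_of_nonneg (by positivity), ← Real.exp_add,
    ← Real.exp_nat_mul, ← Real.exp_add, Real.exp_le_exp]
  push_cast
  nlinarith [sq_nonneg (2 * c - ‖z‖)]

lemma inner_mul_mem_gaussSpan (w : ℂ) {f : ℂ → ℂ} (hf : f ∈ gaussSpan) :
    (fun z => ((inner ℝ z w : ℝ) : ℂ) * f z) ∈ gaussSpan := by
  induction hf using Submodule.span_induction with
  | mem f hf =>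
    obtain ⟨⟨p, q⟩, rfl⟩ := hf
    have : (fun z => ((inner ℝ z w : ℝ) : ℂ) * gaussMon p q z) =
        (w / 2) • gaussMon p (q + 1) + (starRingEnd ℂ w / 2) • gaussMon (p + 1) q := by
      funext z
      have : ((inner ℝ z w : ℝ) : ℂ) = (starRingEnd ℂ z * w + z * starRingEnd ℂ w) / 2 := by
        rw [Complex.inner]
        apply Complex.ext <;> simp <;> ring
      simp only [this, gaussMon, Pi.add_apply, Pi.smul_apply, smul_eq_mul]
      ring
    simp only [this]
    exact gaussSpan.add_mem (gaussSpan.smul_mem _ (gaussMon_mem _ _))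
      (gaussSpan.smul_mem _ (gaussMon_mem _ _))
  | zero =>
    convert gaussSpan.zero_mem using 1
    funext z; simp
  | add f g _ _ hf hg =>
    convert! gaussSpan.add_mem hf hg using 1
    funext z; simp [mul_add]
  | smul c f _ hf =>
    convert! gaussSpan.smul_mem c hf using 1
    funext z; simp; ring

lemma inner_pow_mul_mem_gaussSpan (w : ℂ) (k : ℕ) :
    (fun z => ((inner ℝ z w : ℝ) : ℂ) ^ k * gaussMon 0 0 z) ∈ gaussSpan := by
  induction k with
  | zero => simpa using! gaussMon_mem 0 0
  | succ k ih =>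
    convert! inner_mul_mem_gaussSpan w ih using 1
    funext z; ring

open FourierTransform in
/-- The Gaussian monomials are total in `L²`: if all moments of `exp (-|z|² / 2) g` vanish, then
so does its Fourier transform, by expansion into a power series. -/
lemma ae_eq_zero_of_orthogonal_gaussSpan {g : ℂ → ℂ} (hg : MemLp g 2)
    (h : ∀ f ∈ gaussSpan, ∫ z, f z * g z = 0) : g =ᵐ[volume] 0 := by
  have hn : ∀ z, ‖gaussMon 0 0 z‖ = Real.exp (-‖z‖ ^ 2 / 2) := fun z => by simp [norm_gaussMon]
  have hI : ∀ c : ℝ, Integrable fun z : ℂ =>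
      Real.exp (c * ‖z‖) * ‖gaussMon 0 0 z * g z‖ := by
    intro c
    refine ((memLp_exp_mul_gauss c).integrable_mul hg.norm).congr (ae_of_all _ fun z => ?_)
    simp [hn, mul_assoc]
  have hm : AEStronglyMeasurable (fun z => gaussMon 0 0 z * g z) :=
    (continuous_gaussMon 0 0).aestronglyMeasurable.mul hg.1
  have hG : Integrable fun z => gaussMon 0 0 z * g z := by
    have := hI 0
    simp only [zero_mul, Real.exp_zero, one_mul] at this
    exact (integrable_norm_iff hm).1 this
  have hF : ∀ w, 𝓕 (fun z => gaussMon 0 0 z * g z) w = 0 := by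
    intro w
    rw [Real.fourier_eq']
    set F : ℕ → ℂ → ℂ := fun k z => (((k.factorial : ℂ)⁻¹) * (-2 * Real.pi * Complex.I) ^ k) *
      ((((inner ℝ z w : ℝ) : ℂ) ^ k * gaussMon 0 0 z) * g z) with hFdef
    have hF0 : ∀ k, ∫ z, F k z = 0 := by
      intro k
      rw [hFdef, integral_const_mul, h _ (inner_pow_mul_mem_gaussSpan w k), mul_zero]
    have key := hasSum_integral_of_dominated_convergence (F := F)
      (f := fun v => Complex.exp (((-2 * Real.pi * inner ℝ v w : ℝ) : ℂ) * Complex.I) •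
        (gaussMon 0 0 v * g v))
      (bound := fun k z => (2 * Real.pi * ‖w‖ * ‖z‖) ^ k / k.factorial * ‖gaussMon 0 0 z * g z‖)
      (μ := volume) ?_ ?_ ?_ ?_ ?_
    · simp_rw [hF0] at key
      exact key.unique hasSum_zero
    · intro k
      have : AEStronglyMeasurable (fun z : ℂ => ((inner ℝ z w : ℝ) : ℂ) ^ k) := by
        fun_prop
      refine AEStronglyMeasurable.const_mul ?_ _
      exact (this.mul hm).congr (ae_of_all _ fun z => by simp [mul_assoc])
    · intro k
      refine ae_of_all _ fun z => ?_
      have h1 : |inner ℝ z w| ≤ ‖z‖ * ‖w‖ := abs_real_inner_le_norm z w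
      simp only [hFdef, norm_mul, norm_pow, norm_inv, Complex.norm_real, Complex.norm_natCast,
        norm_neg, Complex.norm_I, Real.norm_eq_abs, abs_of_pos Real.pi_pos, RCLike.norm_ofNat]
      calc _ = (2 * Real.pi * |inner ℝ z w|) ^ k / k.factorial * (‖gaussMon 0 0 z‖ * ‖g z‖) := by
            rw [mul_pow (2 * Real.pi)]; ring
        _ ≤ _ := by
            have : 2 * Real.pi * |inner ℝ z w| ≤ 2 * Real.pi * ‖w‖ * ‖z‖ := by
              nlinarith [Real.pi_pos]
            gcongr
    · refine ae_of_all _ fun z => ?_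
      exact (Real.summable_pow_div_factorial _).mul_right _
    · have e : (fun z => ∑' k : ℕ, (2 * Real.pi * ‖w‖ * ‖z‖) ^ k / k.factorial *
          ‖gaussMon 0 0 z * g z‖) = fun z => Real.exp (2 * Real.pi * ‖w‖ * ‖z‖) *
          ‖gaussMon 0 0 z * g z‖ := by
        funext z
        rw [tsum_mul_right, Real.exp_eq_exp_ℝ, NormedSpace.exp_eq_tsum_div]
      rw [e]
      exact hI _
    · refine ae_of_all _ fun z => ?_
      have h1 := NormedSpace.expSeries_div_hasSum_exp
        (((-2 * Real.pi * inner ℝ z w : ℝ) : ℂ) * Complex.I)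
      rw [← Complex.exp_eq_exp_ℂ] at h1
      convert! h1.mul_right (gaussMon 0 0 z * g z) using 1
      funext k
      simp only [hFdef]
      push_cast
      rw [show (-2 * (Real.pi : ℂ) * (inner ℝ z w : ℝ)) * Complex.I =
        (-2 * Real.pi * Complex.I) * (inner ℝ z w : ℝ) by ring, mul_pow _ (((inner ℝ z w : ℝ) : ℂ))]
      field_simp
  filter_upwards [ae_eq_zero_of_fourier_eq_zero hG hF] with z hz
  have h0 : gaussMon 0 0 z ≠ 0 := by
    rw [← norm_ne_zero_iff, hn]; positivity
  exact (mul_eq_zero.1 hz).resolve_left h0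

/-- Every Gaussian monomial is a combination of Landau functions, since the coefficient of the
highest power in a Laguerre polynomial does not vanish. -/
lemma gaussMon_mem_span_landauFun (p q : ℕ) :
    gaussMon p q ∈ Submodule.span ℂ (Set.range fun k : ℤ × ℕ => landauFun k.1 k.2) := by
  set V := Submodule.span ℂ (Set.range fun k : ℤ × ℕ => landauFun k.1 k.2)
  have key : ∀ (m : ℤ) (n : ℕ), gaussMon (m.toNat + n) ((-m).toNat + n) ∈ V := by
    intro m n
    induction n using Nat.strong_induction_on with
    | _ n ih =>
      have h1 : lagGauss m.toNat (-m).toNat n ∈ V := by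
        have hN : landauNorm m.natAbs n ≠ 0 := by
          rw [landauNorm]; positivity
        have h2 : landauFun m n ∈ V := Submodule.subset_span ⟨(m, n), rfl⟩
        rw [landauFun_eq] at h2
        exact (V.smul_mem_iff (by exact_mod_cast hN)).1 h2
      rw [lagGauss, Finset.sum_range_succ] at h1
      have h3 := (V.add_mem_iff_right (Submodule.sum_mem _ fun j hj =>
        V.smul_mem _ (ih j (Finset.mem_range.1 hj)))).1 h1
      refine (V.smul_mem_iff ?_).1 h3
      rw [lagCoeff_self]
      have : ((-1 : ℝ) ^ n / n.factorial) ≠ 0 :=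
        div_ne_zero (pow_ne_zero _ (by norm_num)) (by positivity)
      exact_mod_cast this
  have := key ((p : ℤ) - q) (min p q)
  rwa [show ((p : ℤ) - q).toNat + min p q = p by omega,
    show (-((p : ℤ) - q)).toNat + min p q = q by omega] at this

lemma memLp_of_mem_gaussSpan {f : ℂ → ℂ} (hf : f ∈ gaussSpan) :
    MemLp f 2 (volume : Measure ℂ) := by
  rw [memLp_two_iff_integrable_sq_norm (contDiff_of_mem_gaussSpan hf).continuous.aestronglyMeasurable]
  have := (integrable_mul_of_mem_gaussSpan (s := 0) (by norm_num) hf hf).re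
  refine this.congr (ae_of_all _ fun z => ?_)
  simp only [Real.rpow_zero, Complex.ofReal_one, one_mul]
  rw [mul_comm, Complex.mul_conj, Complex.normSq_eq_norm_sq]
  exact Complex.ofReal_re _

lemma ae_eq_zero_of_orthogonal_landauFun {g : ℂ → ℂ} (hg : MemLp g 2)
    (h : ∀ m n, ∫ z, starRingEnd ℂ (landauFun m n z) * g z = 0) : g =ᵐ[volume] 0 := by
  have hint : ∀ f ∈ gaussSpan, Integrable fun z => starRingEnd ℂ (f z) * g z := fun f hf =>
    (memLp_of_mem_gaussSpan hf).star.integrable_mul hg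
  have h0 : ∀ f ∈ Submodule.span ℂ (Set.range fun k : ℤ × ℕ => landauFun k.1 k.2),
      f ∈ gaussSpan ∧ ∫ z, starRingEnd ℂ (f z) * g z = 0 := by
    intro f hf
    induction hf using Submodule.span_induction with
    | mem f hf => obtain ⟨k, rfl⟩ := hf; exact ⟨landauFun_mem _ _, h _ _⟩
    | zero => exact ⟨gaussSpan.zero_mem, by simp⟩
    | add f f' _ _ hf hf' =>
      refine ⟨gaussSpan.add_mem hf.1 hf'.1, ?_⟩
      simp only [Pi.add_apply, map_add, add_mul]
      rw [integral_add (hint f hf.1) (hint f' hf'.1), hf.2, hf'.2, add_zero]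
    | smul c f _ hf =>
      refine ⟨gaussSpan.smul_mem c hf.1, ?_⟩
      simp only [Pi.smul_apply, smul_eq_mul, map_mul, mul_assoc]
      rw [integral_const_mul, hf.2, mul_zero]
  refine ae_eq_zero_of_orthogonal_gaussSpan hg fun f hf => ?_
  have hint' : ∀ f ∈ gaussSpan, Integrable fun z => f z * g z := fun f hf =>
    (memLp_of_mem_gaussSpan hf).integrable_mul hg
  induction hf using Submodule.span_induction with
  | mem f hf =>
    obtain ⟨⟨p, q⟩, rfl⟩ := hf
    have := (h0 _ (gaussMon_mem_span_landauFun q p)).2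
    simpa only [conj_gaussMon] using this
  | zero => simp
  | add f f' hf1 hf1' hf hf' =>
    simp only [Pi.add_apply, add_mul]
    rw [integral_add (hint' f hf1) (hint' f' hf1'), hf, hf', add_zero]
  | smul c f _ hf =>
    simp only [Pi.smul_apply, smul_eq_mul, mul_assoc]
    rw [integral_const_mul, hf, mul_zero]

/-! ### The eigenbasis of the free Weyl operator -/

/-- The class in `L²` of an element of `spinorGauss`. -/
noncomputable def spinorGaussLp {u : ℂ → Spinor} (hu : u ∈ spinorGauss) : L2Spinor :=
  (memLp_of_mem_spinorGauss hu).toLp u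

lemma coeFn_spinorGaussLp {u : ℂ → Spinor} (hu : u ∈ spinorGauss) : spinorGaussLp hu =ᵐ[volume] u :=
  (memLp_of_mem_spinorGauss hu).coeFn_toLp

lemma inner_spinorGaussLp {u : ℂ → Spinor} (hu : u ∈ spinorGauss) {x : L2Spinor} {w : ℂ → Spinor}
    (hx : x =ᵐ[volume] w) : inner ℂ (spinorGaussLp hu) x = ∫ z, inner ℂ (u z) (w z) := by
  rw [L2.inner_def]
  refine integral_congr_ae ?_
  filter_upwards [coeFn_spinorGaussLp hu, hx] with z h1 h2
  rw [h1, h2]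

lemma orthonormal_weylEigenfun :
    Orthonormal ℂ fun i => spinorGaussLp (weylEigenfun_mem i) := by
  classical
  rw [orthonormal_iff_ite]
  intro i j
  rw [inner_spinorGaussLp _ (coeFn_spinorGaussLp _), integral_inner_weylEigenfun]

lemma eq_zero_of_orthogonal_weylEigenfun {x : L2Spinor}
    (h : ∀ i, inner ℂ (spinorGaussLp (weylEigenfun_mem i)) x = 0) : x = 0 := by
  have hx := Lp.memLp x
  have hmeas : ∀ j : Fin 2, MemLp (fun z => x z j) 2 := by
    intro j
    refine hx.of_le ?_ (ae_of_all _ fun z => PiLp.norm_apply_le (x z) j)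
    exact (PiLp.continuous_apply 2 (fun _ : Fin 2 => ℂ) j).comp_aestronglyMeasurable hx.1
  have hint : ∀ (j : Fin 2) (m : ℤ) (n : ℕ),
      Integrable fun z => starRingEnd ℂ (landauFun m n z) * x z j := fun j m n =>
    (memLp_of_mem_gaussSpan (landauFun_mem m n)).star.integrable_mul (hmeas j)
  have hsigned : ∀ (σ : ℝ) (m : ℤ) (n : ℕ), (∫ z, inner ℂ (signedSpinor σ m n z) (x z)) = 0 →
      (∫ z, starRingEnd ℂ (landauFun m n z) * x z 0) + σ * starRingEnd ℂ (landauPhase m) *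
        (∫ z, starRingEnd ℂ (landauFun (m + 1) (lowerIndex m n) z) * x z 1) = 0 := by
    intro σ m n h0
    have e : ∀ z, inner ℂ (signedSpinor σ m n z) (x z) = (√2 : ℂ)⁻¹ *
        (starRingEnd ℂ (landauFun m n z) * x z 0 + σ * starRingEnd ℂ (landauPhase m) *
          (starRingEnd ℂ (landauFun (m + 1) (lowerIndex m n) z) * x z 1)) := by
      intro z
      rw [spinor_inner]
      simp [signedSpinor]
      ring
    simp_rw [e] at h0
    rw [integral_const_mul, integral_add (hint _ _ _) ((hint _ _ _).const_mul _),
      integral_const_mul] at h0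
    refine (mul_eq_zero.1 h0).resolve_left ?_
    simp
  have hpos : ∀ (m : ℤ) (n : ℕ), (∫ z, starRingEnd ℂ (landauFun m n z) * x z 0) = 0 ∧
      (∫ z, starRingEnd ℂ (landauFun (m + 1) (lowerIndex m n) z) * x z 1) = 0 := by
    intro m n
    have h1 := h (.inl (m, n))
    have h2 := h (.inr (.inl (m, n)))
    rw [inner_spinorGaussLp _ (ae_eq_refl _)] at h1 h2
    have h3 := hsigned _ _ _ h1
    have h4 := hsigned _ _ _ h2
    push_cast at h3 h4
    have h5 : (∫ z, starRingEnd ℂ (landauFun m n z) * x z 0) = 0 := by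
      linear_combination (h3 + h4) / 2
    refine ⟨h5, ?_⟩
    rw [h5, zero_add, one_mul] at h3
    refine (mul_eq_zero.1 h3).resolve_left fun h0 => ?_
    have := landauPhase_mul_conj m
    simp [h0] at this
  have hone : ∀ (m : ℤ) (n : ℕ), (∫ z, starRingEnd ℂ (landauFun m n z) * x z 1) = 0 := by
    intro m n
    rcases le_or_gt 1 m with hm | hm
    · have := (hpos (m - 1) n).2
      rwa [lowerIndex, if_pos (by omega), sub_add_cancel] at this
    · rcases n with _ | n
      · have h1 := h (.inr (.inr (-m).toNat))
        rw [inner_spinorGaussLp _ (ae_eq_refl _), weylEigenfun_inr_inr] at h1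
        have e : ∀ z, inner ℂ (zeroMode (-m).toNat z) (x z) =
            starRingEnd ℂ (landauFun m 0 z) * x z 1 := by
          intro z
          rw [spinor_inner]
          simp [zeroMode, show max (-m) 0 = -m by omega]
        simpa only [e] using h1
      · have := (hpos (m - 1) n).2
        rwa [lowerIndex, if_neg (by omega), sub_add_cancel] at this
  have h0 := ae_eq_zero_of_orthogonal_landauFun (hmeas 0) fun m n => (hpos m n).1
  have h1 := ae_eq_zero_of_orthogonal_landauFun (hmeas 1) hone
  refine Lp.ext ?_
  filter_upwards [h0, h1, Lp.coeFn_zero Spinor 2 (volume : Measure ℂ)] with z hz0 hz1 hz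
  rw [hz]
  ext j
  fin_cases j
  · exact hz0
  · exact hz1

/-- The Hilbert basis of `L²(ℝ², ℂ²)` formed by the eigenfunctions of `W₀`. -/
noncomputable def weylBasis : HilbertBasis WeylIndex ℂ L2Spinor :=
  HilbertBasis.mkOfOrthogonalEqBot orthonormal_weylEigenfun <| by
    rw [Submodule.eq_bot_iff]
    intro x hx
    exact eq_zero_of_orthogonal_weylEigenfun fun i =>
      (Submodule.mem_orthogonal _ _).1 hx _ (Submodule.subset_span ⟨i, rfl⟩)

lemma weylBasis_apply (i : WeylIndex) : weylBasis i = spinorGaussLp (weylEigenfun_mem i) := by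
  rw [weylBasis, HilbertBasis.coe_mkOfOrthogonalEqBot]

/-! ### Self-adjointness of the free Weyl operator -/

lemma integrable_fderiv_apply {P : ℂ → ℂ} (hP : ContDiff ℝ 1 P) (hc : HasCompactSupport P) (v : ℂ) :
    Integrable fun z => fderiv ℝ P z v :=
  ((hP.continuous_fderiv (by simp)).clm_apply continuous_const).integrable_of_hasCompactSupport
    (hc.fderiv_apply (𝕜 := ℝ) v)

lemma integral_fderiv_eq_zero {P : ℂ → ℂ} (hP : ContDiff ℝ 1 P) (hc : HasCompactSupport P) (v : ℂ) :
    ∫ z, fderiv ℝ P z v = 0 := by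
  have hd : Differentiable ℝ P := hP.differentiable (by simp)
  have h := integral_mul_fderiv_eq_neg_fderiv_mul_of_integrable (μ := (volume : Measure ℂ))
    (f := fun _ : ℂ => (1 : ℂ)) (g := P) (v := v) (𝕜 := ℂ) (by simp) (by simpa using integrable_fderiv_apply hP hc v)
    (by simpa using hP.continuous.integrable_of_hasCompactSupport hc)
    (fun x _ => differentiableAt_const _) (fun x _ => hd x)
  simpa using h

lemma fderiv_conj_mul {f g : ℂ → ℂ} (hf : Differentiable ℝ f) (hg : Differentiable ℝ g) (z v : ℂ) :
    fderiv ℝ (fun z => starRingEnd ℂ (f z) * g z) z v =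
      starRingEnd ℂ (f z) * fderiv ℝ g z v + starRingEnd ℂ (fderiv ℝ f z v) * g z := by
  have h1 : HasFDerivAt (fun z => starRingEnd ℂ (f z))
      ((Complex.conjCLE : ℂ →L[ℝ] ℂ).comp (fderiv ℝ f z)) z :=
    (Complex.conjCLE : ℂ →L[ℝ] ℂ).hasFDerivAt.comp z (hf z).hasFDerivAt
  have h2 : HasFDerivAt (fun z => starRingEnd ℂ (f z) * g z) _ z := h1.mul (hg z).hasFDerivAt
  rw [h2.fderiv]
  simp
  ring

/-- Integration by parts: the Weyl expression is symmetric. -/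
lemma integral_inner_weyl_symm {u η : ℂ → Spinor} (hu : u ∈ spinorGauss) (hη : ContDiff ℝ ∞ η)
    (hη' : HasCompactSupport η) :
    ∫ z, inner ℂ (u z) (weyl 0 η z) = ∫ z, inner ℂ (weyl 0 u z) (η z) := by
  have hu1 := contDiff_of_mem_spinorGauss hu
  have hud := differentiable_of_mem_spinorGauss hu
  have hηd : Differentiable ℝ η := hη.differentiable (by simp)
  have hηi : ∀ i : Fin 2, ContDiff ℝ ∞ fun z => η z i := (contDiff_piLp (n := ∞) 2).1 hη
  have hηci : ∀ i : Fin 2, HasCompactSupport fun z => η z i := fun i =>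
    hη'.comp_left (g := fun v : Spinor => v i) rfl
  have hui : ∀ i : Fin 2, ContDiff ℝ ∞ fun z => starRingEnd ℂ (u z i) := fun i =>
    Complex.conjCLE.contDiff.comp (contDiff_of_mem_gaussSpan (hu i))
  have hP : ∀ i j : Fin 2, ContDiff ℝ 1 fun z => starRingEnd ℂ (u z i) * η z j := fun i j =>
    ((hui i).mul (hηi j)).of_le (by exact_mod_cast le_top)
  have hPc : ∀ i j : Fin 2, HasCompactSupport fun z => starRingEnd ℂ (u z i) * η z j := fun i j =>
    (hηci j).mul_left
  have hI := fun (i j : Fin 2) (v : ℂ) => integrable_fderiv_apply (hP i j) (hPc i j) v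
  have hI0 := fun (i j : Fin 2) (v : ℂ) => integral_fderiv_eq_zero (hP i j) (hPc i j) v
  have hF := fun (i j : Fin 2) (z v : ℂ) => fderiv_conj_mul (differentiable_of_mem_gaussSpan (hu i))
    ((hηi j).differentiable (by simp)) z v
  have hpt : ∀ z, inner ℂ (u z) (weyl 0 η z) = inner ℂ (weyl 0 u z) (η z) +
      (-Complex.I * fderiv ℝ (fun z => starRingEnd ℂ (u z 0) * η z 1) z 1
      + (-1) * fderiv ℝ (fun z => starRingEnd ℂ (u z 0) * η z 1) z Complex.I
      + -Complex.I * fderiv ℝ (fun z => starRingEnd ℂ (u z 1) * η z 0) z 1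
      + 1 * fderiv ℝ (fun z => starRingEnd ℂ (u z 1) * η z 0) z Complex.I) := by
    intro z
    have h2 : starRingEnd ℂ (2 : ℂ) = 2 := Complex.conj_ofNat 2
    rw [spinor_inner, spinor_inner, weyl_apply_zero 0 (hηd z), weyl_apply_one 0 (hηd z),
      weyl_apply_zero 0 (hud z), weyl_apply_one 0 (hud z), hF, hF, hF, hF]
    simp only [dStar, dAdj, zero_div, Complex.ofReal_zero, zero_mul, sub_zero, map_mul, map_add,
      map_sub, map_neg, map_div₀, Complex.conj_I, Complex.conj_conj, h2]
    ring_nf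
    simp only [Complex.I_sq]
    ring
  have hcont : Continuous fun z => inner ℂ (weyl 0 u z) (η z) :=
    (contDiff_of_mem_spinorGauss (weyl_zero_mem_spinorGauss hu)).continuous.inner hη.continuous
  have hc : HasCompactSupport fun z => inner ℂ (weyl 0 u z) (η z) := by
    refine hη'.mono fun z hz h0 => hz ?_
    simp only [h0, inner_zero_right]
  simp_rw [hpt]
  rw [integral_add (hcont.integrable_of_hasCompactSupport hc), integral_add, integral_add,
    integral_add, integral_const_mul, integral_const_mul, integral_const_mul, integral_const_mul,
    hI0, hI0, hI0, hI0]
  · simp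
  · exact (hI _ _ _).const_mul _
  · exact (hI _ _ _).const_mul _
  · exact ((hI _ _ _).const_mul _).add ((hI _ _ _).const_mul _)
  · exact (hI _ _ _).const_mul _
  · exact (((hI _ _ _).const_mul _).add ((hI _ _ _).const_mul _)).add ((hI _ _ _).const_mul _)
  · exact (hI _ _ _).const_mul _
  · exact ((((hI _ _ _).const_mul _).add ((hI _ _ _).const_mul _)).add
      ((hI _ _ _).const_mul _)).add ((hI _ _ _).const_mul _)

lemma tendsto_toLp_of_norm_sub_le {u : ℕ → ℂ → Spinor} {v : ℂ → Spinor} {h : ℂ → ℝ}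
    (hu : ∀ n, MemLp (u n) 2) (hv : MemLp v 2) (hh : MemLp h 2)
    (hle : ∀ n z, ‖u n z - v z‖ ≤ 1 / ((n : ℝ) + 1) * ‖h z‖) :
    Tendsto (fun n => (hu n).toLp (u n)) atTop (𝓝 (hv.toLp v)) := by
  rw [tendsto_iff_norm_sub_tendsto_zero]
  have h0 : Tendsto (fun n : ℕ => 1 / ((n : ℝ) + 1) * ‖hh.toLp h‖) atTop (𝓝 0) := by
    simpa using tendsto_one_div_add_atTop_nhds_zero_nat.mul_const ‖hh.toLp h‖
  refine squeeze_zero (fun _ => norm_nonneg _) (fun n => ?_) h0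
  rw [← MemLp.toLp_sub]
  refine Lp.norm_le_mul_norm_of_ae_le_mul ?_
  filter_upwards [((hu n).sub hv).coeFn_toLp, hh.coeFn_toLp] with z h1 h2
  rw [h1, h2]
  exact hle n z

lemma smul_mem_spinorGauss {u : ℂ → Spinor} (hu : u ∈ spinorGauss) :
    (fun z => z • u z) ∈ spinorGauss := by
  have key : ∀ f ∈ gaussSpan, (fun z => z * f z) ∈ gaussSpan := by
    intro f hf
    induction hf using Submodule.span_induction with
    | mem f hf =>
      obtain ⟨⟨p, q⟩, rfl⟩ := hf
      have : (fun z => z * gaussMon p q z) = gaussMon (p + 1) q := by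
        funext z; simp only [gaussMon]; ring
      simp only [this]
      exact gaussMon_mem _ _
    | zero =>
      convert gaussSpan.zero_mem using 1
      funext z; simp
    | add f g _ _ hf hg =>
      convert! gaussSpan.add_mem hf hg using 1
      funext z; simp [mul_add]
    | smul c f _ hf =>
      convert! gaussSpan.smul_mem c hf using 1
      funext z; simp; ring
  exact fun i => key _ (hu i)

/-- The commutator of the Weyl expression with a real cutoff function is bounded by the gradient of
the cutoff. -/
lemma norm_weyl_smul_sub_le {u : ℂ → Spinor} {χ : ℂ → ℝ} {z : ℂ} (hu : DifferentiableAt ℝ u z)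
    (hχ : DifferentiableAt ℝ χ z) :
    ‖weyl 0 (fun y => (χ y : ℂ) • u y) z - (χ z : ℂ) • weyl 0 u z‖ ≤
      2 * ‖fderiv ℝ χ z‖ * ‖u z‖ := by
  have hD' : HasFDerivAt (fun y => χ y • u y) _ z := hχ.hasFDerivAt.smul hu.hasFDerivAt
  have hD := hD'.fderiv
  have e : weyl 0 (fun y => (χ y : ℂ) • u y) z - (χ z : ℂ) • weyl 0 u z =
      WithLp.toLp 2 (pauli₁.mulVec ((-Complex.I * (fderiv ℝ χ z 1 : ℝ)) • u z).ofLp) +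
      WithLp.toLp 2 (pauli₂.mulVec ((-Complex.I * (fderiv ℝ χ z Complex.I : ℝ)) • u z).ofLp) := by
    ext i
    fin_cases i <;>
    · simp [weyl, kinMom₁, kinMom₂, pauli₁, pauli₂, hD, dotProduct, Fin.sum_univ_two]
      ring
  have h1 : ∀ w : Spinor, ‖(WithLp.toLp 2 (pauli₁.mulVec w.ofLp) : Spinor)‖ = ‖w‖ := by
    intro w
    rw [EuclideanSpace.norm_eq, EuclideanSpace.norm_eq]
    simp [pauli₁, dotProduct, Fin.sum_univ_two, add_comm]
  have h2 : ∀ w : Spinor, ‖(WithLp.toLp 2 (pauli₂.mulVec w.ofLp) : Spinor)‖ = ‖w‖ := by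
    intro w
    rw [EuclideanSpace.norm_eq, EuclideanSpace.norm_eq]
    simp [pauli₂, dotProduct, Fin.sum_univ_two, add_comm]
  have h3 : ∀ v : ℂ, ‖v‖ = 1 → ‖(-Complex.I * (fderiv ℝ χ z v : ℝ)) • u z‖ ≤
      ‖fderiv ℝ χ z‖ * ‖u z‖ := by
    intro v hv
    rw [norm_smul, norm_mul, norm_neg, Complex.norm_I, one_mul, Complex.norm_real]
    gcongr
    simpa [hv] using (fderiv ℝ χ z).le_opNorm v
  rw [e]
  refine (norm_add_le _ _).trans ?_
  rw [h1, h2]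
  have h4 := h3 1 (by simp)
  have h5 := h3 Complex.I (by simp)
  linarith

/-- Gaussian spinors belong to the domain of the closure of `W₀`: with the cutoffs `χ (x / n)`, both
the spinors and their images converge at rate `1 / n`, since the weighted functions `x u` and
`x W₀ u` are still square integrable. -/
lemma mem_closure_weylMinGraph {u : ℂ → Spinor} (hu : u ∈ spinorGauss) :
    (spinorGaussLp hu, spinorGaussLp (weyl_zero_mem_spinorGauss hu)) ∈
      weylMinGraph.topologicalClosure := by
  have hw := weyl_zero_mem_spinorGauss hu
  have hud := differentiable_of_mem_spinorGauss hu
  let χ : ContDiffBump (0 : ℂ) := ⟨1, 2, by norm_num, by norm_num⟩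
  have hχs : ContDiff ℝ ∞ χ := χ.contDiff
  obtain ⟨C, hC⟩ := (χ.hasCompactSupport.fderiv (𝕜 := ℝ)).exists_bound_of_continuous
    (hχs.continuous_fderiv (by simp))
  have hC0 : 0 ≤ C := (norm_nonneg _).trans (hC 0)
  have hχ1 : ∀ y : ℂ, |χ y - 1| ≤ ‖y‖ := by
    intro y
    rcases le_or_gt ‖y‖ 1 with hy | hy
    · rw [χ.one_of_mem_closedBall (by simpa using hy)]; simp
    · have h1 := χ.nonneg (x := y)
      have h2 := χ.le_one (x := y)
      rw [abs_le]; constructor <;> linarith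
  set R : ℕ → ℝ := fun n => ((n : ℝ) + 1)⁻¹ with hR
  have hR0 : ∀ n, 0 < R n := fun n => by positivity
  set c : ℕ → ℂ → ℝ := fun n y => χ (R n • y) with hc
  have hcs : ∀ n, ContDiff ℝ ∞ (c n) := fun n => hχs.comp (contDiff_const_smul (R n))
  have hcd : ∀ n, Differentiable ℝ (c n) := fun n => (hcs n).differentiable (by simp)
  have hcc : ∀ n, HasCompactSupport (c n) := fun n => χ.hasCompactSupport.comp_smul (hR0 n).ne'
  have hc1 : ∀ n y, |c n y - 1| ≤ R n * ‖y‖ := by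
    intro n y
    refine (hχ1 _).trans ?_
    rw [norm_smul, Real.norm_of_nonneg (hR0 n).le]
  have hcf : ∀ n y, ‖fderiv ℝ (c n) y‖ ≤ R n * C := by
    intro n y
    rw [hc, fderiv_comp_smul, norm_smul, Real.norm_of_nonneg (hR0 n).le]
    exact mul_le_mul_of_nonneg_left (hC _) (hR0 n).le
  set U : ℕ → ℂ → Spinor := fun n y => (c n y : ℂ) • u y with hU
  have hUs : ∀ n, ContDiff ℝ ∞ (U n) := fun n =>
    (Complex.ofRealCLM.contDiff.comp (hcs n)).smul (contDiff_of_mem_spinorGauss hu)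
  have hUc : ∀ n, HasCompactSupport (U n) := fun n =>
    ((hcc n).comp_left (g := fun x : ℝ => (x : ℂ)) (by simp)).smul_right
  have hWc : ∀ n, Continuous (weyl 0 (U n)) := by
    intro n
    have h1 : Continuous fun x => fderiv ℝ (U n) x 1 :=
      ((hUs n).continuous_fderiv (by simp)).clm_apply continuous_const
    have h2 : Continuous fun x => fderiv ℝ (U n) x Complex.I :=
      ((hUs n).continuous_fderiv (by simp)).clm_apply continuous_const
    have h0 := (hUs n).continuous
    have e : weyl 0 (U n) = fun x => WithLp.toLp 2 (pauli₁.mulVec (kinMom₁ (U n) x).ofLp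
        + pauli₂.mulVec (kinMom₂ (U n) x).ofLp) := by
      funext x; simp [weyl]
    rw [e]
    unfold kinMom₁ kinMom₂
    fun_prop
  set h : ℂ → ℝ := fun z => ‖z • u z‖ + (‖z • weyl 0 u z‖ + 2 * C * ‖u z‖) with hh
  have hhL : MemLp h 2 := (memLp_of_mem_spinorGauss (smul_mem_spinorGauss hu)).norm.add
    ((memLp_of_mem_spinorGauss (smul_mem_spinorGauss hw)).norm.add
      ((memLp_of_mem_spinorGauss hu).norm.const_mul _))
  have hh0 : ∀ z, ‖h z‖ = ‖z • u z‖ + (‖z • weyl 0 u z‖ + 2 * C * ‖u z‖) := fun z =>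
    Real.norm_of_nonneg (by positivity)
  have hcut : ∀ n z (w : Spinor), ‖(c n z : ℂ) • w - w‖ ≤ R n * ‖z • w‖ := by
    intro n z w
    have : (c n z : ℂ) • w - w = ((c n z - 1 : ℝ) : ℂ) • w := by
      push_cast; rw [sub_smul, one_smul]
    rw [this, norm_smul, norm_smul, Complex.norm_real, ← mul_assoc]
    exact mul_le_mul_of_nonneg_right (hc1 n z) (norm_nonneg _)
  have hle1 : ∀ n z, ‖U n z - u z‖ ≤ 1 / ((n : ℝ) + 1) * ‖h z‖ := by
    intro n z
    refine (hcut n z (u z)).trans ?_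
    rw [hh0, one_div]
    refine mul_le_mul_of_nonneg_left ?_ (hR0 n).le
    have : 0 ≤ ‖z • weyl 0 u z‖ + 2 * C * ‖u z‖ := by positivity
    linarith
  have hle2 : ∀ n z, ‖weyl 0 (U n) z - weyl 0 u z‖ ≤ 1 / ((n : ℝ) + 1) * ‖h z‖ := by
    intro n z
    have h1 := norm_weyl_smul_sub_le (hud z) (hcd n z)
    have h2 := hcut n z (weyl 0 u z)
    have h3 : 2 * ‖fderiv ℝ (c n) z‖ * ‖u z‖ ≤ 2 * (R n * C) * ‖u z‖ := by
      gcongr; exact hcf n z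
    have h4 := norm_sub_le_norm_sub_add_norm_sub (weyl 0 (U n) z) ((c n z : ℂ) • weyl 0 u z)
      (weyl 0 u z)
    rw [hh0, one_div]
    have h5 : 0 ≤ R n * ‖z • u z‖ := mul_nonneg (hR0 n).le (norm_nonneg _)
    change _ ≤ R n * _
    nlinarith
  have hm1 : ∀ n, MemLp (U n) 2 (volume : Measure ℂ) := fun n =>
    (hUs n).continuous.memLp_of_hasCompactSupport (hUc n)
  have hm2 : ∀ n, MemLp (weyl 0 (U n)) 2 (volume : Measure ℂ) := by
    intro n
    have h1 : MemLp (fun z => weyl 0 (U n) z - weyl 0 u z) 2 (volume : Measure ℂ) := by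
      refine (hhL.const_mul (1 / ((n : ℝ) + 1))).of_le ?_ (ae_of_all _ fun z => ?_)
      · exact ((hWc n).sub (contDiff_of_mem_spinorGauss hw).continuous).aestronglyMeasurable
      · refine (hle2 n z).trans ?_
        rw [norm_mul, Real.norm_of_nonneg (by positivity : (0 : ℝ) ≤ 1 / ((n : ℝ) + 1))]
    exact (h1.add (memLp_of_mem_spinorGauss hw)).ae_eq (ae_of_all _ fun z => by simp)
  have ht1 := tendsto_toLp_of_norm_sub_le hm1 (memLp_of_mem_spinorGauss hu) hhL hle1
  have ht2 := tendsto_toLp_of_norm_sub_le hm2 (memLp_of_mem_spinorGauss hw) hhL hle2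
  refine mem_closure_of_tendsto (ht1.prodMk_nhds ht2) (Eventually.of_forall fun n => ?_)
  exact ⟨U n, hUs n, hUc n, (hm1 n).coeFn_toLp, (hm2 n).coeFn_toLp⟩

lemma mem_closure_weylMinGraph_iff (p : L2Spinor × L2Spinor) :
    p ∈ weylMinGraph.topologicalClosure ↔
      ∀ i, inner ℂ (weylBasis i) p.2 = (weylEigenval i : ℂ) * inner ℂ (weylBasis i) p.1 := by
  refine mem_closure_iff_diagonal weylBasis weylEigenval weylMinGraph (fun i => ?_)
    (fun p hp i => ?_) p
  · have h := mem_closure_weylMinGraph (weylEigenfun_mem i)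
    rw [weylBasis_apply]
    convert h using 2
    refine Lp.ext ?_
    filter_upwards [coeFn_spinorGaussLp (weylEigenfun_mem i),
      coeFn_spinorGaussLp (weyl_zero_mem_spinorGauss (weylEigenfun_mem i)),
      Lp.coeFn_smul (weylEigenval i : ℂ) (spinorGaussLp (weylEigenfun_mem i))] with z h1 h2 h3
    rw [h3, h2, weyl_weylEigenfun, Pi.smul_apply, Pi.smul_apply, h1]
  · obtain ⟨η, hη, hη', h1, h2⟩ := hp
    rw [weylBasis_apply, inner_spinorGaussLp _ h1, inner_spinorGaussLp _ h2,
      integral_inner_weyl_symm (weylEigenfun_mem i) hη hη', weyl_weylEigenfun, ← integral_const_mul]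
    congr 1
    funext z
    rw [Pi.smul_apply, inner_smul_left, Complex.conj_ofReal]

/-- The free Weyl operator is multiplication by the eigenvalues in the basis `weylBasis`. -/
lemma mem_graph_freeWeyl_iff (p : L2Spinor × L2Spinor) : p ∈ freeWeyl.graph ↔
    ∀ i, inner ℂ (weylBasis i) p.2 = (weylEigenval i : ℂ) * inner ℂ (weylBasis i) p.1 := by
  have hg : weylMinGraph.toLinearPMap.graph = weylMinGraph :=
    Submodule.toLinearPMap_graph_eq _ weylMinGraph_single_valued
  have hcl : weylMinGraph.toLinearPMap.IsClosable := by
    refine ⟨weylMinGraph.topologicalClosure.toLinearPMap, ?_⟩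
    rw [hg, Submodule.toLinearPMap_graph_eq]
    intro p hp h0
    rw [mem_closure_weylMinGraph_iff] at hp
    refine weylBasis.ext_inner fun i => ?_
    rw [hp, h0, inner_zero_right, mul_zero]
  rw [freeWeyl, ← hcl.graph_closure_eq_closure_graph, hg, mem_closure_weylMinGraph_iff]

lemma isSpectralMeasure_freeWeyl :
    IsSpectralMeasure freeWeyl (diagProj weylBasis weylEigenval) :=
  isSpectralMeasure_diagProj _ _ _ mem_graph_freeWeyl_iff

lemma weylBasis_inl_mem (p : ℤ × ℕ) : weylBasis (.inl p) ∈ landauSubspace := by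
  refine ⟨landauSpinor p.1 p.2, Submodule.subset_span ⟨p, rfl⟩, ?_⟩
  rw [weylBasis_apply, landauSpinor_eq]
  exact coeFn_spinorGaussLp (weylEigenfun_mem (.inl p))

/-- The positive spectral subspace of `W₀` is the closure of `𝔔₀`. -/
lemma range_diagProj_Ioi :
    LinearMap.range (diagProj weylBasis weylEigenval (Set.Ioi 0)).toLinearMap =
      landauSubspace.topologicalClosure := by
  rw [range_diagProj]
  congr 1
  apply le_antisymm
  · rw [Submodule.span_le]
    rintro _ ⟨i, hi, rfl⟩
    obtain ⟨p, rfl⟩ := (weylEigenval_pos_iff i).1 hi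
    exact weylBasis_inl_mem p
  · rintro ψ ⟨u, hu, hψ⟩
    have key : ∀ u (hu : u ∈ landauSpan), spinorGaussLp (landauSpan_le hu) ∈
        Submodule.span ℂ (weylBasis '' {i | weylEigenval i ∈ Set.Ioi 0}) := by
      intro u hu
      induction hu using Submodule.span_induction with
      | mem u hu =>
        obtain ⟨p, rfl⟩ := hu
        refine Submodule.subset_span ⟨.inl p, (weylEigenval_pos_iff _).2 ⟨p, rfl⟩, ?_⟩
        rw [weylBasis_apply]
        congr 1
        exact (landauSpinor_eq _ _).symm
      | zero =>
        convert Submodule.zero_mem _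
        exact MemLp.toLp_zero _
      | add u v hu' hv' hu hv => exact Submodule.add_mem _ hu hv
      | smul c u hu' hu => exact Submodule.smul_mem _ c hu
    have : ψ = spinorGaussLp (landauSpan_le hu) :=
      Lp.ext (hψ.trans (coeFn_spinorGaussLp _).symm)
    rw [this]
    exact key u hu

/-! ### The ground state representation of a quadratic form -/

section GroundState

variable {ι : Type*}

/-- The value at `c` of the quadratic form with real matrix `K`. -/
noncomputable def quadForm (K : ι → ι → ℝ) (c : ι →₀ ℂ) : ℝ :=
  c.sum fun p a => c.sum fun p' b => (starRingEnd ℂ a * b).re * K p p'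

lemma quadForm_mapDomain {κ : Type*} (K : κ → κ → ℝ) {e : ι → κ} (he : Function.Injective e)
    (c : ι →₀ ℂ) : quadForm K (c.mapDomain e) = quadForm (fun p p' => K (e p) (e p')) c := by
  rw [quadForm, Finsupp.sum_mapDomain_index_inj he]
  simp_rw [Finsupp.sum_mapDomain_index_inj he]
  rfl

lemma norm_div_sub_div_sq {h k : ℝ} (hh : 0 < h) (hk : 0 < k) (a b : ℂ) :
    h * k * ‖a / h - b / k‖ ^ 2 =
      k * (‖a‖ ^ 2 / h) + h * (‖b‖ ^ 2 / k) - 2 * (starRingEnd ℂ a * b).re := by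
  have e : ∀ z : ℂ, ‖z‖ ^ 2 = z.re ^ 2 + z.im ^ 2 := fun z => by
    rw [← Complex.normSq_eq_norm_sq, Complex.normSq_apply]; ring
  simp only [e, Complex.sub_re, Complex.sub_im, Complex.div_ofReal_re, Complex.div_ofReal_im,
    Complex.mul_re, Complex.conj_re, Complex.conj_im]
  field_simp
  ring

/-- If `K h = l h` with `h > 0`, then `l - K` is a sum of squares of differences of `c / h`. -/
lemma hasSum_groundState {K : ι → ι → ℝ} {h l : ι → ℝ} (hK : ∀ p p', 0 ≤ K p p')
    (hsymm : ∀ p p', K p p' = K p' p) (hh : ∀ p, 0 < h p)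
    (hKh : ∀ p, HasSum (fun p' => K p p' * h p') (l p * h p)) (c : ι →₀ ℂ) :
    HasSum (fun p : ι × ι => K p.1 p.2 / 2 *
        (h p.1 * h p.2 * ‖c p.1 / h p.1 - c p.2 / h p.2‖ ^ 2))
      ((c.sum fun p a => l p * ‖a‖ ^ 2) - quadForm K c) := by
  set A : ι × ι → ℝ := fun p => K p.1 p.2 * h p.2 * (‖c p.1‖ ^ 2 / h p.1) with hA
  have hfib : ∀ p, HasSum (fun p' => A (p, p')) (l p * ‖c p‖ ^ 2) := by
    intro p
    have := (hKh p).mul_right (‖c p‖ ^ 2 / h p)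
    rwa [show l p * h p * (‖c p‖ ^ 2 / h p) = l p * ‖c p‖ ^ 2 by
      have := (hh p).ne'
      field_simp] at this
  have hA0 : ∀ p, 0 ≤ A p := fun p =>
    mul_nonneg (mul_nonneg (hK _ _) (hh _).le) (div_nonneg (by positivity) (hh _).le)
  have hfin : HasSum (fun p => l p * ‖c p‖ ^ 2) (c.sum fun p a => l p * ‖a‖ ^ 2) :=
    hasSum_sum_of_ne_finset_zero fun p hp => by simp [Finsupp.notMem_support_iff.1 hp]
  have hAs : Summable A := (summable_prod_of_nonneg hA0).2
    ⟨fun p => (hfib p).summable, by simpa only [(hfib _).tsum_eq] using hfin.summable⟩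
  have h1 : HasSum A (c.sum fun p a => l p * ‖a‖ ^ 2) := by
    have := hAs.hasSum.prod_fiberwise hfib
    rw [hfin.unique this]
    exact hAs.hasSum
  have h2 : HasSum (fun p : ι × ι => A p.swap) (c.sum fun p a => l p * ‖a‖ ^ 2) :=
    (Equiv.prodComm ι ι).hasSum_iff.2 h1
  have h3 : HasSum (fun p : ι × ι => (starRingEnd ℂ (c p.1) * c p.2).re * K p.1 p.2)
      (quadForm K c) := by
    have : HasSum (fun p : ι × ι => (starRingEnd ℂ (c p.1) * c p.2).re * K p.1 p.2)
        (∑ p ∈ c.support ×ˢ c.support, (starRingEnd ℂ (c p.1) * c p.2).re * K p.1 p.2) :=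
      hasSum_sum_of_ne_finset_zero (fun p hp => by
        rw [Finset.mem_product, not_and_or, Finsupp.notMem_support_iff,
          Finsupp.notMem_support_iff] at hp
        rcases hp with hp | hp <;> simp [hp])
    rwa [Finset.sum_product] at this
  have h4 := (((h1.add h2).mul_left (1 / 2)).sub h3)
  convert! h4 using 1
  · funext p
    rw [norm_div_sub_div_sq (hh _) (hh _)]
    simp only [hA, Prod.fst_swap, Prod.snd_swap, hsymm p.2 p.1]
    ring
  · ring

end GroundState

/-- A form that is a sum of continuous nonnegative functions is lower semicontinuous, hence
closable. -/
lemma tendsto_form_zero_of_hasSum {H κ : Type*} [NormedAddCommGroup H] [InnerProductSpace ℂ H]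
    {D : Submodule ℂ H} {q : D → ℝ} {t : κ → H → ℝ} (ht : ∀ k, Continuous (t k))
    (ht0 : ∀ k x, 0 ≤ t k x) (hq : ∀ w : D, HasSum (fun k => t k w) (q w)) {u : ℕ → D}
    (hu : Tendsto (fun n => (u n : H)) atTop (𝓝 0))
    (hc : Tendsto (fun p : ℕ × ℕ => q (u p.1 - u p.2)) atTop (𝓝 0)) :
    Tendsto (fun n => q (u n)) atTop (𝓝 0) := by
  have hq0 : ∀ w, 0 ≤ q w := fun w => (hq w).nonneg fun k => ht0 k _
  rw [Metric.tendsto_atTop]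
  intro ε hε
  obtain ⟨⟨N, M⟩, hN⟩ := (hc.eventually (gt_mem_nhds (half_pos hε))).exists_forall_of_atTop
  refine ⟨N, fun n hn => ?_⟩
  have hle : q (u n) ≤ ε / 2 := by
    refine hasSum_le_of_sum_le (hq (u n)) fun F => ?_
    have h1 : Tendsto (fun m => ∑ k ∈ F, t k ((u n - u m : D) : H)) atTop
        (𝓝 (∑ k ∈ F, t k (u n))) := by
      refine tendsto_finsetSum _ fun k _ => ?_
      have h2 : Tendsto (fun m => ((u n - u m : D) : H)) atTop (𝓝 (u n)) := by
        simpa using tendsto_const_nhds.sub hu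
      exact ((ht k).tendsto _).comp h2
    refine le_of_tendsto h1 ((eventually_ge_atTop M).mono fun m hm => ?_)
    exact (sum_le_hasSum F (fun k _ => ht0 k _) (hq (u n - u m))).trans
      (hN (n, m) ⟨hn, hm⟩).le
  rw [Real.dist_eq, sub_zero, abs_of_nonneg (hq0 _)]
  linarith

/-! ### The Coulomb matrix on all angular momentum sectors -/

/-- The matrix of the Coulomb potential in the basis of the functions `f^m_n`. -/
noncomputable def landauCoulomb (p p' : ℤ × ℕ) : ℝ :=
  if p.1 = p'.1 then coulombMatrix p.1.natAbs p.2 p'.2 else 0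

/-- The positive sequence used in the Schur test for `landauCoulomb`. -/
noncomputable def landauWeight (p : ℤ × ℕ) : ℝ := schurSeq p.1.natAbs (critExp p.1.natAbs) p.2

/-- The multiplier by which `landauCoulomb` acts on `landauWeight`. -/
noncomputable def landauRate (p : ℤ × ℕ) : ℝ :=
  critConst p.1.natAbs * gammaRatio (p.2 + critExp p.1.natAbs)

/-- The indices of the lower component of `ψ^m_n`. -/
def lowerPair (p : ℤ × ℕ) : ℤ × ℕ := (p.1 + 1, lowerIndex p.1 p.2)

lemma lowerPair_injective : Function.Injective lowerPair := by
  rintro ⟨m, n⟩ ⟨m', n'⟩ h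
  simp only [lowerPair, Prod.mk.injEq, add_left_inj] at h
  obtain ⟨rfl, h⟩ := h
  rw [(lowerIndex_inj m).1 h]

lemma landauCoulomb_nonneg (p p' : ℤ × ℕ) : 0 ≤ landauCoulomb p p' := by
  rw [landauCoulomb]; split_ifs
  exacts [(coulombMatrix_pos _ _ _).le, le_rfl]

lemma landauCoulomb_comm (p p' : ℤ × ℕ) : landauCoulomb p p' = landauCoulomb p' p := by
  rw [landauCoulomb, landauCoulomb]
  by_cases h : p.1 = p'.1
  · rw [if_pos h, if_pos h.symm, h, coulombMatrix_comm]
  · rw [if_neg h, if_neg (Ne.symm h)]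

lemma landauWeight_pos (p : ℤ × ℕ) : 0 < landauWeight p :=
  schurSeq_pos _ (critExp_pos _) _

lemma hasSum_landauCoulomb_mul_landauWeight (p : ℤ × ℕ) :
    HasSum (fun p' => landauCoulomb p p' * landauWeight p') (landauRate p * landauWeight p) := by
  have h := hasSum_coulombMatrix_mul_schurSeq p.1.natAbs p.2 (critExp_pos p.1.natAbs)
    (critExp_lt p.1.natAbs)
  have hi : Function.Injective fun n : ℕ => (p.1, n) := Prod.mk_right_injective p.1
  refine (hi.hasSum_iff ?_).1 ?_
  · rintro ⟨m, n⟩ hm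
    have : p.1 ≠ m := by
      rintro rfl; exact hm ⟨n, rfl⟩
    simp [landauCoulomb, this]
  · convert! h using 1
    funext n
    simp [landauCoulomb, landauWeight]

/-! ### The Weyl form as a sesquilinear map -/

lemma weylForm_add_left (Z : ℝ) {u u' v : ℂ → Spinor} (hu : u ∈ spinorGauss) (hu' : u' ∈ spinorGauss)
    (hv : v ∈ spinorGauss) : weylForm Z (u + u') v = weylForm Z u v + weylForm Z u' v := by
  simp only [weylForm, Pi.add_apply, inner_add_left]
  exact integral_add (integrable_inner_weyl Z hu hv) (integrable_inner_weyl Z hu' hv)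

lemma weylForm_smul_left (Z : ℝ) (c : ℂ) (u v : ℂ → Spinor) :
    weylForm Z (c • u) v = starRingEnd ℂ c * weylForm Z u v := by
  simp only [weylForm, Pi.smul_apply, inner_smul_left]
  exact integral_const_mul _ _

lemma weylForm_add_right (Z : ℝ) {u v v' : ℂ → Spinor} (hu : u ∈ spinorGauss) (hv : v ∈ spinorGauss)
    (hv' : v' ∈ spinorGauss) : weylForm Z u (v + v') = weylForm Z u v + weylForm Z u v' := by
  simp only [weylForm, weyl_add Z (differentiable_of_mem_spinorGauss hv)
    (differentiable_of_mem_spinorGauss hv'), Pi.add_apply, inner_add_right]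
  exact integral_add (integrable_inner_weyl Z hu hv) (integrable_inner_weyl Z hu hv')

lemma weylForm_smul_right (Z : ℝ) (c : ℂ) (u : ℂ → Spinor) {v : ℂ → Spinor} (hv : v ∈ spinorGauss) :
    weylForm Z u (c • v) = c * weylForm Z u v := by
  simp only [weylForm, weyl_smul Z c (differentiable_of_mem_spinorGauss hv), Pi.smul_apply,
    inner_smul_right]
  exact integral_const_mul _ _

/-- The form `weylForm` as a sesquilinear map. -/
noncomputable def weylSesq (Z : ℝ) : spinorGauss →ₗ⋆[ℂ] spinorGauss →ₗ[ℂ] ℂ :=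
  LinearMap.mk₂'ₛₗ (starRingEnd ℂ) (RingHom.id ℂ) (fun u v => weylForm Z u v)
    (fun u u' v => weylForm_add_left Z u.2 u'.2 v.2) (fun c u v => weylForm_smul_left Z c u v)
    (fun u v v' => weylForm_add_right Z u.2 v.2 v'.2) (fun c u v => weylForm_smul_right Z c u v.2)

/-- The finite combination of the spinors `ψ^m_n` with coefficients `c`. -/
noncomputable def landauComb (c : ℤ × ℕ →₀ ℂ) : ℂ → Spinor :=
  Finsupp.linearCombination ℂ (fun p : ℤ × ℕ => landauSpinor p.1 p.2) c

lemma mem_landauSpan_iff {u : ℂ → Spinor} : u ∈ landauSpan ↔ ∃ c, landauComb c = u :=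
  Finsupp.mem_span_range_iff_exists_finsupp

lemma landauComb_mem (c : ℤ × ℕ →₀ ℂ) : landauComb c ∈ landauSpan :=
  mem_landauSpan_iff.2 ⟨c, rfl⟩

lemma weylForm_landauSpinor' (Z : ℝ) (p p' : ℤ × ℕ) :
    weylForm Z (landauSpinor p.1 p.2) (landauSpinor p'.1 p'.2) =
      (((if p = p' then 2 * √(landauLevel p.1 p.2) else 0) - Z / 2 * (landauCoulomb p p' +
        landauCoulomb (lowerPair p) (lowerPair p')) : ℝ) : ℂ) := by
  rw [weylForm_landauSpinor]
  obtain ⟨m, n⟩ := p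
  obtain ⟨m', n'⟩ := p'
  by_cases hm : m = m'
  · subst hm
    simp only [landauCoulomb, lowerPair, spinorCoulomb, if_true, Prod.mk.injEq, true_and]
    congr 1
    ring
  · simp [landauCoulomb, lowerPair, hm]

lemma weylForm_landauComb (Z : ℝ) (c d : ℤ × ℕ →₀ ℂ) :
    weylForm Z (landauComb c) (landauComb d) = c.sum fun p a => d.sum fun p' b =>
      starRingEnd ℂ a * b * weylForm Z (landauSpinor p.1 p.2) (landauSpinor p'.1 p'.2) := by
  set ψ : ℤ × ℕ → spinorGauss := fun p => ⟨landauSpinor p.1 p.2, landauSpinor_mem _ _⟩ with hψ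
  have hc : ∀ c : ℤ × ℕ →₀ ℂ, landauComb c = (Finsupp.linearCombination ℂ ψ c : spinorGauss) := by
    intro c
    rw [landauComb, Finsupp.linearCombination_apply, Finsupp.linearCombination_apply, Finsupp.sum,
      Finsupp.sum, Submodule.coe_sum]
    rfl
  have h : weylForm Z (landauComb c) (landauComb d) =
      weylSesq Z (Finsupp.linearCombination ℂ ψ c) (Finsupp.linearCombination ℂ ψ d) := by
    rw [hc, hc]; rfl
  rw [h, Finsupp.linearCombination_apply, Finsupp.linearCombination_apply, Finsupp.sum, Finsupp.sum,
    map_sum (weylSesq Z), LinearMap.sum_apply]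
  refine Finset.sum_congr rfl fun p _ => ?_
  rw [map_sum]
  refine Finset.sum_congr rfl fun p' _ => ?_
  rw [map_smulₛₗ (weylSesq Z), LinearMap.smul_apply, map_smul, smul_eq_mul, smul_eq_mul, ← mul_assoc]
  rfl

lemma weylForm_conj_symm (Z : ℝ) {u v : ℂ → Spinor} (hu : u ∈ landauSpan) (hv : v ∈ landauSpan) :
    weylForm Z u v = starRingEnd ℂ (weylForm Z v u) := by
  obtain ⟨c, rfl⟩ := mem_landauSpan_iff.1 hu
  obtain ⟨d, rfl⟩ := mem_landauSpan_iff.1 hv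
  rw [weylForm_landauComb, weylForm_landauComb]
  simp only [Finsupp.sum, map_sum]
  rw [Finset.sum_comm]
  refine Finset.sum_congr rfl fun p' _ => Finset.sum_congr rfl fun p _ => ?_
  rw [map_mul, map_mul, Complex.conj_conj, weylForm_landauSpinor', weylForm_landauSpinor',
    Complex.conj_ofReal, landauCoulomb_comm p p', landauCoulomb_comm (lowerPair p)]
  have : (if p = p' then 2 * √(landauLevel p.1 p.2) else 0) =
      if p' = p then 2 * √(landauLevel p'.1 p'.2) else 0 := by
    by_cases h : p = p'
    · subst h; simp
    · rw [if_neg h, if_neg (Ne.symm h)]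
  rw [this]
  ring

lemma re_weylForm_landauComb (Z : ℝ) (c : ℤ × ℕ →₀ ℂ) :
    (weylForm Z (landauComb c) (landauComb c)).re =
      (c.sum fun p a => 2 * √(landauLevel p.1 p.2) * ‖a‖ ^ 2) -
        Z / 2 * (quadForm landauCoulomb c + quadForm landauCoulomb (c.mapDomain lowerPair)) := by
  rw [weylForm_landauComb, quadForm_mapDomain _ lowerPair_injective, quadForm, quadForm]
  simp only [Finsupp.sum, Complex.re_sum]
  rw [← Finset.sum_add_distrib, Finset.mul_sum, ← Finset.sum_sub_distrib]
  refine Finset.sum_congr rfl fun p hp => ?_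
  rw [← Finset.sum_add_distrib, Finset.mul_sum]
  have e : 2 * √(landauLevel p.1 p.2) * ‖c p‖ ^ 2 = ∑ p' ∈ c.support,
      if p = p' then 2 * √(landauLevel p.1 p.2) * (starRingEnd ℂ (c p) * c p').re else 0 := by
    rw [Finset.sum_ite_eq, if_pos hp, mul_comm (starRingEnd ℂ (c p)), Complex.mul_conj,
      Complex.normSq_eq_norm_sq, Complex.ofReal_re]
  rw [e, ← Finset.sum_sub_distrib]
  refine Finset.sum_congr rfl fun p' _ => ?_
  rw [weylForm_landauSpinor', Complex.re_mul_ofReal]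
  split_ifs <;> ring

/-! ### Positivity and closability for subcritical charges -/

/-- The coefficients of `ψ` with respect to the spinors `ψ^m_n`. -/
noncomputable def landauCoeff (ψ : L2Spinor) (p : ℤ × ℕ) : ℂ := inner ℂ (weylBasis (.inl p)) ψ

lemma continuous_landauCoeff (p : ℤ × ℕ) : Continuous fun ψ => landauCoeff ψ p :=
  continuous_const.inner continuous_id

/-- The finite combination of the basis vectors `ψ^m_n` in `L²`. -/
noncomputable def landauCombLp : (ℤ × ℕ →₀ ℂ) →ₗ[ℂ] L2Spinor :=
  Finsupp.linearCombination ℂ fun p : ℤ × ℕ => weylBasis (.inl p)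

lemma coeFn_landauCombLp (c : ℤ × ℕ →₀ ℂ) : landauCombLp c =ᵐ[volume] landauComb c := by
  induction c using Finsupp.induction_linear with
  | zero => simpa [landauComb] using Lp.coeFn_zero Spinor 2 (volume : Measure ℂ)
  | add c d hc hd =>
    rw [map_add, show landauComb (c + d) = landauComb c + landauComb d from map_add _ _ _]
    exact (Lp.coeFn_add _ _).trans (hc.add hd)
  | single p a =>
    rw [landauCombLp, landauComb, Finsupp.linearCombination_single, Finsupp.linearCombination_single,
      weylBasis_apply, landauSpinor_eq]
    exact (Lp.coeFn_smul _ _).trans ((coeFn_spinorGaussLp (weylEigenfun_mem (.inl p))).const_smul a)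

lemma landauCoeff_landauCombLp (c : ℤ × ℕ →₀ ℂ) (p : ℤ × ℕ) :
    landauCoeff (landauCombLp c) p = c p :=
  (weylBasis.orthonormal.comp (fun p : ℤ × ℕ => (.inl p : WeylIndex))
    Sum.inl_injective).inner_right_finsupp c p

lemma landauCombLp_mem (c : ℤ × ℕ →₀ ℂ) : landauCombLp c ∈ landauSubspace :=
  ⟨landauComb c, landauComb_mem c, coeFn_landauCombLp c⟩

/-- Finite sequences of coefficients parametrize `𝔔₀`. -/
noncomputable def landauCombEquiv : (ℤ × ℕ →₀ ℂ) ≃ₗ[ℂ] landauSubspace :=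
  LinearEquiv.ofBijective (landauCombLp.codRestrict landauSubspace landauCombLp_mem) <| by
    constructor
    · intro c d h
      have h' : landauCombLp c = landauCombLp d := congrArg Subtype.val h
      ext p
      rw [← landauCoeff_landauCombLp, h', landauCoeff_landauCombLp]
    · rintro ⟨ψ, u, hu, h⟩
      obtain ⟨c, rfl⟩ := mem_landauSpan_iff.1 hu
      exact ⟨c, Subtype.ext (Lp.ext ((coeFn_landauCombLp c).trans h.symm))⟩

lemma coe_landauCombEquiv (c : ℤ × ℕ →₀ ℂ) : (landauCombEquiv c : L2Spinor) = landauCombLp c := rfl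

/-- The form `(φ, W_Z ψ)` on `𝔔₀`, as a subspace of `L²`. -/
noncomputable def landauForm (Z : ℝ) : landauSubspace →ₗ⋆[ℂ] landauSubspace →ₗ[ℂ] ℂ :=
  LinearMap.mk₂'ₛₗ (starRingEnd ℂ) (RingHom.id ℂ)
    (fun φ ψ => weylForm Z (landauComb (landauCombEquiv.symm φ)) (landauComb (landauCombEquiv.symm ψ)))
    (fun φ φ' ψ => by
      rw [map_add, show ∀ c d, landauComb (c + d) = landauComb c + landauComb d from map_add _,
        weylForm_add_left Z (landauSpan_le (landauComb_mem _)) (landauSpan_le (landauComb_mem _))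
          (landauSpan_le (landauComb_mem _))])
    (fun a φ ψ => by
      rw [map_smul, show ∀ c, landauComb (a • c) = a • landauComb c from map_smul _ a,
        weylForm_smul_left, smul_eq_mul])
    (fun φ ψ ψ' => by
      rw [map_add, show ∀ c d, landauComb (c + d) = landauComb c + landauComb d from map_add _,
        weylForm_add_right Z (landauSpan_le (landauComb_mem _)) (landauSpan_le (landauComb_mem _))
          (landauSpan_le (landauComb_mem _))])
    (fun a φ ψ => by
      rw [map_smul, show ∀ c, landauComb (a • c) = a • landauComb c from map_smul _ a,
        weylForm_smul_right _ _ _ (landauSpan_le (landauComb_mem _)), smul_eq_mul, RingHom.id_apply])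

lemma landauForm_apply (Z : ℝ) (φ ψ : landauSubspace) : landauForm Z φ ψ =
    weylForm Z (landauComb (landauCombEquiv.symm φ)) (landauComb (landauCombEquiv.symm ψ)) := rfl

lemma landauComb_symm_eq {φ : landauSubspace} {u : ℂ → Spinor} (hu : u ∈ landauSpan)
    (h : (φ : L2Spinor) =ᵐ[volume] u) : landauComb (landauCombEquiv.symm φ) = u := by
  have h1 := coeFn_landauCombLp (landauCombEquiv.symm φ)
  rw [← coe_landauCombEquiv, LinearEquiv.apply_symm_apply] at h1
  exact ((contDiff_of_mem_spinorGauss (landauSpan_le (landauComb_mem _))).continuous.ae_eq_iff_eq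
    volume (contDiff_of_mem_spinorGauss (landauSpan_le hu)).continuous).1 (h1.symm.trans h)

lemma landauCoeff_coe (φ : landauSubspace) : landauCoeff φ = landauCombEquiv.symm φ := by
  funext p
  rw [← landauCoeff_landauCombLp, ← coe_landauCombEquiv, LinearEquiv.apply_symm_apply]

/-- The diagonal part that is left from the kinetic energy in the ground state representation. -/
noncomputable def kineticRest (Z : ℝ) (p : ℤ × ℕ) : ℝ :=
  2 * √(landauLevel p.1 p.2) - Z / 2 * (landauRate p + landauRate (lowerPair p))

/-- Below the critical charge the Schur test constants do not exceed the kinetic energy. -/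
lemma kineticRest_nonneg {Z : ℝ} (hZ : 0 ≤ Z) (hZc : Z ≤ criticalCharge) (p : ℤ × ℕ) :
    0 ≤ kineticRest Z p := by
  have h1 : landauRate p + landauRate (lowerPair p) ≤
      (critConst 0 + critConst 1) * √(landauLevel p.1 p.2) := critConst_mul_gammaRatio_le p.1 p.2
  have h2 := criticalCharge_mul
  have h3 := Real.sqrt_nonneg (landauLevel p.1 p.2)
  have h4 := critConst_pos 0
  have h5 := critConst_pos 1
  have h6 : Z * (critConst 0 + critConst 1) ≤ 4 := by
    rw [← h2]; gcongr
  have h7 : Z / 2 * (landauRate p + landauRate (lowerPair p)) ≤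
      Z / 2 * ((critConst 0 + critConst 1) * √(landauLevel p.1 p.2)) := by gcongr
  rw [kineticRest]
  nlinarith

/-- The contribution of a pair of indices to the ground state representation. -/
noncomputable def groundTerm (x : ℤ × ℕ → ℂ) (p : (ℤ × ℕ) × (ℤ × ℕ)) : ℝ :=
  landauCoulomb p.1 p.2 / 2 * (landauWeight p.1 * landauWeight p.2 *
    ‖x p.1 / landauWeight p.1 - x p.2 / landauWeight p.2‖ ^ 2)

lemma groundTerm_nonneg (x : ℤ × ℕ → ℂ) (p : (ℤ × ℕ) × (ℤ × ℕ)) : 0 ≤ groundTerm x p := by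
  have h1 := landauCoulomb_nonneg p.1 p.2
  have h2 := landauWeight_pos p.1
  have h3 := landauWeight_pos p.2
  rw [groundTerm]; positivity

lemma hasSum_groundTerm (c : ℤ × ℕ →₀ ℂ) : HasSum (groundTerm c)
    ((c.sum fun p a => landauRate p * ‖a‖ ^ 2) - quadForm landauCoulomb c) :=
  hasSum_groundState landauCoulomb_nonneg landauCoulomb_comm landauWeight_pos
    hasSum_landauCoulomb_mul_landauWeight c

/-- The terms of the ground state representation of `(ψ, W_Z ψ)`: the rest of the kinetic energy,
and the contributions of the upper and of the lower component. -/
noncomputable def formTerm (Z : ℝ) :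
    (ℤ × ℕ) ⊕ ((ℤ × ℕ) × (ℤ × ℕ)) ⊕ ((ℤ × ℕ) × (ℤ × ℕ)) → (ℤ × ℕ → ℂ) → ℝ
  | .inl p, x => kineticRest Z p * ‖x p‖ ^ 2
  | .inr (.inl p), x => Z / 2 * groundTerm x p
  | .inr (.inr p), x => Z / 2 * groundTerm (Function.extend lowerPair x 0) p

/-- The ground state representation of the form, for every `Z`; its terms are nonnegative for
`0 ≤ Z ≤ Z_c`. -/
lemma hasSum_formTerm (Z : ℝ) (c : ℤ × ℕ →₀ ℂ) :
    HasSum (fun k => formTerm Z k c) (weylForm Z (landauComb c) (landauComb c)).re := by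
  have h1 : HasSum (fun p => kineticRest Z p * ‖c p‖ ^ 2)
      (c.sum fun p a => kineticRest Z p * ‖a‖ ^ 2) :=
    hasSum_sum_of_ne_finset_zero fun p hp => by simp [Finsupp.notMem_support_iff.1 hp]
  have h2 := (hasSum_groundTerm c).mul_left (Z / 2)
  have h3 := (hasSum_groundTerm (c.mapDomain lowerPair)).mul_left (Z / 2)
  have e : ⇑(c.mapDomain lowerPair) = Function.extend lowerPair c 0 := by
    funext p
    by_cases hp : ∃ p', lowerPair p' = p
    · obtain ⟨p', rfl⟩ := hp
      rw [Finsupp.mapDomain_apply lowerPair_injective, lowerPair_injective.extend_apply]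
    · rw [Finsupp.mapDomain_of_notMem_range _ _ (by simpa using hp), Function.extend_apply' _ _ _ hp]
      rfl
  rw [e, Finsupp.sum_mapDomain_index_inj lowerPair_injective] at h3
  have h23 : HasSum (fun k => formTerm Z (.inr k) c) _ :=
    HasSum.sum (f := fun k => formTerm Z (.inr k) c) h2 h3
  have h := HasSum.sum (f := fun k => formTerm Z k c) h1 h23
  convert! h using 1
  rw [re_weylForm_landauComb]
  simp only [Finsupp.sum, kineticRest, sub_mul, mul_add, add_mul, mul_sub, Finset.mul_sum]
  rw [Finset.sum_sub_distrib, Finset.sum_add_distrib]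
  simp only [mul_assoc]
  ring

lemma formTerm_nonneg {Z : ℝ} (hZ : 0 ≤ Z) (hZc : Z ≤ criticalCharge)
    (k : (ℤ × ℕ) ⊕ ((ℤ × ℕ) × (ℤ × ℕ)) ⊕ ((ℤ × ℕ) × (ℤ × ℕ))) (x : ℤ × ℕ → ℂ) :
    0 ≤ formTerm Z k x := by
  rcases k with p | p | p
  · exact mul_nonneg (kineticRest_nonneg hZ hZc p) (by positivity)
  · exact mul_nonneg (by positivity) (groundTerm_nonneg _ _)
  · exact mul_nonneg (by positivity) (groundTerm_nonneg _ _)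

lemma continuous_formTerm (Z : ℝ)
    (k : (ℤ × ℕ) ⊕ ((ℤ × ℕ) × (ℤ × ℕ)) ⊕ ((ℤ × ℕ) × (ℤ × ℕ))) :
    Continuous fun ψ : L2Spinor => formTerm Z k (landauCoeff ψ) := by
  have h0 := continuous_landauCoeff
  have h1 : ∀ p, Continuous fun ψ : L2Spinor => Function.extend lowerPair (landauCoeff ψ) 0 p := by
    intro p
    by_cases hp : ∃ p', lowerPair p' = p
    · obtain ⟨p', rfl⟩ := hp
      simp only [lowerPair_injective.extend_apply]
      exact h0 p'
    · simp only [Function.extend_apply' _ _ _ hp]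
      exact continuous_const
  rcases k with p | p | p <;> simp only [formTerm, groundTerm]
  · exact continuous_const.mul ((h0 p).norm.pow 2)
  · exact continuous_const.mul (continuous_const.mul (continuous_const.mul
      ((((h0 _).div_const _).sub ((h0 _).div_const _)).norm.pow 2)))
  · exact continuous_const.mul (continuous_const.mul (continuous_const.mul
      ((((h1 _).div_const _).sub ((h1 _).div_const _)).norm.pow 2)))

lemma re_weylForm_nonneg {Z : ℝ} (hZ : 0 ≤ Z) (hZc : Z ≤ criticalCharge) (c : ℤ × ℕ →₀ ℂ) :
    0 ≤ (weylForm Z (landauComb c) (landauComb c)).re :=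
  (hasSum_formTerm Z c).nonneg fun k => formTerm_nonneg hZ hZc k _

/-- The Coulomb energy. -/
noncomputable def coulombEnergy (u : ℂ → Spinor) : ℝ := ∫ x, ‖x‖⁻¹ * ‖u x‖ ^ 2

lemma coulombEnergy_nonneg (u : ℂ → Spinor) : 0 ≤ coulombEnergy u :=
  integral_nonneg fun x => by positivity

lemma re_weylForm_eq (Z : ℝ) {u : ℂ → Spinor} (hu : u ∈ spinorGauss) :
    (weylForm Z u u).re = (weylForm 0 u u).re - Z * coulombEnergy u := by
  have h : weylForm Z u u = weylForm 0 u u - Z * (coulombEnergy u : ℂ) := by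
    have e : (coulombEnergy u : ℂ) = ∫ x, ((‖x‖⁻¹ : ℝ) : ℂ) * inner ℂ (u x) (u x) := by
      rw [coulombEnergy, ← integral_complex_ofReal]
      congr 1
      funext x
      rw [inner_self_eq_norm_sq_to_K]
      push_cast
      rfl
    rw [e, weylForm, weylForm]
    simp_rw [inner_weyl Z u]
    rw [integral_sub (integrable_inner hu (weyl_zero_mem_spinorGauss hu))
      ((integrable_coulomb hu hu).const_mul _), integral_const_mul]
  rw [h, Complex.sub_re, Complex.re_ofReal_mul, Complex.ofReal_re]

/-- A nonzero finite sequence is not a multiple of the (nowhere vanishing) optimal weight, so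
the form is strictly positive even at the critical charge. -/
lemma re_weylForm_pos {Z : ℝ} (hZc : Z ≤ criticalCharge) {c : ℤ × ℕ →₀ ℂ} (hc : c ≠ 0) :
    0 < (weylForm Z (landauComb c) (landauComb c)).re := by
  have hpos : ∀ Z, 0 < Z → Z ≤ criticalCharge →
      0 < (weylForm Z (landauComb c) (landauComb c)).re := by
    intro Z hZ hZc
    obtain ⟨⟨m, n⟩, hp⟩ := Finsupp.support_nonempty_iff.2 hc
    have hinj : Function.Injective fun n : ℕ => (m, n) := Prod.mk_right_injective m
    obtain ⟨n', hn'⟩ := Infinite.exists_notMem_finset (c.support.preimage _ hinj.injOn)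
    rw [Finset.mem_preimage, Finsupp.notMem_support_iff] at hn'
    -- `n'` lies outside the support, so that the term of `(m, n)` and `(m, n')` does not vanish
    refine lt_of_lt_of_le ?_ (le_hasSum (hasSum_formTerm Z c) (.inr (.inl ((m, n), (m, n'))))
      fun k _ => formTerm_nonneg hZ.le hZc k _)
    have h1 := landauWeight_pos (m, n)
    have h2 := landauWeight_pos (m, n')
    have h3 : 0 < landauCoulomb (m, n) (m, n') := by
      simpa [landauCoulomb] using coulombMatrix_pos m.natAbs n n'
    have h4 : 0 < ‖c (m, n) / landauWeight (m, n)‖ := by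
      rw [norm_pos_iff]
      exact div_ne_zero (Finsupp.mem_support_iff.1 hp) (by exact_mod_cast h1.ne')
    simp only [formTerm, groundTerm, hn', zero_div, sub_zero]
    positivity
  rcases lt_or_ge 0 Z with h | h
  · exact hpos Z h hZc
  · -- for `Z ≤ 0` compare with the critical charge
    have h1 := hpos _ criticalCharge_pos le_rfl
    have hu := landauSpan_le (landauComb_mem c)
    rw [re_weylForm_eq _ hu] at h1 ⊢
    have h2 := coulombEnergy_nonneg (landauComb c)
    nlinarith [criticalCharge_pos]

lemma tendsto_landauForm_zero {Z : ℝ} (hZc : Z ≤ criticalCharge) {u : ℕ → landauSubspace}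
    (hu : Tendsto (fun n => (u n : L2Spinor)) atTop (𝓝 0))
    (hc : Tendsto (fun p : ℕ × ℕ => (landauForm Z (u p.1 - u p.2) (u p.1 - u p.2)).re) atTop (𝓝 0)) :
    Tendsto (fun n => (landauForm Z (u n) (u n)).re) atTop (𝓝 0) := by
  have hnn : ∀ Z, 0 ≤ Z → Z ≤ criticalCharge → ∀ w, 0 ≤ (landauForm Z w w).re :=
    fun Z hZ hZc w => re_weylForm_nonneg hZ hZc _
  have hsub : ∀ Z, 0 ≤ Z → Z ≤ criticalCharge →
      Tendsto (fun p : ℕ × ℕ => (landauForm Z (u p.1 - u p.2) (u p.1 - u p.2)).re) atTop (𝓝 0) →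
      Tendsto (fun n => (landauForm Z (u n) (u n)).re) atTop (𝓝 0) := by
    intro Z hZ hZc hc
    refine tendsto_form_zero_of_hasSum (t := fun k ψ => formTerm Z k (landauCoeff ψ))
      (q := fun w => (landauForm Z w w).re) (continuous_formTerm Z)
      (fun k x => formTerm_nonneg hZ hZc k _) (fun w => ?_) hu hc
    simp only [landauCoeff_coe]
    exact hasSum_formTerm Z _
  rcases le_or_gt 0 Z with h | h
  · exact hsub Z h hZc hc
  · -- for negative `Z` the form is comparable with the one for `Z = 0`
    have hE : ∀ Z w, (landauForm Z w w).re = (landauForm 0 w w).re -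
        Z * coulombEnergy (landauComb (landauCombEquiv.symm w)) := fun Z w =>
      re_weylForm_eq Z (landauSpan_le (landauComb_mem _))
    have hE0 := fun w : landauSubspace => coulombEnergy_nonneg (landauComb (landauCombEquiv.symm w))
    have hle : ∀ w, (landauForm 0 w w).re ≤ (landauForm Z w w).re := by
      intro w
      rw [hE Z]
      nlinarith [hE0 w]
    have hge : ∀ w, (landauForm Z w w).re ≤ (1 - Z / criticalCharge) * (landauForm 0 w w).re := by
      intro w
      have h1 := hnn _ criticalCharge_pos.le le_rfl w
      rw [hE] at h1
      have h2 : coulombEnergy (landauComb (landauCombEquiv.symm w)) ≤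
          (landauForm 0 w w).re / criticalCharge := by
        rw [le_div_iff₀ criticalCharge_pos]; linarith
      rw [hE Z]
      have h3 := mul_le_mul_of_nonneg_left h2 (neg_nonneg.2 h.le)
      calc _ ≤ (landauForm 0 w w).re + -Z * ((landauForm 0 w w).re / criticalCharge) := by linarith
        _ = _ := by ring
    have h0 := hnn 0 le_rfl criticalCharge_pos.le
    have h1 := hsub 0 le_rfl criticalCharge_pos.le
      (squeeze_zero (fun p => h0 _) (fun p => hle _) hc)
    refine squeeze_zero (fun n => (h0 _).trans (hle _)) (fun n => hge _) ?_
    simpa using h1.const_mul (1 - Z / criticalCharge)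

lemma exists_closedForm {Z : ℝ} (hZc : Z ≤ criticalCharge) :
    ∃ t : SesqForm L2Spinor,
      t.domain.topologicalClosure = landauSubspace.topologicalClosure ∧
      (∀ (φ ψ : t.domain), ∀ u ∈ landauSpan, ∀ v ∈ landauSpan,
        (φ : L2Spinor) =ᵐ[volume] u → (ψ : L2Spinor) =ᵐ[volume] v →
          t.form φ ψ = weylForm Z u v) ∧
      t.IsCore landauSubspace ∧ t.IsHermitian ∧ t.IsBoundedBelow ∧ t.IsClosed := by
  obtain ⟨t, h1, h2, h3, h4⟩ := exists_form_closure landauSubspace (landauForm Z)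
    (fun φ ψ => weylForm_conj_symm Z (landauComb_mem _) (landauComb_mem _))
    (fun φ => by
      rcases eq_or_ne (landauCombEquiv.symm φ) 0 with h | h
      · rw [landauForm_apply, h, re_weylForm_landauComb]
        simp [quadForm]
      · exact (re_weylForm_pos hZc h).le)
    (fun u => tendsto_landauForm_zero hZc)
  refine ⟨t, le_antisymm ?_ (Submodule.topologicalClosure_mono h3.1), ?_, h3, h4⟩
  · exact Submodule.topologicalClosure_minimal _ h2 (Submodule.isClosed_topologicalClosure _)
  · intro φ ψ u hu v hv hφ hψ
    rw [h1 φ ψ ⟨φ, u, hu, hφ⟩ ⟨ψ, v, hv, hψ⟩ rfl rfl, landauForm_apply]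
    congr 1
    · exact landauComb_symm_eq hu hφ
    · exact landauComb_symm_eq hv hψ

/-! ### Instability for supercritical charges -/

lemma integral_norm_sq_landauComb (c : ℤ × ℕ →₀ ℂ) :
    ∫ x, ‖landauComb c x‖ ^ 2 = c.sum fun _ a => ‖a‖ ^ 2 := by
  have h1 : (∫ x, inner ℂ (landauComb c x) (landauComb c x)) =
      inner ℂ (landauCombLp c) (landauCombLp c) := by
    rw [L2.inner_def]
    refine integral_congr_ae ?_
    filter_upwards [coeFn_landauCombLp c] with x hx
    rw [hx]
  have h2 : (∫ x, inner ℂ (landauComb c x) (landauComb c x)) =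
      ((∫ x, ‖landauComb c x‖ ^ 2 : ℝ) : ℂ) := by
    rw [← integral_complex_ofReal]
    congr 1
    funext x
    rw [inner_self_eq_norm_sq_to_K]
    push_cast
    rfl
  have h3 : inner ℂ (landauCombLp c) (landauCombLp c) =
      c.sum fun _ a => starRingEnd ℂ a * a := by
    have hv : Orthonormal ℂ fun p : ℤ × ℕ => weylBasis (.inl p) :=
      weylBasis.orthonormal.comp (fun p : ℤ × ℕ => (.inl p : WeylIndex)) Sum.inl_injective
    exact hv.inner_finsupp_eq_sum_right c c
  have h4 : ((∫ x, ‖landauComb c x‖ ^ 2 : ℝ) : ℂ) = ((c.sum fun _ a => ‖a‖ ^ 2 : ℝ) : ℂ) := by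
    rw [← h2, h1, h3]
    simp only [Finsupp.sum, Complex.ofReal_sum]
    refine Finset.sum_congr rfl fun p _ => ?_
    rw [mul_comm, Complex.mul_conj, Complex.normSq_eq_norm_sq]
  exact_mod_cast h4

/-- The truncation of a real sequence to `{0, …, N - 1}`. -/
noncomputable def truncSeq (h : ℕ → ℝ) (N : ℕ) : ℕ →₀ ℂ :=
  Finsupp.onFinset (Finset.range N) (fun n => if n < N then (h n : ℂ) else 0) fun n hn => by
    by_contra hN
    exact hn (if_neg (by simpa using hN))

lemma sum_truncSeq {M : Type*} [AddCommMonoid M] (h : ℕ → ℝ) (N : ℕ) (g : ℕ → ℂ → M)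
    (hg : ∀ n, g n 0 = 0) :
    (truncSeq h N).sum g = ∑ n ∈ Finset.range N, g n (h n) := by
  rw [truncSeq, Finsupp.onFinset_sum _ hg]
  exact Finset.sum_congr rfl fun n hn => by rw [if_pos (Finset.mem_range.1 hn)]

/-- If the form is bounded from below, then testing it with truncated sequences in the sector of
angular momentum zero gives an inequality for the Coulomb matrices. -/
lemma sum_coulombMatrix_le {Z c : ℝ}
    (hc : ∀ u ∈ landauSpan, c * ∫ x, ‖u x‖ ^ 2 ≤ (weylForm Z u u).re) (h : ℕ → ℝ) (N : ℕ) :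
    Z / 2 * ∑ n ∈ Finset.range N, ∑ n' ∈ Finset.range N,
        (coulombMatrix 0 n n' + coulombMatrix 1 n n') * (h n * h n') ≤
      ∑ n ∈ Finset.range N, (2 * √((n : ℝ) + 1) - c) * h n ^ 2 := by
  have hi : Function.Injective fun n : ℕ => ((0 : ℤ), n) := Prod.mk_right_injective 0
  have hq : ∀ K : ℕ → ℕ → ℝ, quadForm K (truncSeq h N) =
      ∑ n ∈ Finset.range N, ∑ n' ∈ Finset.range N, K n n' * (h n * h n') := by
    intro K
    rw [quadForm, sum_truncSeq _ _ _ (fun n => by simp)]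
    refine Finset.sum_congr rfl fun n _ => ?_
    rw [sum_truncSeq _ _ _ (fun n => by simp)]
    refine Finset.sum_congr rfl fun n' _ => ?_
    rw [Complex.conj_ofReal, ← Complex.ofReal_mul, Complex.ofReal_re, mul_comm]
  have := hc _ (landauComb_mem ((truncSeq h N).mapDomain fun n => ((0 : ℤ), n)))
  rw [integral_norm_sq_landauComb, re_weylForm_landauComb, quadForm_mapDomain _ lowerPair_injective,
    quadForm_mapDomain _ hi, quadForm_mapDomain _ hi, hq, hq, Finsupp.sum_mapDomain_index_inj hi,
    Finsupp.sum_mapDomain_index_inj hi, sum_truncSeq _ _ _ (fun n => by simp),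
    sum_truncSeq _ _ _ (fun n => by simp), ← Finset.sum_add_distrib] at this
  simp only [← Finset.sum_add_distrib, ← add_mul] at this
  simp only [landauCoulomb, lowerPair, lowerIndex, landauLevel] at this
  norm_num at this
  simp only [sub_mul]
  rw [Finset.sum_sub_distrib, ← Finset.mul_sum (a := c)]
  linarith

lemma schurSeq_one_eq {x : ℝ} (hx : 0 < x) (n : ℕ) :
    schurSeq 1 (x + 1 / 2) n = gammaRatio (n + x) / √((n : ℝ) + 1) * schurSeq 0 x n := by
  have h1 := (Real.Gamma_pos_of_pos (show (0 : ℝ) < n + x by positivity)).ne'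
  have h2 : √((n.factorial : ℝ) * (n + 1).factorial) =
      √((n : ℝ) + 1) * √((n.factorial : ℝ) * (n + 0).factorial) := by
    rw [← Real.sqrt_mul (by positivity), Nat.factorial_succ, add_zero]
    congr 1
    push_cast
    ring
  rw [schurSeq, schurSeq, gammaRatio, h2, ← add_assoc]
  have h3 : √((n.factorial : ℝ) * (n + 0).factorial) ≠ 0 := by positivity
  field_simp

lemma schurSeq_one_le {x : ℝ} (hx : 0 < x) (hx1 : x ≤ 1) (n : ℕ) :
    schurSeq 1 (x + 1 / 2) n ≤ schurSeq 0 x n := by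
  rw [schurSeq_one_eq hx]
  refine mul_le_of_le_one_left (schurSeq_pos 0 hx n).le ?_
  rw [div_le_one (by positivity)]
  exact (gammaRatio_le_sqrt (by positivity)).trans (Real.sqrt_le_sqrt (by linarith))

lemma schurSeq_zero_eq (x : ℝ) (n : ℕ) : schurSeq 0 x n = Real.Gamma (n + x) / n.factorial := by
  rw [schurSeq, add_zero, Real.sqrt_mul_self (by positivity)]

lemma schurSeq_zero_succ_le {x : ℝ} (hx : 0 < x) (hx1 : x < 1) (n : ℕ) :
    schurSeq 0 x (n + 1) ≤ ((n : ℝ) + 1) ^ (x - 1) := by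
  have h := Real.Gamma_mul_add_mul_le_rpow_Gamma_mul_rpow_Gamma
    (show (0 : ℝ) < n + 1 by positivity) (show (0 : ℝ) < n + 2 by positivity)
    (a := 1 - x) (b := x) (by linarith) hx (by ring)
  have h1 : Real.Gamma (n + 2) = (n + 1) * Real.Gamma (n + 1) := by
    rw [← Real.Gamma_add_one (by positivity)]; ring_nf
  have h2 : Real.Gamma (n + 1) = n.factorial := Real.Gamma_nat_eq_factorial n
  have h3 : (0 : ℝ) < n.factorial := by positivity
  rw [show (1 - x) * ((n : ℝ) + 1) + x * (n + 2) = (n + 1 : ℕ) + x by push_cast; ring, h1, h2,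
    Real.mul_rpow (by positivity) h3.le] at h
  rw [schurSeq_zero_eq, div_le_iff₀ (by positivity), Nat.factorial_succ]
  refine h.trans (le_of_eq ?_)
  have h4 : (n.factorial : ℝ) ^ (1 - x) * (n.factorial : ℝ) ^ x = n.factorial := by
    rw [← Real.rpow_add h3]; simp
  have h5 : ((n : ℝ) + 1) ^ x = ((n : ℝ) + 1) ^ (x - 1) * (n + 1) := by
    rw [← Real.rpow_add_one (by positivity)]; ring_nf
  push_cast
  linear_combination ((n : ℝ) + 1) ^ x * h4 + n.factorial * h5

lemma summable_sqrt_mul_schurSeq_sq {x : ℝ} (hx : 0 < x) (hx1 : x < 1 / 4) :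
    Summable fun n : ℕ => √((n : ℝ) + 1) * schurSeq 0 x n ^ 2 := by
  rw [← summable_nat_add_iff 1]
  have hs : Summable fun n : ℕ => 2 * ((n + 1 : ℕ) : ℝ) ^ (2 * x - 3 / 2) :=
    ((summable_nat_add_iff 1).2 (Real.summable_nat_rpow.2 (by linarith))).mul_left 2
  refine hs.of_nonneg_of_le (fun n => by positivity) fun n => ?_
  have h1 := schurSeq_zero_succ_le hx (by linarith) n
  have h0 := schurSeq_pos 0 hx (n + 1)
  have h2 : √(((n + 1 : ℕ) : ℝ) + 1) ≤ 2 * ((n : ℝ) + 1) ^ (1 / 2 : ℝ) := by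
    rw [← Real.sqrt_eq_rpow]
    refine Real.sqrt_le_iff.2 ⟨by positivity, ?_⟩
    rw [mul_pow, Real.sq_sqrt (by positivity)]
    push_cast
    linarith [(by positivity : (0 : ℝ) ≤ n)]
  calc _ ≤ 2 * ((n : ℝ) + 1) ^ (1 / 2 : ℝ) * (((n : ℝ) + 1) ^ (x - 1)) ^ 2 := by gcongr
    _ = _ := by
      rw [← Real.rpow_natCast, ← Real.rpow_mul (by positivity), mul_assoc,
        ← Real.rpow_add (by positivity)]
      push_cast
      congr 2
      ring

lemma le_sqrt_mul_schurSeq_sq (n : ℕ) :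
    1 / ((n : ℝ) + 1) ≤ √((n : ℝ) + 1) * schurSeq 0 (1 / 4) n ^ 2 := by
  have hp : (0 : ℝ) < n + 1 / 4 := by positivity
  have h := Real.Gamma_mul_add_mul_le_rpow_Gamma_mul_rpow_Gamma hp
    (show (0 : ℝ) < n + 5 / 4 by positivity) (a := 1 / 4) (b := 3 / 4) (by norm_num) (by norm_num)
    (by norm_num)
  have h1 : Real.Gamma (n + 5 / 4) = (n + 1 / 4) * Real.Gamma (n + 1 / 4) := by
    rw [← Real.Gamma_add_one hp.ne']; ring_nf
  have hΓ := Real.Gamma_pos_of_pos hp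
  rw [show 1 / 4 * ((n : ℝ) + 1 / 4) + 3 / 4 * (n + 5 / 4) = n + 1 by ring,
    Real.Gamma_nat_eq_factorial, h1, Real.mul_rpow hp.le hΓ.le, mul_left_comm,
    ← Real.rpow_add hΓ] at h
  norm_num at h
  have h2 : 1 ≤ ((n : ℝ) + 1) ^ (3 / 4 : ℝ) * schurSeq 0 (1 / 4) n := by
    rw [schurSeq_zero_eq, ← mul_div_assoc, one_le_div (by positivity)]
    refine h.trans ?_
    have : ((n : ℝ) + 1 / 4) ^ (3 / 4 : ℝ) ≤ ((n : ℝ) + 1) ^ (3 / 4 : ℝ) := by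
      gcongr; norm_num
    gcongr
  have h3 : (((n : ℝ) + 1) ^ (3 / 4 : ℝ)) ^ 2 = (n + 1) * √((n : ℝ) + 1) := by
    rw [← Real.rpow_natCast, ← Real.rpow_mul (by positivity), Real.sqrt_eq_rpow]
    nth_rw 2 [← Real.rpow_one ((n : ℝ) + 1)]
    rw [← Real.rpow_add (by positivity)]
    norm_num
  rw [div_le_iff₀ (by positivity)]
  have h4 := one_le_pow₀ (n := 2) h2
  rw [mul_pow, h3] at h4
  linarith

/-- The rate at which the Coulomb matrices of both components act on the trial sequences, relative
to the trial sequence of the upper component. -/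
noncomputable def trialRate (x : ℝ) (n : ℕ) : ℝ :=
  schurConst 0 x * gammaRatio (n + x) +
    schurConst 1 (x + 1 / 2) * gammaRatio (n + (x + 1 / 2)) * (gammaRatio (n + x) ^ 2 / (n + 1))

lemma schurConst_pos {a : ℕ} {x : ℝ} (hx : 0 < x) (hxa : x < a + 1 / 2) : 0 < schurConst a x := by
  have h1 := Real.Gamma_pos_of_pos hx
  have h2 := Real.Gamma_pos_of_pos (show 0 < x + 1 / 2 by linarith)
  have h3 := Real.Gamma_pos_of_pos (show 0 < a + 1 / 2 - x by linarith)
  have h4 := Real.Gamma_pos_of_pos (show 0 < a + 1 - x by linarith)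
  rw [schurConst]; positivity

/-- The passage to infinite trial sequences in `sum_coulombMatrix_le`. -/
lemma sum_trialRate_le {Z c x : ℝ} (hZ : 0 < Z) (hx : 0 < x) (hx1 : x < 1 / 4)
    (hc : ∀ u ∈ landauSpan, c * ∫ x, ‖u x‖ ^ 2 ≤ (weylForm Z u u).re) {e : ℝ}
    (he : HasSum (fun n : ℕ => (2 * √((n : ℝ) + 1) - c) * schurSeq 0 x n ^ 2) e) (M : ℕ) :
    ∑ n ∈ Finset.range M, Z / 2 * trialRate x n * schurSeq 0 x n ^ 2 ≤ e := by
  set h := schurSeq 0 x with hh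
  set k := schurSeq 1 (x + 1 / 2) with hk
  have hpos : ∀ n, 0 < h n := schurSeq_pos 0 hx
  have kpos : ∀ n, 0 < k n := schurSeq_pos 1 (by linarith)
  have hkh : ∀ n, k n ≤ h n := schurSeq_one_le hx (by linarith)
  have l1 : ∀ n, Tendsto (fun N => ∑ n' ∈ Finset.range N, coulombMatrix 0 n n' * h n') atTop
      (𝓝 (schurConst 0 x * gammaRatio (n + x) * h n)) := fun n =>
    (hasSum_coulombMatrix_mul_schurSeq 0 n hx (by norm_num; linarith)).tendsto_sum_nat
  have l2 : ∀ n, Tendsto (fun N => ∑ n' ∈ Finset.range N, coulombMatrix 1 n n' * k n') atTop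
      (𝓝 (schurConst 1 (x + 1 / 2) * gammaRatio (n + (x + 1 / 2)) * k n)) := fun n =>
    (hasSum_coulombMatrix_mul_schurSeq 1 n (by linarith) (by norm_num; linarith)).tendsto_sum_nat
  have l3 : Tendsto (fun N => ∑ n ∈ Finset.range M, Z / 2 *
      (h n * (∑ n' ∈ Finset.range N, coulombMatrix 0 n n' * h n') +
        k n * ∑ n' ∈ Finset.range N, coulombMatrix 1 n n' * k n')) atTop
      (𝓝 (∑ n ∈ Finset.range M, Z / 2 * (h n * (schurConst 0 x * gammaRatio (n + x) * h n) +
        k n * (schurConst 1 (x + 1 / 2) * gammaRatio (n + (x + 1 / 2)) * k n)))) :=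
    tendsto_finsetSum _ fun n _ => (((l1 n).const_mul _).add ((l2 n).const_mul _)).const_mul _
  have e1 : ∑ n ∈ Finset.range M, Z / 2 * trialRate x n * h n ^ 2 =
      ∑ n ∈ Finset.range M, Z / 2 * (h n * (schurConst 0 x * gammaRatio (n + x) * h n) +
        k n * (schurConst 1 (x + 1 / 2) * gammaRatio (n + (x + 1 / 2)) * k n)) := by
    refine Finset.sum_congr rfl fun n _ => ?_
    have hk2 : k n ^ 2 = gammaRatio (n + x) ^ 2 / (n + 1) * h n ^ 2 := by
      rw [hk, hh, schurSeq_one_eq hx, mul_pow, div_pow, Real.sq_sqrt (by positivity)]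
    rw [trialRate]
    linear_combination (-(Z / 2 * schurConst 1 (x + 1 / 2) * gammaRatio (n + (x + 1 / 2)))) * hk2
  rw [e1]
  refine le_of_tendsto_of_tendsto l3 he.tendsto_sum_nat ((eventually_ge_atTop M).mono fun N hN => ?_)
  refine le_trans ?_ (sum_coulombMatrix_le hc h N)
  rw [Finset.mul_sum]
  have hK : ∀ a n n', 0 ≤ coulombMatrix a n n' := fun a n n' => (coulombMatrix_pos a n n').le
  calc _ ≤ ∑ n ∈ Finset.range M, Z / 2 * ∑ n' ∈ Finset.range N,
        (coulombMatrix 0 n n' + coulombMatrix 1 n n') * (h n * h n') := by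
        refine Finset.sum_le_sum fun n _ => mul_le_mul_of_nonneg_left ?_ (by linarith)
        rw [Finset.mul_sum, Finset.mul_sum, ← Finset.sum_add_distrib]
        refine Finset.sum_le_sum fun n' _ => ?_
        have h1 := mul_le_mul (hkh n) (hkh n') (kpos n').le (hpos n).le
        have h2 := mul_le_mul_of_nonneg_left h1 (hK 1 n n')
        linarith
    _ ≤ _ := by
        refine Finset.sum_le_sum_of_subset_of_nonneg (Finset.range_mono hN) fun n _ _ => ?_
        refine mul_nonneg (by linarith) (Finset.sum_nonneg fun n' _ => ?_)
        exact mul_nonneg (add_nonneg (hK _ _ _) (hK _ _ _)) (mul_pos (hpos n) (hpos n')).le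

/-- In the inequality for infinite trial sequences, negative terms of the tail may be dropped. -/
lemma sum_excess_nonneg {Z c x : ℝ} (hZ : 0 < Z) (hx : 0 < x) (hx1 : x < 1 / 4)
    (hc : ∀ u ∈ landauSpan, c * ∫ x, ‖u x‖ ^ 2 ≤ (weylForm Z u u).re) {M : ℕ}
    (hM : ∀ n, M ≤ n → 2 * √((n : ℝ) + 1) - c - Z / 2 * trialRate x n ≤ 0) :
    0 ≤ ∑ n ∈ Finset.range M,
      (2 * √((n : ℝ) + 1) - c - Z / 2 * trialRate x n) * schurSeq 0 x n ^ 2 := by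
  have hs := summable_sqrt_mul_schurSeq_sq hx hx1
  have hs' : Summable fun n : ℕ => (2 * √((n : ℝ) + 1) - c) * schurSeq 0 x n ^ 2 := by
    refine Summable.of_norm_bounded (hs.mul_left (2 + |c|)) fun n => ?_
    have h1 : 1 ≤ √((n : ℝ) + 1) := Real.one_le_sqrt.2 (by linarith [(by positivity : (0 : ℝ) ≤ n)])
    have h2 : |2 * √((n : ℝ) + 1) - c| ≤ (2 + |c|) * √((n : ℝ) + 1) := by
      refine (abs_sub _ _).trans ?_
      rw [abs_of_nonneg (by positivity)]
      nlinarith [abs_nonneg c]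
    rw [norm_mul, Real.norm_eq_abs, Real.norm_of_nonneg (by positivity), ← mul_assoc]
    gcongr
  have he := hs'.hasSum
  set e := ∑' n : ℕ, (2 * √((n : ℝ) + 1) - c) * schurSeq 0 x n ^ 2
  have key := sum_trialRate_le hZ hx hx1 hc he
  have h1 : ∀ N, M ≤ N → (∑ n ∈ Finset.range N, (2 * √((n : ℝ) + 1) - c) * schurSeq 0 x n ^ 2) ≤
      e + ∑ n ∈ Finset.range M,
        (2 * √((n : ℝ) + 1) - c - Z / 2 * trialRate x n) * schurSeq 0 x n ^ 2 := by
    intro N hN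
    have h2 : ∑ n ∈ Finset.Ico M N,
        (2 * √((n : ℝ) + 1) - c - Z / 2 * trialRate x n) * schurSeq 0 x n ^ 2 ≤ 0 :=
      Finset.sum_nonpos fun n hn =>
        mul_nonpos_of_nonpos_of_nonneg (hM n (Finset.mem_Ico.1 hn).1) (by positivity)
    have h3 := Finset.sum_range_add_sum_Ico
      (fun n : ℕ => (2 * √((n : ℝ) + 1) - c - Z / 2 * trialRate x n) * schurSeq 0 x n ^ 2) hN
    have h4 : ∑ n ∈ Finset.range N,
        (2 * √((n : ℝ) + 1) - c - Z / 2 * trialRate x n) * schurSeq 0 x n ^ 2 =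
        (∑ n ∈ Finset.range N, (2 * √((n : ℝ) + 1) - c) * schurSeq 0 x n ^ 2) -
        ∑ n ∈ Finset.range N, Z / 2 * trialRate x n * schurSeq 0 x n ^ 2 := by
      rw [← Finset.sum_sub_distrib]
      exact Finset.sum_congr rfl fun n _ => by ring
    linarith [key N]
  have := le_of_tendsto he.tendsto_sum_nat ((eventually_ge_atTop M).mono h1)
  linarith

lemma continuousAt_Gamma_of_pos {y : ℝ} (hy : 0 < y) : ContinuousAt Real.Gamma y :=
  (Real.differentiableAt_Gamma fun m => by
    have : (0 : ℝ) ≤ m := by positivity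
    linarith).continuousAt

lemma ContinuousAt.gamma_comp {f : ℝ → ℝ} {y : ℝ} (hf : ContinuousAt f y) (h : 0 < f y) :
    ContinuousAt (fun x => Real.Gamma (f x)) y :=
  ContinuousAt.comp (f := f) (continuousAt_Gamma_of_pos h) hf

lemma ContinuousAt.gammaRatio_comp {f : ℝ → ℝ} {y : ℝ} (hf : ContinuousAt f y) (h : 0 < f y) :
    ContinuousAt (fun x => gammaRatio (f x)) y :=
  ((hf.add continuousAt_const).gamma_comp (by simp; linarith)).div (hf.gamma_comp h)
    (Real.Gamma_pos_of_pos h).ne'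

lemma ContinuousAt.schurConst_comp {f : ℝ → ℝ} {y : ℝ} (a : ℕ) (hf : ContinuousAt f y) (h : 0 < f y)
    (h' : f y < a + 1 / 2) : ContinuousAt (fun x => schurConst a (f x)) y :=
  (((continuousAt_const.sub hf).gamma_comp (by simp; linarith)).mul (hf.gamma_comp h)).div
    (((continuousAt_const.sub hf).gamma_comp (by simp; linarith)).mul
      ((hf.add continuousAt_const).gamma_comp (by simp; linarith)))
    (mul_pos (Real.Gamma_pos_of_pos (by linarith)) (Real.Gamma_pos_of_pos (by linarith))).ne'

lemma continuousAt_trialRate (n : ℕ) : ContinuousAt (fun x => trialRate x n) (1 / 4) := by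
  have h1 : ContinuousAt (fun x : ℝ => schurConst 0 x) (1 / 4) :=
    continuousAt_id.schurConst_comp 0 (by norm_num) (by norm_num)
  have h2 : ContinuousAt (fun x : ℝ => schurConst 1 (x + 1 / 2)) (1 / 4) :=
    (continuousAt_id.add continuousAt_const).schurConst_comp 1 (by norm_num) (by norm_num)
  have h3 : ContinuousAt (fun x : ℝ => gammaRatio (n + x)) (1 / 4) :=
    (continuousAt_const.add continuousAt_id).gammaRatio_comp (by simp; positivity)
  have h4 : ContinuousAt (fun x : ℝ => gammaRatio (n + (x + 1 / 2))) (1 / 4) :=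
    (continuousAt_const.add (continuousAt_id.add continuousAt_const)).gammaRatio_comp
      (by simp; positivity)
  exact (h1.mul h3).add ((h2.mul h4).mul ((h3.pow 2).div_const _))

lemma continuousAt_schurSeq (n : ℕ) : ContinuousAt (fun x => schurSeq 0 x n) (1 / 4) :=
  ((continuousAt_const.add continuousAt_id).gamma_comp (by simp; positivity)).div_const _

lemma le_trialRate {x : ℝ} (hx : 0 < x) (hx1 : x ≤ 1 / 4) (n : ℕ) :
    (schurConst 0 x + schurConst 1 (x + 1 / 2)) * ((n : ℝ) / (n + 1)) ^ 3 * √((n : ℝ) + 1) ≤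
      trialRate x n := by
  have hn : (0 : ℝ) ≤ n := by positivity
  set s := √((n : ℝ) + 1) with hs
  set θ : ℝ := n / (n + 1) with hθ
  have hs0 : 0 < s := by positivity
  have hs2 : s ^ 2 = n + 1 := Real.sq_sqrt (by positivity)
  have hθ0 : 0 ≤ θ := by positivity
  have hθ1 : θ ≤ 1 := by rw [hθ, div_le_one (by positivity)]; linarith
  have hθs : (θ * s) ^ 2 = n ^ 2 / (n + 1) := by
    rw [mul_pow, hs2, hθ]; field_simp
  have hR : ∀ t : ℝ, n < t → (n : ℝ) ^ 2 / (n + 1) ≤ t ^ 2 / (t + 1 / 2) →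
      θ * s ≤ gammaRatio t := by
    intro t ht h
    refine le_of_sq_le_sq ?_ (gammaRatio_pos (by linarith)).le
    rw [hθs]
    exact h.trans (le_gammaRatio_sq (by linarith))
  have h1 : θ * s ≤ gammaRatio (n + x) := by
    refine hR _ (by linarith) ?_
    rw [div_le_div_iff₀ (by positivity) (by positivity)]
    nlinarith [mul_nonneg hn hx.le, mul_nonneg hn hn, mul_nonneg (mul_nonneg hn hn) hx.le]
  have h2 : θ * s ≤ gammaRatio (n + (x + 1 / 2)) := by
    refine hR _ (by linarith) ?_
    rw [div_le_div_iff₀ (by positivity) (by positivity)]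
    nlinarith [mul_nonneg hn hx.le, mul_nonneg hn hn, mul_nonneg (mul_nonneg hn hn) hx.le]
  have h3 : θ ^ 2 ≤ gammaRatio (n + x) ^ 2 / (n + 1) := by
    rw [le_div_iff₀ (by positivity), ← hs2, ← mul_pow]
    gcongr
  have k0 : 0 < schurConst 0 x := schurConst_pos hx (by norm_num; linarith)
  have k1 : 0 < schurConst 1 (x + 1 / 2) := schurConst_pos (by linarith) (by norm_num; linarith)
  have hθ3 : θ ^ 3 ≤ θ := pow_le_of_le_one hθ0 hθ1 (by norm_num)
  have k2 : 0 < gammaRatio (n + (x + 1 / 2)) := gammaRatio_pos (by positivity)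
  rw [trialRate]
  calc _ = schurConst 0 x * (θ ^ 3 * s) + schurConst 1 (x + 1 / 2) * (θ * s) * θ ^ 2 := by ring
    _ ≤ schurConst 0 x * (θ * s) + schurConst 1 (x + 1 / 2) * (θ * s) * θ ^ 2 := by gcongr
    _ ≤ _ := by gcongr

/-- For `Z > Z_c` the form is unbounded from below: the trial sequences `Γ(n + x) / n!` with
`x → 1/4` have a relative excess of potential energy, while their kinetic energy diverges
logarithmically in the limit. -/
lemma exists_weylForm_lt {Z : ℝ} (hZ : criticalCharge < Z) (c : ℝ) :
    ∃ u ∈ landauSpan, (weylForm Z u u).re < c * ∫ x, ‖u x‖ ^ 2 := by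
  by_contra! hc
  have hZ0 : 0 < Z := criticalCharge_pos.trans hZ
  -- the rate of the potential energy at the critical exponent exceeds the kinetic one, which is `2`
  have hcrit : 4 < Z * (critConst 0 + critConst 1) := by
    rw [← criticalCharge_mul]
    exact mul_lt_mul_of_pos_right hZ (add_pos (critConst_pos 0) (critConst_pos 1))
  have e0 : critConst 0 = schurConst 0 (1 / 4) := by simp [critConst, critExp]
  have e1 : critConst 1 = schurConst 1 (1 / 4 + 1 / 2) := by
    rw [critConst, critExp]; norm_num
  obtain ⟨δ, hδ, hδ'⟩ : ∃ δ : ℝ, 0 < δ ∧ 2 + 4 * δ < Z / 2 * (critConst 0 + critConst 1) :=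
    ⟨(Z / 2 * (critConst 0 + critConst 1) - 2) / 8, by linarith, by linarith⟩
  have hcont : ContinuousAt (fun x : ℝ => Z / 2 * (schurConst 0 x + schurConst 1 (x + 1 / 2)))
      (1 / 4) := by
    have h1 : ContinuousAt (fun x : ℝ => schurConst 0 x) (1 / 4) :=
      continuousAt_id.schurConst_comp 0 (by norm_num) (by norm_num)
    have h2 : ContinuousAt (fun x : ℝ => schurConst 1 (x + 1 / 2)) (1 / 4) :=
      (continuousAt_id.add continuousAt_const).schurConst_comp 1 (by norm_num) (by norm_num)
    exact continuousAt_const.mul (h1.add h2)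
  rw [e0, e1] at hδ'
  have hev : ∀ᶠ x in 𝓝 (1 / 4 : ℝ), 2 + 4 * δ < Z / 2 * (schurConst 0 x + schurConst 1 (x + 1 / 2)) :=
    hcont.eventually (lt_mem_nhds hδ')
  -- from some index on, the energy densities are negative, uniformly in `x`
  have hθ : ∀ᶠ n : ℕ in atTop, 2 + 2 * δ ≤ (2 + 4 * δ) * ((n : ℝ) / (n + 1)) ^ 3 := by
    have h1 : Tendsto (fun n : ℕ => (2 + 4 * δ) * ((n : ℝ) / (n + 1)) ^ 3) atTop
        (𝓝 ((2 + 4 * δ) * 1 ^ 3)) := by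
      have := tendsto_natCast_add_div 0 1
      simp only [add_zero] at this
      exact (this.pow 3).const_mul _
    exact h1.eventually (le_mem_nhds (by linarith))
  have hsq : ∀ᶠ n : ℕ in atTop, -c ≤ δ * √((n : ℝ) + 1) := by
    have h1 : Tendsto (fun n : ℕ => δ * √((n : ℝ) + 1)) atTop atTop :=
      (Real.tendsto_sqrt_atTop.comp
        (tendsto_atTop_add_const_right _ 1 tendsto_natCast_atTop_atTop)).const_mul_atTop hδ
    exact h1.eventually_ge_atTop _
  obtain ⟨n₀, hn₀⟩ := (hθ.and hsq).exists_forall_of_atTop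
  have htail : ∀ x : ℝ, 0 < x → x ≤ 1 / 4 →
      2 + 4 * δ < Z / 2 * (schurConst 0 x + schurConst 1 (x + 1 / 2)) → ∀ n, n₀ ≤ n →
      2 * √((n : ℝ) + 1) - c - Z / 2 * trialRate x n ≤ -δ * √((n : ℝ) + 1) := by
    intro x hx hx1 hxδ n hn
    obtain ⟨h1, h2⟩ := hn₀ n hn
    have h3 := mul_le_mul_of_nonneg_left (le_trialRate hx hx1 n) (half_pos hZ0).le
    have h4 : (2 + 2 * δ) * √((n : ℝ) + 1) ≤ Z / 2 * ((schurConst 0 x + schurConst 1 (x + 1 / 2)) *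
        ((n : ℝ) / (n + 1)) ^ 3 * √((n : ℝ) + 1)) := by
      calc _ ≤ (2 + 4 * δ) * ((n : ℝ) / (n + 1)) ^ 3 * √((n : ℝ) + 1) := by gcongr
        _ ≤ Z / 2 * (schurConst 0 x + schurConst 1 (x + 1 / 2)) *
            ((n : ℝ) / (n + 1)) ^ 3 * √((n : ℝ) + 1) := by gcongr
        _ = _ := by ring
    nlinarith
  set G : ℝ → ℕ → ℝ := fun x n =>
    (2 * √((n : ℝ) + 1) - c - Z / 2 * trialRate x n) * schurSeq 0 x n ^ 2 with hG
  have hGcont : ∀ n, ContinuousAt (fun x => G x n) (1 / 4) := fun n =>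
    (continuousAt_const.sub (continuousAt_const.mul (continuousAt_trialRate n))).mul
      ((continuousAt_schurSeq n).pow 2)
  -- boundedness from below survives the limit `x → 1 / 4` for partial sums, as their tails are
  -- nonpositive
  have hnonneg : ∀ M, n₀ ≤ M → 0 ≤ ∑ n ∈ Finset.range M, G (1 / 4) n := by
    intro M hM
    have ht : Tendsto (fun x => ∑ n ∈ Finset.range M, G x n) (𝓝[<] (1 / 4))
        (𝓝 (∑ n ∈ Finset.range M, G (1 / 4) n)) :=
      tendsto_finsetSum _ fun n _ => (hGcont n).tendsto.mono_left nhdsWithin_le_nhds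
    refine ge_of_tendsto ht ?_
    filter_upwards [nhdsWithin_le_nhds hev, self_mem_nhdsWithin,
      nhdsWithin_le_nhds (lt_mem_nhds (show (0 : ℝ) < 1 / 4 by norm_num))] with x hx1 hx2 hx3
    have hx2' : x < 1 / 4 := hx2
    refine sum_excess_nonneg hZ0 hx3 hx2' hc fun n hn => ?_
    have := htail x hx3 hx2'.le hx1 n (hM.trans hn)
    have h0 : 0 ≤ δ * √((n : ℝ) + 1) := by positivity
    linarith
  -- at `x = 1 / 4` the tail decreases at least like the negative of a harmonic series
  have hupper : ∀ n, n₀ ≤ n → G (1 / 4) n ≤ -δ * (1 / ((n : ℝ) + 1)) := by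
    intro n hn
    have h1 := htail (1 / 4) (by norm_num) le_rfl hδ' n hn
    have h2 := mul_le_mul_of_nonneg_right h1 (sq_nonneg (schurSeq 0 (1 / 4) n))
    have h3 := mul_le_mul_of_nonneg_left (le_sqrt_mul_schurSeq_sq n) hδ.le
    simp only [hG]
    linarith
  set B := (∑ n ∈ Finset.range n₀, G (1 / 4) n) + δ * ∑ n ∈ Finset.range n₀, 1 / ((n : ℝ) + 1)
    with hB
  have hbound : ∀ M, n₀ ≤ M → ∑ n ∈ Finset.range M, 1 / ((n : ℝ) + 1) ≤ B / δ := by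
    intro M hM
    have h1 := hnonneg M hM
    have h2 := Finset.sum_range_add_sum_Ico (G (1 / 4)) hM
    have h3 := Finset.sum_range_add_sum_Ico (fun n : ℕ => 1 / ((n : ℝ) + 1)) hM
    have h4 : ∑ n ∈ Finset.Ico n₀ M, G (1 / 4) n ≤ -δ * ∑ n ∈ Finset.Ico n₀ M, 1 / ((n : ℝ) + 1) := by
      rw [Finset.mul_sum]
      exact Finset.sum_le_sum fun n hn => hupper n (Finset.mem_Ico.1 hn).1
    rw [le_div_iff₀ hδ, ← h3, hB]
    linarith
  obtain ⟨M, hM, hM'⟩ := ((Real.tendsto_sum_range_one_div_nat_succ_atTop.eventually_gt_atTop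
    (B / δ)).and (eventually_ge_atTop n₀)).exists
  exact absurd (hbound M hM') (not_le.2 hM)

theorem theorem1 :
    ∃ E : Set ℝ → L2Spinor →L[ℂ] L2Spinor, IsSpectralMeasure freeWeyl E ∧
      (∀ u ∈ landauSpan, MemLp u 2 (volume : Measure ℂ)) ∧
      ∀ Z : ℝ,
        (∀ u ∈ landauSpan, ∀ v ∈ landauSpan,
          Integrable (fun x => inner ℂ (u x) (weyl Z v x)) (volume : Measure ℂ)) ∧
        (Z ≤ criticalCharge →
          (∀ u ∈ landauSpan, u ≠ 0 → (weylForm Z u u).im = 0 ∧ 0 < (weylForm Z u u).re) ∧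
          ∃ t : SesqForm L2Spinor,
            t.domain.topologicalClosure = LinearMap.range (E (Set.Ioi 0)).toLinearMap ∧
            (∀ (φ ψ : t.domain), ∀ u ∈ landauSpan, ∀ v ∈ landauSpan,
              (φ : L2Spinor) =ᵐ[volume] u → (ψ : L2Spinor) =ᵐ[volume] v →
                t.form φ ψ = weylForm Z u v) ∧
            t.IsCore landauSubspace ∧
            t.IsHermitian ∧ t.IsBoundedBelow ∧ t.IsClosed) ∧
        (criticalCharge < Z →
          ∀ c : ℝ, ∃ u ∈ landauSpan, (weylForm Z u u).re < c * ∫ x, ‖u x‖ ^ 2) := by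
  refine ⟨diagProj weylBasis weylEigenval, isSpectralMeasure_freeWeyl,
    fun u hu => memLp_of_mem_spinorGauss (landauSpan_le hu), fun Z =>
    ⟨fun u hu v hv => integrable_inner_weyl Z (landauSpan_le hu) (landauSpan_le hv),
      fun hZ => ⟨fun u hu hu0 => ⟨?_, ?_⟩, ?_⟩, fun hZ c => exists_weylForm_lt hZ c⟩⟩
  · exact Complex.conj_eq_iff_im.1 (weylForm_conj_symm Z hu hu).symm
  · obtain ⟨c, rfl⟩ := mem_landauSpan_iff.1 hu
    refine re_weylForm_pos hZ ?_
    rintro rfl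
    exact hu0 (map_zero _)
  · rw [range_diagProj_Ioi]
    exact exists_closedForm hZ
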